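/- **Setting.** Let $M\ge 1$, $p_1,\dots,p_M\ge 1$, $p=\prod_m p_m$, $p_{-m}=\prod_{j\ne m}p_j$. A shape is a tuple $\Xi=(\Sigma_1,\dots,\Sigma_M)$ of symmetric positive definite matrices $\Sigma_m\in\mathbb R^{p_m\times p_m}$, and for $A\in\mathbb R^{p_1\times\cdots\times p_M}$ put $\|A\|_\Xi^2=\langle [\![A;\Sigma_1^{-1},\dots,\Sigma_M^{-1}]\!],A\rangle$, where $[\![\cdot]\!]$ is the Tucker product. The tensor $t$-distribution $\mathrm{TT}(\mu,\Xi,\nu)$ has density $$\frac{\Gamma(\frac{\nu+p}{2})\prod_m|\Sigma_m|^{-p_{-m}/2}}{(\pi\nu)^{p/2}\,\Gamma(\nu/2)}\bigl(1+\|Y-\mu\|_\Xi^2/\nu\bigr)^{-(\nu+p)/2}.$$ Let $Y_i=B\bar\times_{M+1}X_i+E_i$, $i=1,\dots,n$, where $B\in\mathbb R^{p_1\times\cdots\times p_M\times q}$, $(B\bar\times_{M+1}x)_J=\sum_k B_{Jk}x_k$, the errors $E_i\sim\mathrm{TT}(0,\Xi^*,\nu^*)$ are independent, with $\nu^*>0$,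 and $(E_1,\dots,E_n)$ is independent of the predictors $(X_1,\dots,X_n)$, which are vectors of $\mathbb R^q$. Let $\mathbb X=(X_1,\dots,X_n)\in\mathbb R^{q\times n}$ and assume that $\mathbb X\mathbb X^T$ is invertible almost surely. Fix $\nu>0$ (possibly different from $\nu^*$) and $\lambda>0$. Let $\widehat B^{\mathrm{OLS}}_{Jk}=\sum_i\bigl((\mathbb X\mathbb X^T)^{-1}\mathbb X\bigr)_{ki}(Y_i)_J$, $r_j=(\widehat b_j^{\mathrm{OLS}})^{-2}$ and $P_\lambda(B)=\lambda\sum_j r_j|b_j|$. **Algorithm.** 1. $\widehat B^{\mathrm{APL}}$ is the limit of cyclic coordinate descent (in any fixed order, from any starting point), applied separately for each response entry $J$, to the problem $$\min_B\ \sum_{i}\|Y_i-B\bar\times_{M+1}X_i\|^2+P_\lambda(B).\tag{APL}$$ Put $R_i=Y_i-\widehat B^{\mathrm{APL}}\bar\times_{M+1}X_i$. 2. For given weights $w_i>0$, the update of the $m$-th matrix of a shape is $$\Sigma_m\leftarrow\frac1{np_{-m}}\sum_i w_i\,(R_i)_{(m)}\Bigl(\bigotimes_{j\ne m}\Sigma_j^{-1}\Bigr)(R_i)_{(m)}^T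 .$$ Start from any shape $\Xi^{(0)}$. In round $k$, freeze the weights $w_i=(\nu+p)/(\nu+\|R_i\|^2_{\Xi^{(k)}})$ and obtain $\Xi^{(k+1)}$ from $\Xi^{(k)}$ by performing the updates for $m=1,\dots,M$ cyclically, either through one cycle or until convergence. Repeat the rounds until convergence. An output $\widehat\Xi$ is the entrywise limit of $\Xi^{(k)}$ in a run in which these limits exist. 3. With $\widehat w_i=(\nu+p)/(\nu+\|R_i\|^2_{\widehat\Xi})$, $\widehat B^{\mathrm{OST}}$ is the limit of cyclic coordinate descent (in any fixed order of the coordinates, from any starting point) for the problem $$\min_B\ \sum_i\widehat w_i\|Y_i-B\bar\times_{M+1}X_i\|_{\widehat\Xi}^2+P_\lambda(B).\tag{OST}$$ In both coordinate descents the update of the coordinate $j=(J,k)$ is $b_j\leftarrow \dfrac{U_1}{U_2+\tau U_2/(|U_1|-\tau)}$ if $|U_1|>\tau$ and $b_j\leftarrow0$ otherwise, where $\tau=\lambda r_j/2$. Let $B_{-j}$ denote $B$ with its $j$-th entry replaced by $0$. In (OST), $U_1$ is the $(J,k)$ entry of $\sum_i\widehat w_i[\![Y_i-B_{-j}\bar\times_{M+1}X_i;\widehat\Sigma_1^{-1},\dots,\widehat\Sigma_M^{-1},X_i]\!]$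 and $U_2=\sum_i\widehat w_i x_{ik}^2\prod_m(\widehat\Sigma_m^{-1})_{J_mJ_m}$; in (APL) the same holds with $\widehat w_i=1$ and $\widehat\Sigma_m=I$. **Theorem.** Suppose $np_{-m}>p_m$ for $m=1,\dots,M$. With probability one the following hold. (a) All entries of $\widehat B^{\mathrm{OLS}}$ are nonzero, the coordinate descent in step 1 converges, and its limit $\widehat B^{\mathrm{APL}}$ is the unique global minimizer of (APL). (b) For all positive weights and every shape, each update in step 2 yields a positive definite matrix. In every run of step 2 with an output $\widehat\Xi$, all $\Xi^{(k)}$ and $\widehat\Xi$ consist of positive definite matrices, and $\widehat\Xi$ is a global minimizer, over all shapes, of $$\mathrm L_n(\Xi)=\frac n2\sum_m p_{-m}\log|\Sigma_m|+\frac{\nu+p}2\sum_i\log\bigl(1+\|R_i\|_\Xi^2/\nu\bigr).$$ (c) For every such $\widehat\Xi$, the coordinate descent in step 3 converges, and its limit $\widehat B^{\mathrm{OST}}$ is the unique global minimizer of (OST). -/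

import Mathlib

open MeasureTheory ProbabilityTheory Filter Topology

noncomputable section

namespace TensorReg

/-- Multi-indices `(j_1, …, j_M)` with `j_m` ranging over `p_m` values. -/
abbrev Idx {M : ℕ} (p : Fin M → ℕ) : Type := (m : Fin M) → Fin (p m)

/-- `M`-way tensors in `ℝ^{p_1 × ⋯ × p_M}`. -/
abbrev Tensor {M : ℕ} (p : Fin M → ℕ) : Type := Idx p → ℝ

/-- `(M+1)`-way coefficient tensors in `ℝ^{p_1 × ⋯ × p_M × q}`. -/
abbrev CoefTensor {M : ℕ} (p : Fin M → ℕ) (q : ℕ) : Type := Idx p × Fin q → ℝ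

/-- Tuples `(Σ_1, …, Σ_M)` of square matrices, `Σ_m` of size `p_m`. -/
abbrev Shape {M : ℕ} (p : Fin M → ℕ) : Type :=
  (m : Fin M) → Matrix (Fin (p m)) (Fin (p m)) ℝ

/-- Multi-indices with the `m`-th index left out: the columns of a mode-`m` matricization. -/
abbrev CoIdx {M : ℕ} (p : Fin M → ℕ) (m : Fin M) : Type :=
  (j : {j : Fin M // j ≠ m}) → Fin (p j)

/-- `p = ∏_m p_m`. -/
def totalDim {M : ℕ} (p : Fin M → ℕ) : ℕ := ∏ m, p m

/-- `p_{-m} = ∏_{j ≠ m} p_j`. -/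
def coDim {M : ℕ} (p : Fin M → ℕ) (m : Fin M) : ℕ := ∏ j ∈ Finset.univ.erase m, p j

variable {M n q : ℕ} {p : Fin M → ℕ}

/-- All the matrices `Σ_1, …, Σ_M` are symmetric positive definite. -/
def IsPD (Ξ : Shape p) : Prop := ∀ m, (Ξ m).PosDef

/-- The mode-`(M+1)` vector product of a coefficient tensor with a vector of `ℝ^q`. -/
def vecProd (B : CoefTensor p q) (x : Fin q → ℝ) : Tensor p :=
  fun J => ∑ k, B (J, k) * x k

/-- The Tucker product `⟦A; G_1, …, G_M⟧` with square factor matrices. -/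
def tucker (A : Tensor p) (G : Shape p) : Tensor p :=
  fun J => ∑ K, (∏ m, G m (J m) (K m)) * A K

/-- The entrywise inverse tuple `(Σ_1⁻¹, …, Σ_M⁻¹)`. -/
def shapeInv (Ξ : Shape p) : Shape p := fun m => (Ξ m)⁻¹

/-- The squared tensor Mahalanobis norm `⟨⟦A; Σ_1⁻¹, …, Σ_M⁻¹⟧, A⟩`. -/
def mahaSq (Ξ : Shape p) (A : Tensor p) : ℝ := ∑ J, tucker A (shapeInv Ξ) J * A J

/-- The mode-`m` matricization. -/
def matricize (A : Tensor p) (m : Fin M) : Matrix (Fin (p m)) (CoIdx p m) ℝ :=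
  fun a c => A ((Equiv.piSplitAt m (fun j => Fin (p j))).symm (a, c))

/-- The Kronecker product of the inverses `Σ_j⁻¹` over all `j ≠ m`. -/
def kronInv (Ξ : Shape p) (m : Fin M) : Matrix (CoIdx p m) (CoIdx p m) ℝ :=
  fun c d => ∏ j : {j : Fin M // j ≠ m}, (Ξ j)⁻¹ (c j) (d j)

/-! ### The tensor t-distribution -/

/-- The density of the tensor t-distribution `TT(loc, Ξ, ν)`. -/
def tensorTPDF (loc : Tensor p) (Ξ : Shape p) (ν : ℝ) (y : Tensor p) : ℝ :=
  Real.Gamma ((ν + totalDim p) / 2) * (∏ m, (Ξ m).det ^ (-((coDim p m : ℝ) / 2)))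
    / ((Real.pi * ν) ^ ((totalDim p : ℝ) / 2) * Real.Gamma (ν / 2))
    * (1 + mahaSq Ξ (y - loc) / ν) ^ (-((ν + totalDim p) / 2))

/-- The tensor t-distribution `TT(loc, Ξ, ν)`. -/
def tensorT (loc : Tensor p) (Ξ : Shape p) (ν : ℝ) : Measure (Tensor p) :=
  volume.withDensity (fun y => ENNReal.ofReal (tensorTPDF loc Ξ ν y))

/-! ### Objective functions

Throughout, `x i` and `y i` are the `i`-th predictor and response. -/

/-- The `q × n` predictor matrix, with columns `x i`. -/
def designMat (x : Fin n → Fin q → ℝ) : Matrix (Fin q) (Fin n) ℝ := fun k i => x i k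

/-- The ordinary least squares estimator. -/
def ols (x : Fin n → Fin q → ℝ) (y : Fin n → Tensor p) : CoefTensor p q :=
  fun j => ∑ i, ((designMat x * (designMat x).transpose)⁻¹ * designMat x) j.2 i * y i j.1

/-- The adaptive lasso weights `r_j = (b_j^OLS)⁻²`. -/
def adaWeight (x : Fin n → Fin q → ℝ) (y : Fin n → Tensor p) : CoefTensor p q :=
  fun j => ((ols x y j) ^ 2)⁻¹

/-- The adaptive lasso penalty `P_λ(B) = λ ∑_j r_j |b_j|`. -/
def adaPenalty (lam : ℝ) (r B : CoefTensor p q) : ℝ := lam * ∑ j, r j * |B j|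

/-- The residual tensors of a coefficient tensor. -/
def resid (x : Fin n → Fin q → ℝ) (y : Fin n → Tensor p) (B : CoefTensor p q) :
    Fin n → Tensor p :=
  fun i => y i - vecProd B (x i)

/-- The adaptive penalized least squares objective. -/
def aplObj (x : Fin n → Fin q → ℝ) (y : Fin n → Tensor p) (lam : ℝ) (r B : CoefTensor p q) : ℝ :=
  (∑ i, ∑ J, (resid x y B i J) ^ 2) + adaPenalty lam r B

/-- The plug-in objective `L_n(Ξ)` for the shape, for given residual tensors `R_1, …, R_n`. -/
def shapeObj (ν : ℝ) (R : Fin n → Tensor p) (Ξ : Shape p) : ℝ :=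
  (n : ℝ) / 2 * (∑ m, (coDim p m : ℝ) * Real.log (Ξ m).det)
    + (ν + totalDim p) / 2 * ∑ i, Real.log (1 + mahaSq Ξ (R i) / ν)

/-- The weights `w_i = (ν + p) / (ν + ‖R_i‖²_Ξ)`. -/
def tWeight (ν : ℝ) (R : Fin n → Tensor p) (Ξ : Shape p) : Fin n → ℝ :=
  fun i => (ν + totalDim p) / (ν + mahaSq Ξ (R i))

/-- The one-step objective `F_n(B)`, for given observation weights and shape. -/
def ostObj (x : Fin n → Fin q → ℝ) (y : Fin n → Tensor p) (lam : ℝ) (r : CoefTensor p q)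
    (w : Fin n → ℝ) (Ξ : Shape p) (B : CoefTensor p q) : ℝ :=
  (∑ i, w i * mahaSq Ξ (resid x y B i)) + adaPenalty lam r B

/-! ### The algorithm -/

/-- The new value of a coordinate in coordinate descent, with threshold `τ`. -/
def shrink (U₁ U₂ τ : ℝ) : ℝ :=
  if 0 < |U₁| - τ then U₁ / (U₂ + τ * U₂ / (|U₁| - τ)) else 0

/-- One pass of coordinate descent: the coordinates are visited in the order given by the list,
and coordinate `j` of the current point `b` is overwritten by `upd b j`. -/
def coordSweep {ι : Type*} [DecidableEq ι] (upd : (ι → ℝ) → ι → ℝ) (order : List ι)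
    (b : ι → ℝ) : ι → ℝ :=
  order.foldl (fun b j => Function.update b j (upd b j)) b

/-- The list visits every coordinate exactly once. -/
def IsOrder {ι : Type*} (order : List ι) : Prop := order.Nodup ∧ ∀ j, j ∈ order

/-- Coordinate update for the sub-problem of regressing one entry `z` of the response on the
predictor, with objective `∑_i (z_i - b ⬝ x_i)² + λ ∑_k r_k |b_k|`. -/
def aplUpdate (x : Fin n → Fin q → ℝ) (z : Fin n → ℝ) (lam : ℝ) (r : Fin q → ℝ)
    (b : Fin q → ℝ) (k : Fin q) : ℝ :=
  shrink (∑ i, (z i - ∑ l, Function.update b k 0 l * x i l) * x i k)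
    (∑ i, (x i k) ^ 2) (lam * r k / 2)

/-- Coordinate update for the one-step objective. -/
def ostUpdate (x : Fin n → Fin q → ℝ) (y : Fin n → Tensor p) (lam : ℝ) (r : CoefTensor p q)
    (w : Fin n → ℝ) (Ξ : Shape p) (B : CoefTensor p q) (j : Idx p × Fin q) : ℝ :=
  shrink
    (∑ i, w i * (tucker (resid x y (Function.update B j 0) i) (shapeInv Ξ) j.1 * x i j.2))
    (∑ i, w i * (x i j.2) ^ 2 * ∏ m, (Ξ m)⁻¹ (j.1 m) (j.1 m))
    (lam * r j / 2)

/-- The right-hand side of the update of `Σ_m`: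
`(n p_{-m})⁻¹ ∑_i w_i (R_i)_(m) (⨂_{j ≠ m} Σ_j⁻¹) (R_i)_(m)ᵀ`. -/
def modeUpdate (R : Fin n → Tensor p) (w : Fin n → ℝ) (Ξ : Shape p) (m : Fin M) :
    Matrix (Fin (p m)) (Fin (p m)) ℝ :=
  ((n : ℝ) * coDim p m)⁻¹ •
    ∑ i, w i • (matricize (R i) m * kronInv Ξ m * (matricize (R i) m).transpose)

/-- One cycle `m = 1, …, M` of the updates of `Σ_m`, with fixed weights. -/
def shapeSweep (R : Fin n → Tensor p) (w : Fin n → ℝ) (Ξ : Shape p) : Shape p :=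
  (List.finRange M).foldl (fun Ξ m => Function.update Ξ m (modeUpdate R w Ξ m)) Ξ

/-- `Ξ 0, Ξ 1, …` is a run of the shape estimation with output `Ξhat`: it starts from positive
definite matrices; in each round the weights are computed from the current `Ξ k` and kept fixed,
and `Ξ (k + 1)` results either from one cycle of updates or from cycling until convergence; the
rounds are repeated until convergence. Limits are taken entry by entry. -/
structure IsShapeRun (ν : ℝ) (R : Fin n → Tensor p) (Ξ : ℕ → Shape p) (Ξhat : Shape p) :
    Prop where
  init : IsPD (Ξ 0)
  step : ∀ k, Ξ (k + 1) = shapeSweep R (tWeight ν R (Ξ k)) (Ξ k) ∨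
    Tendsto (fun t : ℕ => (shapeSweep R (tWeight ν R (Ξ k)))^[t] (Ξ k)) atTop (𝓝 (Ξ (k + 1)))
  converges : Tendsto Ξ atTop (𝓝 Ξhat)

end TensorReg

end

open TensorReg

open MeasureTheory ProbabilityTheory Filter Topology

namespace TensorReg

open Matrix

/-! ### Quadratic forms -/

/-! Both coordinate descents minimize a positive definite quadratic form plus a weighted `ℓ¹` norm
(`lassoObj`). The update `shrink` is soft thresholding, the exact minimizer in one coordinate, and
it lowers the objective by at least a multiple of the squared step. Sublevel sets are compact and
the sweep is continuous, so every cluster point of the iterates is fixed by all coordinate updates,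
hence stationary, hence the unique minimizer (`tendsto_coordSweep_lassoUpdate`).

The probabilistic input is general position (`GenPos`) of the residuals of (APL). The sign pattern
of the solution is random, but there are only finitely many patterns, and for a fixed one the
residual is an explicit function of the response: a linear part plus a combination of the
thresholds, which are inverse squares of OLS coefficients. A nonzero functional of it has countable
level sets along suitable lines, so adding the rows of a determinant one at a time and using Fubini
gives invertibility for almost every response, for all patterns at once (`ae_det_ne_zero`,
`exists_line_patternResid`).

For the shape, a mode update minimizes in `Σ_m` a Gaussian surrogate that majorizes `L_n` up to a
constant, so `L_n` decreases along a run. The limit could only fail by becoming singular. In every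
mode but a largest one, a single residual already has full row rank; the normalization after each
round forces some residual to keep a weight bounded below infinitely often, which bounds the update
below (`frequently_exists_le`, `limit_posDef_of_le_coDim`). With these modes nondegenerate,
Hadamard's inequality over cyclic windows of columns shows that `L_n` would tend to infinity if the
last mode degenerated (`exists_sum_log_ge`, `limit_posDef_of_forall_ne`).

So an output is a positive definite fixed point of the updates. Along the path that scales the modes
exponentially in a simultaneous diagonalization with a competitor, `L_n` is convex, being linear
plus log-sum-exp terms, and the fixed-point equation makes its slope at the start vanish. Hence a
fixed point is a global minimizer (`shapeObj_le_of_fixed`). -/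

theorem dotProduct_mulVec_comm {ι : Type*} [Fintype ι] {H : Matrix ι ι ℝ} (hH : H.IsHermitian)
    (a b : ι → ℝ) : a ⬝ᵥ H *ᵥ b = b ⬝ᵥ H *ᵥ a := by
  have h : Hᵀ = H := by simpa [conjTranspose_eq_transpose_of_trivial] using hH.eq
  rw [dotProduct_mulVec, ← mulVec_transpose, h, dotProduct_comm]

theorem posDef_quad_pos {ι : Type*} [Fintype ι] {H : Matrix ι ι ℝ} (hH : H.PosDef)
    {a : ι → ℝ} (ha : a ≠ 0) : 0 < a ⬝ᵥ H *ᵥ a := by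
  simpa using hH.dotProduct_mulVec_pos ha

theorem posSemidef_quad_nonneg {ι : Type*} [Fintype ι] {H : Matrix ι ι ℝ} (hH : H.PosSemidef)
    (a : ι → ℝ) : 0 ≤ a ⬝ᵥ H *ᵥ a := by
  simpa using hH.dotProduct_mulVec_nonneg a

theorem posDef_of_quad_pos {ι : Type*} [Fintype ι] {H : Matrix ι ι ℝ} (hs : Hᵀ = H)
    (h : ∀ a : ι → ℝ, a ≠ 0 → 0 < a ⬝ᵥ H *ᵥ a) : H.PosDef := by
  refine .of_dotProduct_mulVec_pos ?_ fun a ha => ?_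
  · simpa [IsHermitian, conjTranspose_eq_transpose_of_trivial] using hs
  · simpa using h a ha

theorem quad_le_of_entry_le {ι : Type*} [Fintype ι] {K : Matrix ι ι ℝ} {C : ℝ}
    (hK : ∀ i j, |K i j| ≤ C) (a : ι → ℝ) :
    a ⬝ᵥ K *ᵥ a ≤ C * Fintype.card ι * (a ⬝ᵥ a) := by
  have h1 : ∀ i j, a i * (K i j * a j) ≤ C * ((a i ^ 2 + a j ^ 2) / 2) := by
    intro i j
    have h2 : a i * (K i j * a j) ≤ |K i j| * (|a i| * |a j|) := by
      calc a i * (K i j * a j) ≤ |a i * (K i j * a j)| := le_abs_self _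
        _ = _ := by rw [abs_mul, abs_mul]; ring
    have h3 : |a i| * |a j| ≤ (a i ^ 2 + a j ^ 2) / 2 := by
      rw [← sq_abs (a i), ← sq_abs (a j)]
      nlinarith [sq_nonneg (|a i| - |a j|)]
    calc _ ≤ _ := h2
      _ ≤ C * (|a i| * |a j|) := by gcongr; exact hK i j
      _ ≤ _ := mul_le_mul_of_nonneg_left h3 ((abs_nonneg _).trans (hK i j))
  calc a ⬝ᵥ K *ᵥ a = ∑ i, ∑ j, a i * (K i j * a j) := by
        simp [dotProduct, mulVec, Finset.mul_sum]
    _ ≤ ∑ i, ∑ j, C * ((a i ^ 2 + a j ^ 2) / 2) :=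
        Finset.sum_le_sum fun i _ => Finset.sum_le_sum fun j _ => h1 i j
    _ = C * Fintype.card ι * (a ⬝ᵥ a) := by
        simp only [← Finset.mul_sum, ← Finset.sum_div, Finset.sum_add_distrib, Finset.sum_const,
          Finset.card_univ, nsmul_eq_mul, dotProduct, ← pow_two]
        ring

/-- A positive definite matrix whose inverse has bounded entries is bounded below. -/
theorem quad_ge_of_inv_entry_le {ι : Type*} [Fintype ι] [DecidableEq ι] {H : Matrix ι ι ℝ}
    (hH : H.PosDef) {C : ℝ} (hC : 0 < C) (h : ∀ i j, |H⁻¹ i j| ≤ C) (a : ι → ℝ) :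
    (C * (Fintype.card ι + 1))⁻¹ * (a ⬝ᵥ a) ≤ a ⬝ᵥ H *ᵥ a := by
  -- The `+ 1` keeps `D` positive for an empty index type.
  set D : ℝ := C * (Fintype.card ι + 1) with hD
  have hDpos : 0 < D := by positivity
  have hu : IsUnit H.det := (Matrix.isUnit_iff_isUnit_det _).1 hH.isUnit
  set e := H⁻¹ *ᵥ a with he
  have h1 : H *ᵥ e = a := by rw [he, mulVec_mulVec, mul_nonsing_inv _ hu, one_mulVec]
  have h2 : a ⬝ᵥ e ≤ D * (a ⬝ᵥ a) := by
    refine (quad_le_of_entry_le h a).trans ?_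
    have : 0 ≤ a ⬝ᵥ a := by simpa using dotProduct_star_self_nonneg a
    gcongr
    nlinarith
  -- Nonnegativity of the form at `a - D⁻¹ H⁻¹ a` turns the upper bound `D` for `H⁻¹` into the lower
  -- bound `D⁻¹` for `H`, without eigenvalues.
  have h3 := posSemidef_quad_nonneg hH.posSemidef (a - D⁻¹ • e)
  have h4 : e ⬝ᵥ H *ᵥ a = a ⬝ᵥ a := by rw [dotProduct_mulVec_comm hH.1, h1]
  have h5 : (a - D⁻¹ • e) ⬝ᵥ H *ᵥ (a - D⁻¹ • e)
      = a ⬝ᵥ H *ᵥ a - 2 * D⁻¹ * (a ⬝ᵥ a) + D⁻¹ * D⁻¹ * (a ⬝ᵥ e) := by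
    simp only [mulVec_sub, mulVec_smul, dotProduct_sub, sub_dotProduct, smul_dotProduct,
      dotProduct_smul, h1, h4, smul_eq_mul, dotProduct_comm e a]
    ring
  have h6 : D⁻¹ * D⁻¹ * (a ⬝ᵥ e) ≤ D⁻¹ * (a ⬝ᵥ a) := by
    calc _ ≤ D⁻¹ * D⁻¹ * (D * (a ⬝ᵥ a)) := by gcongr
      _ = _ := by field_simp
  linarith

theorem exists_quad_lower {ι : Type*} [Fintype ι] {H : Matrix ι ι ℝ} (hH : H.PosDef) :
    ∃ ε > 0, ∀ a : ι → ℝ, ε * (a ⬝ᵥ a) ≤ a ⬝ᵥ H *ᵥ a := by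
  classical
  have hC : ∀ i j, |H⁻¹ i j| ≤ (∑ i, ∑ j, |H⁻¹ i j|) + 1 := fun i j => by
    have h1 := Finset.single_le_sum (f := fun j => |H⁻¹ i j|) (fun _ _ => abs_nonneg _)
      (Finset.mem_univ j)
    have h2 := Finset.single_le_sum (f := fun i => ∑ j, |H⁻¹ i j|)
      (fun _ _ => Finset.sum_nonneg fun _ _ => abs_nonneg _) (Finset.mem_univ i)
    have h3 : |H⁻¹ i j| ≤ ∑ j, |H⁻¹ i j| := h1
    have h4 : ∑ j, |H⁻¹ i j| ≤ ∑ i, ∑ j, |H⁻¹ i j| := h2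
    linarith
  have h0 : 0 < (∑ i, ∑ j, |H⁻¹ i j|) + 1 := by positivity
  exact ⟨_, by positivity, quad_ge_of_inv_entry_le hH h0 hC⟩

/-! ### Coordinate descent for penalized quadratic functions -/

/-- Soft thresholding as a difference of positive parts; in this form it is visibly continuous in
`u`, which the case distinction hides. -/
theorem shrink_eq {u h τ : ℝ} (hh : 0 < h) (hτ : 0 ≤ τ) :
    shrink u h τ = (max (u - τ) 0 - max (-u - τ) 0) / h := by
  unfold shrink
  split_ifs with hu
  · have hu' : 0 < |u| := by linarith
    have h1 : h + τ * h / (|u| - τ) = h * |u| / (|u| - τ) := by field_simp; ring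
    rw [h1]
    rcases abs_cases u with ⟨h2, h3⟩ | ⟨h2, h3⟩ <;> rw [h2] at hu hu' ⊢
    · rw [max_eq_left hu.le, max_eq_right (by linarith)]
      field_simp; ring
    · rw [max_eq_left hu.le, max_eq_right (by linarith)]
      have : u ≠ 0 := by linarith
      field_simp; ring
  · have := le_abs_self u
    have := neg_abs_le u
    rw [max_eq_right (by linarith), max_eq_right (by linarith)]
    simp

/-- The residual gradient `u - h s` at the thresholded value `s` is a subgradient of `τ |·|` at `s`:
it equals `±τ` when `s ≠ 0` and lies in `[-τ, τ]` when `s = 0`. -/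
theorem shrink_subgradient {u h τ : ℝ} (hh : 0 < h) (hτ : 0 ≤ τ) (d : ℝ) :
    (u - h * shrink u h τ) * d ≤ τ * (|shrink u h τ + d| - |shrink u h τ|) := by
  rw [shrink_eq hh hτ]
  set s := (max (u - τ) 0 - max (-u - τ) 0) / h with hs
  have h1 : h * s = max (u - τ) 0 - max (-u - τ) 0 := by rw [hs]; field_simp
  rcases lt_trichotomy s 0 with h0 | h0 | h0
  · have h2 : u - h * s = -τ := by
      have : h * s < 0 := mul_neg_of_pos_of_neg hh h0
      rw [h1] at this ⊢
      rcases max_cases (u - τ) 0 with ⟨h3, h4⟩ | ⟨h3, h4⟩ <;>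
        rcases max_cases (-u - τ) 0 with ⟨h5, h6⟩ | ⟨h5, h6⟩ <;> linarith
    rw [h2, abs_of_neg h0]
    nlinarith [neg_abs_le (s + d)]
  · rw [h0] at h1 ⊢
    have h2 : |u| ≤ τ := by
      rw [abs_le]
      rcases max_cases (u - τ) 0 with ⟨h3, h4⟩ | ⟨h3, h4⟩ <;>
        rcases max_cases (-u - τ) 0 with ⟨h5, h6⟩ | ⟨h5, h6⟩ <;> constructor <;> linarith
    simp only [mul_zero, sub_zero, zero_add, abs_zero]
    calc u * d ≤ |u * d| := le_abs_self _
      _ = |u| * |d| := abs_mul _ _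
      _ ≤ _ := by gcongr
  · have h2 : u - h * s = τ := by
      have : 0 < h * s := mul_pos hh h0
      rw [h1] at this ⊢
      rcases max_cases (u - τ) 0 with ⟨h3, h4⟩ | ⟨h3, h4⟩ <;>
        rcases max_cases (-u - τ) 0 with ⟨h5, h6⟩ | ⟨h5, h6⟩ <;> linarith
    rw [h2, abs_of_pos h0]
    nlinarith [le_abs_self (s + d)]

section Lasso

variable {ι : Type*} [Fintype ι] [DecidableEq ι]

/-- The quadratic function with an `ℓ¹` penalty. -/
noncomputable def lassoObj (H : Matrix ι ι ℝ) (c τ b : ι → ℝ) : ℝ :=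
  b ⬝ᵥ H *ᵥ b - 2 * (c ⬝ᵥ b) + 2 * ∑ j, τ j * |b j|

/-- The coordinate update of `lassoObj`. -/
noncomputable def lassoUpdate (H : Matrix ι ι ℝ) (c τ b : ι → ℝ) (j : ι) : ℝ :=
  shrink (c j - (H *ᵥ Function.update b j 0) j) (H j j) (τ j)

/-- The first order optimality condition for `lassoObj` in the coordinate `j`. -/
def LassoStationary (H : Matrix ι ι ℝ) (c τ b : ι → ℝ) (j : ι) : Prop :=
  ∀ d : ℝ, (c j - (H *ᵥ b) j) * d ≤ τ j * (|b j + d| - |b j|)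

variable {H : Matrix ι ι ℝ} {c τ : ι → ℝ}

omit [DecidableEq ι] in
-- Exact expansion: the quadratic term in `d` is separated from a sum whose terms are nonnegative
-- exactly under the coordinatewise optimality conditions.
theorem lassoObj_add (hH : H.IsHermitian) (b d : ι → ℝ) :
    lassoObj H c τ (b + d) = lassoObj H c τ b + d ⬝ᵥ H *ᵥ d
      + 2 * ∑ j, (τ j * (|b j + d j| - |b j|) - (c j - (H *ᵥ b) j) * d j) := by
  have h1 : b ⬝ᵥ H *ᵥ d = d ⬝ᵥ H *ᵥ b := dotProduct_mulVec_comm hH b d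
  have h2 : ∑ j, (τ j * (|b j + d j| - |b j|) - (c j - (H *ᵥ b) j) * d j)
      = ∑ j, τ j * |b j + d j| - ∑ j, τ j * |b j| - c ⬝ᵥ d + d ⬝ᵥ H *ᵥ b := by
    simp only [dotProduct, ← Finset.sum_sub_distrib, ← Finset.sum_add_distrib]
    exact Finset.sum_congr rfl fun j _ => by ring
  rw [h2]
  simp only [lassoObj, mulVec_add, dotProduct_add, add_dotProduct, h1, Pi.add_apply]
  ring

theorem mulVec_update (H : Matrix ι ι ℝ) (b : ι → ℝ) (j : ι) (s : ℝ) (k : ι) :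
    (H *ᵥ Function.update b j s) k = (H *ᵥ Function.update b j 0) k + H k j * s := by
  have h : Function.update b j s = Function.update b j 0 + Pi.single j s := by
    ext l
    by_cases hl : l = j
    · subst hl; simp
    · simp [hl]
  rw [h, mulVec_add, Pi.add_apply, mulVec_single]
  simp [col_apply]

theorem lassoStationary_update (hH : H.PosDef) (hτ : ∀ j, 0 ≤ τ j) (b : ι → ℝ) (j : ι) :
    LassoStationary H c τ (Function.update b j (lassoUpdate H c τ b j)) j := by
  intro d
  have h := shrink_subgradient (u := c j - (H *ᵥ Function.update b j 0) j)
    (hH.diag_pos (i := j)) (hτ j) d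
  rw [mulVec_update]
  simp only [Function.update_self]
  change _ ≤ τ j * (|lassoUpdate H c τ b j + d| - |lassoUpdate H c τ b j|) at h
  refine le_trans (le_of_eq ?_) h
  unfold lassoUpdate
  ring

/-- The updated point is stationary in coordinate `j`, so stepping back to `b` costs at least the
quadratic term of `lassoObj_add`. This sufficient decrease is what excludes stalling. -/
theorem lassoObj_update_le (hH : H.PosDef) (hτ : ∀ j, 0 ≤ τ j) (b : ι → ℝ) (j : ι) :
    lassoObj H c τ (Function.update b j (lassoUpdate H c τ b j))
      + H j j * (b j - lassoUpdate H c τ b j) ^ 2 ≤ lassoObj H c τ b := by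
  set s := lassoUpdate H c τ b j with hs
  have h1 : b = Function.update b j s + Pi.single j (b j - s) := by
    ext l
    by_cases hl : l = j
    · subst hl; simp
    · simp [hl]
  have h2 := lassoStationary_update (c := c) hH hτ b j (b j - s)
  conv_rhs => rw [h1, lassoObj_add hH.1]
  have h3 : (Pi.single j (b j - s) : ι → ℝ) ⬝ᵥ H *ᵥ Pi.single j (b j - s)
      = H j j * (b j - s) ^ 2 := by
    rw [single_dotProduct, mulVec_single]
    simp [col_apply]
    ring
  rw [h3]
  have h4 : 0 ≤ ∑ l, (τ l * (|Function.update b j s l + (Pi.single j (b j - s) : ι → ℝ) l|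
      - |Function.update b j s l|)
      - (c l - (H *ᵥ Function.update b j s) l) * (Pi.single j (b j - s) : ι → ℝ) l) := by
    refine Finset.sum_nonneg fun l _ => ?_
    by_cases hl : l = j
    · subst hl
      simp only [Function.update_self, Pi.single_eq_same] at h2 ⊢
      linarith
    · simp [hl]
  linarith

omit [DecidableEq ι] in
theorem lassoObj_add_ge (hH : H.PosDef) {b : ι → ℝ} (hb : ∀ j, LassoStationary H c τ b j)
    (d : ι → ℝ) : lassoObj H c τ b + d ⬝ᵥ H *ᵥ d ≤ lassoObj H c τ (b + d) := by
  rw [lassoObj_add hH.1]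
  have : 0 ≤ ∑ j, (τ j * (|b j + d j| - |b j|) - (c j - (H *ᵥ b) j) * d j) :=
    Finset.sum_nonneg fun j _ => sub_nonneg.2 (hb j (d j))
  linarith

omit [DecidableEq ι] in
theorem lassoObj_lt_of_stationary (hH : H.PosDef) {b : ι → ℝ}
    (hb : ∀ j, LassoStationary H c τ b j) {b' : ι → ℝ} (hne : b' ≠ b) :
    lassoObj H c τ b < lassoObj H c τ b' := by
  have h := lassoObj_add_ge hH hb (b' - b)
  have h1 := posDef_quad_pos hH (sub_ne_zero.2 hne)
  rw [add_sub_cancel] at h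
  linarith

theorem lassoObj_coordSweep_le (hH : H.PosDef) (hτ : ∀ j, 0 ≤ τ j) (l : List ι) (b : ι → ℝ) :
    lassoObj H c τ (coordSweep (lassoUpdate H c τ) l b) ≤ lassoObj H c τ b := by
  induction l generalizing b with
  | nil => exact le_rfl
  | cons j l ih =>
    refine (ih _).trans ?_
    have h := lassoObj_update_le (c := c) hH hτ b j
    have := mul_nonneg (hH.diag_pos (i := j)).le (sq_nonneg (b j - lassoUpdate H c τ b j))
    linarith

/-- Each coordinate step decreases the objective by at least `H j j` times its squared length.
Without total decrease the first step is null, and the rest of the sweep starts from the same point.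
-/
theorem lassoUpdate_eq_of_coordSweep (hH : H.PosDef) (hτ : ∀ j, 0 ≤ τ j) (l : List ι)
    (b : ι → ℝ)
    (h : lassoObj H c τ (coordSweep (lassoUpdate H c τ) l b) = lassoObj H c τ b) :
    ∀ j ∈ l, lassoUpdate H c τ b j = b j := by
  induction l generalizing b with
  | nil => simp
  | cons j l ih =>
    have h1 := lassoObj_update_le (c := c) hH hτ b j
    have h2 := lassoObj_coordSweep_le (c := c) hH hτ l
      (Function.update b j (lassoUpdate H c τ b j))
    have h3 : coordSweep (lassoUpdate H c τ) (j :: l) b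
      = coordSweep (lassoUpdate H c τ) l (Function.update b j (lassoUpdate H c τ b j)) := rfl
    rw [h3] at h
    have hpos := hH.diag_pos (i := j)
    have h4 : lassoUpdate H c τ b j = b j := by
      by_contra hne
      have : 0 < (b j - lassoUpdate H c τ b j) ^ 2 := by
        have : b j - lassoUpdate H c τ b j ≠ 0 := sub_ne_zero.2 (Ne.symm hne)
        positivity
      nlinarith
    rw [h4, Function.update_eq_self] at h
    intro k hk
    rcases List.mem_cons.1 hk with rfl | hk
    · exact h4
    · exact ih b h k hk

omit [DecidableEq ι] in
theorem continuous_lassoObj : Continuous (lassoObj H c τ) := by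
  unfold lassoObj dotProduct mulVec dotProduct
  fun_prop

theorem continuous_coordSweep_lassoUpdate (hH : H.PosDef) (hτ : ∀ j, 0 ≤ τ j) (l : List ι) :
    Continuous (coordSweep (lassoUpdate H c τ) l) := by
  induction l with
  | nil => exact continuous_id
  | cons j l ih =>
    refine ih.comp (continuous_id.update j ?_)
    have h : ∀ b, lassoUpdate H c τ b j = (max ((c j - (H *ᵥ Function.update b j 0) j) - τ j) 0
        - max (-(c j - (H *ᵥ Function.update b j 0) j) - τ j) 0) / H j j :=
      fun b => shrink_eq hH.diag_pos (hτ j)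
    have h2 : Continuous fun b : ι → ℝ => (H *ᵥ Function.update b j 0) j := by
      have : Continuous fun b : ι → ℝ => Function.update b j (0 : ℝ) :=
        continuous_id.update j continuous_const
      unfold mulVec dotProduct
      fun_prop
    simp only [h]
    fun_prop

omit [DecidableEq ι] in
-- Coercivity: the penalty is nonnegative, and Young's inequality absorbs the linear term into half
-- of the quadratic lower bound.
theorem isCompact_lassoObj_le (hH : H.PosDef) (hτ : ∀ j, 0 ≤ τ j) (C : ℝ) :
    IsCompact {b | lassoObj H c τ b ≤ C} := by
  obtain ⟨ε, hε, hlow⟩ := exists_quad_lower hH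
  set K := 2 / ε * (|C| + 2 / ε * (c ⬝ᵥ c)) + 1 with hK
  have hcc : 0 ≤ c ⬝ᵥ c := by simpa using dotProduct_star_self_nonneg c
  refine (isCompact_Icc (a := fun _ : ι => -K) (b := fun _ => K)).of_isClosed_subset
    (isClosed_le continuous_lassoObj continuous_const) fun b hb => ?_
  have h1 : ε * (b ⬝ᵥ b) - 2 * (c ⬝ᵥ b) ≤ C := by
    have h2 : lassoObj H c τ b ≤ C := hb
    have h3 : 0 ≤ ∑ j, τ j * |b j| :=
      Finset.sum_nonneg fun j _ => mul_nonneg (hτ j) (abs_nonneg _)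
    have := hlow b
    unfold lassoObj at h2
    linarith
  have h2 : 2 * (c ⬝ᵥ b) ≤ ε / 2 * (b ⬝ᵥ b) + 2 / ε * (c ⬝ᵥ c) := by
    simp only [dotProduct, Finset.mul_sum, ← Finset.sum_add_distrib]
    refine Finset.sum_le_sum fun j _ => ?_
    have h : ε / 2 * (b j * b j) + 2 / ε * (c j * c j) - 2 * (c j * b j)
        = (2 * ε)⁻¹ * (ε * b j - 2 * c j) ^ 2 := by field_simp; ring
    have : 0 ≤ (2 * ε)⁻¹ * (ε * b j - 2 * c j) ^ 2 := by positivity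
    linarith
  have h3 : b ⬝ᵥ b ≤ 2 / ε * (|C| + 2 / ε * (c ⬝ᵥ c)) := by
    have h5 : ε / 2 * (b ⬝ᵥ b) ≤ |C| + 2 / ε * (c ⬝ᵥ c) := by linarith [le_abs_self C]
    calc b ⬝ᵥ b = 2 / ε * (ε / 2 * (b ⬝ᵥ b)) := by field_simp
      _ ≤ _ := by gcongr
  have h4 : ∀ j, |b j| ≤ K := fun j => by
    have h5 : b j ^ 2 ≤ b ⬝ᵥ b := by
      rw [pow_two]
      exact Finset.single_le_sum (f := fun j => b j * b j) (fun i _ => mul_self_nonneg _)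
        (Finset.mem_univ j)
    have h6 : |b j| ≤ 1 + b j ^ 2 := by
      rw [← sq_abs]; nlinarith [sq_nonneg (|b j| - 1), abs_nonneg (b j)]
    linarith
  exact ⟨fun j => (abs_le.1 (h4 j)).1, fun j => (abs_le.1 (h4 j)).2⟩

theorem exists_lassoStationary (hH : H.PosDef) (hτ : ∀ j, 0 ≤ τ j) :
    ∃ b, ∀ j, LassoStationary H c τ b j := by
  obtain ⟨b, hb, hmin⟩ := (isCompact_lassoObj_le (c := c) hH hτ (lassoObj H c τ 0)).exists_isMinOn
    ⟨0, le_refl (lassoObj H c τ 0)⟩ continuous_lassoObj.continuousOn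
  refine ⟨b, fun j => ?_⟩
  have h1 := lassoObj_update_le (c := c) hH hτ b j
  have hpos := hH.diag_pos (i := j)
  have h2 : lassoUpdate H c τ b j = b j := by
    by_contra hne
    have h3 : 0 < (b j - lassoUpdate H c τ b j) ^ 2 := by
      have : b j - lassoUpdate H c τ b j ≠ 0 := sub_ne_zero.2 (Ne.symm hne)
      positivity
    have h4 : lassoObj H c τ (Function.update b j (lassoUpdate H c τ b j)) < lassoObj H c τ b := by
      nlinarith
    exact absurd (hmin (show _ ≤ lassoObj H c τ 0 from h4.le.trans hb)) (not_le.2 h4)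
  have h5 := lassoStationary_update (c := c) hH hτ b j
  rwa [h2, Function.update_eq_self] at h5

/-- Cyclic coordinate descent converges to the stationary point of `lassoObj`. -/
theorem tendsto_coordSweep_lassoUpdate (hH : H.PosDef) (hτ : ∀ j, 0 ≤ τ j) {b : ι → ℝ}
    (hb : ∀ j, LassoStationary H c τ b j) {l : List ι} (hl : ∀ j, j ∈ l) (b₀ : ι → ℝ) :
    Tendsto (fun t : ℕ => (coordSweep (lassoUpdate H c τ) l)^[t] b₀) atTop (𝓝 b) := by
  set T := coordSweep (lassoUpdate H c τ) l with hT
  set f := lassoObj H c τ with hf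
  have hanti : Antitone fun t : ℕ => f (T^[t] b₀) := antitone_nat_of_succ_le fun t => by
    rw [Function.iterate_succ_apply']
    exact lassoObj_coordSweep_le hH hτ l _
  have hTc : Continuous T := continuous_coordSweep_lassoUpdate hH hτ l
  have hfc : Continuous f := continuous_lassoObj
  have hbdd : BddBelow (Set.range fun t : ℕ => f (T^[t] b₀)) := by
    refine ⟨f b, ?_⟩
    rintro _ ⟨t, rfl⟩
    by_cases h : T^[t] b₀ = b
    · exact (congrArg f h).ge
    · exact (lassoObj_lt_of_stationary hH hb h).le
  have hlim := tendsto_atTop_ciInf hanti hbdd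
  set a := ⨅ t : ℕ, f (T^[t] b₀)
  -- In a compact set it suffices that `b` is the only cluster point. At a cluster point `z`, both
  -- `f z` and `f (T z)` equal the limit of the decreasing objective values, so `z` is fixed by
  -- every coordinate update.
  refine (isCompact_lassoObj_le (c := c) hH hτ (f b₀)).tendsto_nhds_of_unique_mapClusterPt
    (Eventually.of_forall fun t => hanti (Nat.zero_le t)) fun z _ hz => ?_
  obtain ⟨φ, hφ, hφz⟩ := hz.tendsto_subseq
  have h1 : f z = a := tendsto_nhds_unique ((hfc.tendsto z).comp hφz)
    (hlim.comp hφ.tendsto_atTop)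
  have h2 : f (T z) = a := by
    refine tendsto_nhds_unique (((hfc.comp hTc).tendsto z).comp hφz)
      ((hlim.comp ((tendsto_add_atTop_nat 1).comp hφ.tendsto_atTop)).congr fun t => ?_)
    simp only [Function.comp_apply, Function.iterate_succ_apply']
  have h3 := lassoUpdate_eq_of_coordSweep hH hτ l z (h2.trans h1.symm)
  by_contra hne
  have h4 : ∀ j, LassoStationary H c τ z j := fun j => by
    have h5 := lassoStationary_update (c := c) hH hτ z j
    rwa [h3 j (hl j), Function.update_eq_self] at h5
  exact lt_asymm (lassoObj_lt_of_stationary hH hb hne) (lassoObj_lt_of_stationary hH h4 (Ne.symm hne))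

end Lasso

/-! ### Generic position of the residuals -/

theorem measurable_matrix_det {α κ : Type*} [MeasurableSpace α] [Fintype κ] [DecidableEq κ]
    {A : α → Matrix κ κ ℝ} (hA : ∀ i j, Measurable fun a => A a i j) :
    Measurable fun a => (A a).det := by
  simp only [det_apply]
  refine Finset.measurable_sum _ fun s _ => ?_
  exact (Finset.measurable_prod _ fun i _ => hA _ _).const_smul _

theorem measurable_adjugate_apply {α κ : Type*} [MeasurableSpace α] [Fintype κ] [DecidableEq κ]
    {A : α → Matrix κ κ ℝ} (hA : ∀ i j, Measurable fun a => A a i j) (i j : κ) :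
    Measurable fun a => (A a).adjugate i j := by
  simp only [adjugate_apply]
  refine measurable_matrix_det fun k l => ?_
  by_cases hk : k = j
  · subst hk; simp
  · simpa [updateRow_ne hk] using hA k l

theorem measurable_inv_apply {α κ : Type*} [MeasurableSpace α] [Fintype κ] [DecidableEq κ]
    {A : α → Matrix κ κ ℝ} (hA : ∀ i j, Measurable fun a => A a i j) (i j : κ) :
    Measurable fun a => (A a)⁻¹ i j := by
  simp only [inv_def, Ring.inverse_eq_inv', Matrix.smul_apply, smul_eq_mul]
  exact (measurable_matrix_det hA).inv.mul (measurable_adjugate_apply hA i j)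

theorem measurable_mul_apply {α κ₁ κ₂ κ₃ : Type*} [MeasurableSpace α] [Fintype κ₂]
    {A : α → Matrix κ₁ κ₂ ℝ} {B : α → Matrix κ₂ κ₃ ℝ} (hA : ∀ i j, Measurable fun a => A a i j)
    (hB : ∀ i j, Measurable fun a => B a i j) (i : κ₁) (j : κ₃) :
    Measurable fun a => (A a * B a) i j := by
  simp only [mul_apply]
  exact Finset.measurable_sum _ fun k _ => (hA i k).mul (hB k j)

theorem measurable_mulVec_apply {α κ₁ κ₂ : Type*} [MeasurableSpace α] [Fintype κ₂]
    {A : α → Matrix κ₁ κ₂ ℝ} {b : α → κ₂ → ℝ} (hA : ∀ i j, Measurable fun a => A a i j)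
    (hb : ∀ j, Measurable fun a => b a j) (i : κ₁) : Measurable fun a => (A a *ᵥ b a) i := by
  simp only [mulVec, dotProduct]
  exact Finset.measurable_sum _ fun k _ => (hA i k).mul (hb k)

theorem det_updateRow_eq_dotProduct {κ : Type*} [Fintype κ] [DecidableEq κ]
    (A : Matrix κ κ ℝ) (i : κ) (r : κ → ℝ) :
    (A.updateRow i r).det = Aᵀ.adjugate i ⬝ᵥ r := by
  rw [← cramer_transpose_apply, cramer_eq_adjugate_mulVec]
  rfl

/-- If each row of a random matrix can be moved separately, and no nontrivial linear functional of
it vanishes on more than countably many points of suitable lines, then the matrix is almost surely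
invertible. -/
theorem ae_det_ne_zero {V : Type*} [NormedAddCommGroup V] [NormedSpace ℝ V] [MeasurableSpace V]
    [BorelSpace V] [FiniteDimensional ℝ V] (ρ : Measure V) [ρ.IsAddHaarMeasure]
    {κ : Type*} [Fintype κ] [DecidableEq κ] (F : κ → V → κ → ℝ)
    (hF : ∀ a b, Measurable fun y => F a y b) (L : κ → V →ₗ[ℝ] V)
    (hloc : ∀ a a', a' ≠ a → ∀ y w, F a' (y + L a w) = F a' y)
    (hline : ∀ a u, u ≠ 0 → ∃ v, ∀ y, {t : ℝ | u ⬝ᵥ F a (y + t • L a v) = 0}.Countable) :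
    ∀ᵐ y ∂ρ, (Matrix.of fun a b => F a y b).det ≠ 0 := by
  classical
  have : ProperSpace V := FiniteDimensional.proper ℝ V
  -- The rows outside `s` are those of the identity, so the induction on `s` starts from determinant
  -- one and inserts one random row at a time.
  set A : Finset κ → V → Matrix κ κ ℝ := fun s y =>
    Matrix.of fun a b => if a ∈ s then F a y b else (1 : Matrix κ κ ℝ) a b with hA
  have hAm : ∀ s i j, Measurable fun y => A s y i j := fun s i j => by
    by_cases h : i ∈ s
    · simpa [hA, h] using hF i j
    · simp [hA, h]
  suffices h : ∀ s, ∀ᵐ y ∂ρ, (A s y).det ≠ 0 by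
    filter_upwards [h Finset.univ] with y hy
    simpa [hA] using hy
  intro s
  induction s using Finset.induction_on with
  | empty =>
    refine Eventually.of_forall fun y => ?_
    have : A ∅ y = 1 := by ext i j; simp [hA]
    rw [this, det_one]
    exact one_ne_zero
  | insert a s ha ih =>
    -- The cofactors of row `a`: they do not see that row, so motions along `L a` leave them
    -- unchanged, and their entry at `a` is the previous determinant.
    set u : V → κ → ℝ := fun y => (A s y)ᵀ.adjugate a with hu
    have hum : ∀ b, Measurable fun y => u y b := fun b =>
      measurable_adjugate_apply (A := fun y => (A s y)ᵀ) (fun i j => hAm s j i) a b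
    have hins : ∀ y, (A (insert a s) y).det = u y ⬝ᵥ F a y := fun y => by
      have h : A (insert a s) y = (A s y).updateRow a (F a y) := by
        ext i j
        by_cases hi : i = a
        · subst hi; simp [hA]
        · simp [hA, hi]
      rw [h, det_updateRow_eq_dotProduct]
    have hold : ∀ y, (A s y).det = u y a := fun y => by
      have h : A s y = (A s y).updateRow a (Pi.single a 1) := by
        ext i j
        by_cases hi : i = a
        · subst hi; simp [hA, ha, Matrix.one_apply, Pi.single_apply, eq_comm]
        · simp [hi]
      rw [h, det_updateRow_eq_dotProduct, dotProduct_single_one]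
    have huloc : ∀ y w, u (y + L a w) = u y := fun y w => by
      have h : A s (y + L a w) = A s y := by
        ext i j
        by_cases hi : i ∈ s
        · have : i ≠ a := fun h => ha (h ▸ hi)
          simp [hA, hi, hloc a i this]
        · simp [hA, hi]
      simp only [hu, h]
    have hdot : Measurable fun y => u y ⬝ᵥ F a y := by
      simp only [dotProduct]
      exact Finset.measurable_sum _ fun b _ => (hum b).mul (hF a b)
    have hmeas : MeasurableSet {y | u y = 0 ∨ u y ⬝ᵥ F a y ≠ 0} := by
      refine MeasurableSet.union ?_ ?_
      · exact measurableSet_eq_fun (measurable_pi_lambda _ hum) measurable_const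
      · exact (measurableSet_eq_fun hdot measurable_const).compl
    have hae : ∀ᵐ y ∂ρ, y ∈ {y | u y = 0 ∨ u y ⬝ᵥ F a y ≠ 0} := by
      -- Fubini along the range of `L a`: there `u` is a fixed vector and the determinant is a fixed
      -- linear functional of row `a`. A second reduction, to lines, then uses that countable sets
      -- are null.
      refine ae_mem_of_ae_add_linearMap_mem (L a) ρ ρ hmeas fun y => ?_
      by_cases hy : u y = 0
      · exact Eventually.of_forall fun w => Or.inl (by rw [huloc, hy])
      obtain ⟨v, hv⟩ := hline a (u y) hy
      have hmeas' : MeasurableSet {w | u y ⬝ᵥ F a (y + L a w) ≠ 0} := by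
        have h1 : Measurable fun w => y + L a w :=
          ((L a).continuous_of_finiteDimensional.measurable).const_add y
        have h2 : Measurable fun w => u y ⬝ᵥ F a (y + L a w) := by
          simp only [dotProduct]
          exact Finset.measurable_sum _ fun b _ => ((hF a b).comp h1).const_mul _
        exact (measurableSet_eq_fun h2 measurable_const).compl
      have h3 : ∀ᵐ w ∂ρ, w ∈ {w | u y ⬝ᵥ F a (y + L a w) ≠ 0} := by
        refine ae_mem_of_ae_add_linearMap_mem (LinearMap.toSpanSingleton ℝ V v)
          (volume : Measure ℝ) ρ hmeas' fun w => ?_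
        filter_upwards [(hv (y + L a w)).ae_notMem volume] with t ht
        simpa [add_assoc] using ht
      filter_upwards [h3] with w hw
      refine Or.inr ?_
      rw [huloc]
      exact hw
    filter_upwards [ih, hae] with y h1 h2
    rw [hins]
    rw [hold] at h1
    rcases h2 with h2 | h2
    · exact absurd (by rw [h2]; rfl) h1
    · exact h2

/-! ### Adaptive lasso residuals with a prescribed sign pattern -/

section Pattern

variable {n q : ℕ}

/-- The diagonal matrix of the support of a sign pattern. -/
def suppMat (s : Fin q → SignType) : Matrix (Fin q) (Fin q) ℝ :=
  diagonal fun k => if s k = 0 then 0 else 1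

/-- The normal equations restricted to the support of a sign pattern. -/
def suppGram (x : Fin n → Fin q → ℝ) (s : Fin q → SignType) : Matrix (Fin q) (Fin q) ℝ :=
  suppMat s * (designMat x * (designMat x)ᵀ) * suppMat s + (1 - suppMat s)

/-- The ordinary least squares coefficients of one entry of the response. -/
noncomputable def olsVec (x : Fin n → Fin q → ℝ) (z : Fin n → ℝ) : Fin q → ℝ :=
  ((designMat x * (designMat x)ᵀ)⁻¹ * designMat x) *ᵥ z

/-- The signed thresholds `(λ / 2) r_k s_k`. -/
noncomputable def signedThreshold (x : Fin n → Fin q → ℝ) (lam : ℝ) (s : Fin q → SignType)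
    (z : Fin n → ℝ) : Fin q → ℝ :=
  fun k => lam / 2 * (s k : ℝ) * ((olsVec x z k) ^ 2)⁻¹

/-- The residual of an adaptive lasso solution with a given sign pattern. -/
noncomputable def patternResid (x : Fin n → Fin q → ℝ) (lam : ℝ) (s : Fin q → SignType)
    (z : Fin n → ℝ) : Fin n → ℝ :=
  z - (designMat x)ᵀ *ᵥ (suppMat s *ᵥ ((suppGram x s)⁻¹ *ᵥ
    (suppMat s *ᵥ (designMat x *ᵥ z) - signedThreshold x lam s z)))

variable {x : Fin n → Fin q → ℝ} {lam : ℝ} {s : Fin q → SignType}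

theorem suppMat_mulVec_apply (b : Fin q → ℝ) (k : Fin q) :
    (suppMat s *ᵥ b) k = if s k = 0 then 0 else b k := by
  simp [suppMat, mulVec_diagonal]

theorem suppMat_transpose : (suppMat s)ᵀ = suppMat s := diagonal_transpose _

theorem design_transpose_mulVec_ne_zero
    (hx : IsUnit (designMat x * (designMat x)ᵀ).det) {b : Fin q → ℝ} (hb : b ≠ 0) :
    (designMat x)ᵀ *ᵥ b ≠ 0 := by
  intro h
  apply hb
  have h1 : (designMat x * (designMat x)ᵀ) *ᵥ b = 0 := by rw [← mulVec_mulVec, h, mulVec_zero]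
  have := congrArg (fun w => (designMat x * (designMat x)ᵀ)⁻¹ *ᵥ w) h1
  simpa [mulVec_mulVec, nonsing_inv_mul _ hx] using this

/-- The quadratic form is the squared norm of the fit restricted to the support plus the squared
norm of the coordinates off the support; the added `1 - suppMat s` supplies the latter. -/
theorem isUnit_suppGram_det (hx : IsUnit (designMat x * (designMat x)ᵀ).det) :
    IsUnit (suppGram x s).det := by
  rw [isUnit_iff_ne_zero]
  intro h0
  obtain ⟨b, hb, hb0⟩ := exists_mulVec_eq_zero_iff.2 h0
  have h1 : b ⬝ᵥ suppGram x s *ᵥ b = ((designMat x)ᵀ *ᵥ (suppMat s *ᵥ b)) ⬝ᵥ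
      ((designMat x)ᵀ *ᵥ (suppMat s *ᵥ b)) + ∑ k, (if s k = 0 then b k ^ 2 else 0) := by
    rw [suppGram, add_mulVec, dotProduct_add]
    congr 1
    · rw [← mulVec_mulVec, ← mulVec_mulVec, ← mulVec_mulVec, dotProduct_mulVec b,
        ← mulVec_transpose, suppMat_transpose, dotProduct_mulVec _ (designMat x),
        ← mulVec_transpose]
    · rw [sub_mulVec, one_mulVec]
      refine Finset.sum_congr rfl fun k _ => ?_
      rw [Pi.sub_apply, suppMat_mulVec_apply]
      split_ifs <;> simp [pow_two]
  rw [hb0, dotProduct_zero] at h1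
  have h2 : 0 ≤ ∑ k, (if s k = 0 then b k ^ 2 else 0) :=
    Finset.sum_nonneg fun k _ => by split_ifs <;> positivity
  have h3 : 0 ≤ ((designMat x)ᵀ *ᵥ (suppMat s *ᵥ b)) ⬝ᵥ ((designMat x)ᵀ *ᵥ (suppMat s *ᵥ b)) := by
    simpa using dotProduct_star_self_nonneg ((designMat x)ᵀ *ᵥ (suppMat s *ᵥ b))
  have h4 : suppMat s *ᵥ b = 0 := by
    by_contra hne
    exact design_transpose_mulVec_ne_zero hx hne (dotProduct_self_eq_zero.1 (by linarith))
  have h5 : ∑ k, (if s k = 0 then b k ^ 2 else 0) = 0 := by linarith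
  rw [Finset.sum_eq_zero_iff_of_nonneg fun k _ => by split_ifs <;> positivity] at h5
  apply hb
  ext k
  have h6 := congrFun h4 k
  have h7 := h5 k (Finset.mem_univ k)
  rw [suppMat_mulVec_apply] at h6
  by_cases hk : s k = 0
  · simpa [hk] using h7
  · simpa [hk] using h6

theorem suppMat_mulVec_eq_self {b : Fin q → ℝ} (hb : ∀ k, s k = 0 → b k = 0) :
    suppMat s *ᵥ b = b := by
  ext k
  rw [suppMat_mulVec_apply]
  split_ifs with h
  · exact (hb k h).symm
  · rfl

theorem suppGram_inv_mulVec (hx : IsUnit (designMat x * (designMat x)ᵀ).det) {b : Fin q → ℝ}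
    (hb : ∀ k, s k = 0 → b k = 0) :
    (suppGram x s)⁻¹ *ᵥ (suppMat s *ᵥ (designMat x *ᵥ ((designMat x)ᵀ *ᵥ b))) = b := by
  have h1 : suppGram x s *ᵥ b = suppMat s *ᵥ (designMat x *ᵥ ((designMat x)ᵀ *ᵥ b)) := by
    rw [suppGram, add_mulVec, sub_mulVec, one_mulVec, ← mulVec_mulVec, suppMat_mulVec_eq_self hb,
      sub_self, add_zero, ← mulVec_mulVec, ← mulVec_mulVec]
  rw [← h1, mulVec_mulVec, nonsing_inv_mul _ (isUnit_suppGram_det hx), one_mulVec]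

/-- On the support the optimality conditions are equations; they are the restricted normal equations
shifted by the signed thresholds, and `suppGram` solves them. -/
theorem eq_patternResid (hx : IsUnit (designMat x * (designMat x)ᵀ).det) {b : Fin q → ℝ}
    {z : Fin n → ℝ} (hb : ∀ k, s k = 0 → b k = 0)
    (hR : ∀ k, s k ≠ 0 → (designMat x *ᵥ (z - (designMat x)ᵀ *ᵥ b)) k
      = signedThreshold x lam s z k) :
    z - (designMat x)ᵀ *ᵥ b = patternResid x lam s z := by
  have h1 : suppMat s *ᵥ (designMat x *ᵥ z) - signedThreshold x lam s z
      = suppMat s *ᵥ (designMat x *ᵥ ((designMat x)ᵀ *ᵥ b)) := by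
    ext k
    rw [Pi.sub_apply, suppMat_mulVec_apply, suppMat_mulVec_apply]
    by_cases hk : s k = 0
    · simp [hk, signedThreshold]
    · have := hR k hk
      rw [mulVec_sub, Pi.sub_apply] at this
      simp only [hk, if_false]
      linarith
  rw [patternResid, h1, suppGram_inv_mulVec hx hb, suppMat_mulVec_eq_self hb]

/-- Moving the response along row `k` of the design shifts a single OLS coefficient, hence a single
threshold. -/
theorem olsVec_add_smul_row (hx : IsUnit (designMat x * (designMat x)ᵀ).det) (z : Fin n → ℝ)
    (t : ℝ) (k : Fin q) :
    olsVec x (z + t • ((designMat x)ᵀ *ᵥ Pi.single k 1)) = olsVec x z + t • Pi.single k 1 := by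
  unfold olsVec
  rw [mulVec_add, mulVec_smul, mulVec_mulVec, Matrix.mul_assoc, nonsing_inv_mul _ hx, one_mulVec]

theorem countable_inv_sq_eq {γ β κ : ℝ} (hγ : γ ≠ 0) :
    {t : ℝ | γ * ((β + t) ^ 2)⁻¹ = κ}.Countable := by
  -- The two square roots, and the pole `-β`, where the inverse takes the default value zero.
  refine Set.Countable.mono (s₂ := {-β, √(γ / κ) - β, -√(γ / κ) - β}) ?_
    (Set.Finite.countable (Set.toFinite _))
  intro t ht
  simp only [Set.mem_insert_iff, Set.mem_singleton_iff]
  by_cases h0 : β + t = 0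
  · left; linarith
  right
  have h1 : κ = γ * ((β + t) ^ 2)⁻¹ := ht.symm
  have h2 : γ / κ = (β + t) ^ 2 := by rw [h1]; field_simp
  rw [h2, Real.sqrt_sq_eq_abs]
  rcases abs_cases (β + t) with ⟨h, _⟩ | ⟨h, _⟩ <;> rw [h]
  · left; ring
  · right; ring

/-- Every nontrivial linear functional of the residual is nonconstant on suitable lines. -/
theorem exists_line_patternResid (hx : IsUnit (designMat x * (designMat x)ᵀ).det)
    (hlam : 0 < lam) {u : Fin n → ℝ} (hu : u ≠ 0) :
    ∃ v : Fin n → ℝ, ∀ z κ, {t : ℝ | u ⬝ᵥ patternResid x lam s (z + t • v) = κ}.Countable := by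
  -- The coefficients with which the signed thresholds enter `u ⬝ᵥ patternResid`.
  set a : Fin q → ℝ := ((suppGram x s)⁻¹)ᵀ *ᵥ (suppMat s *ᵥ (designMat x *ᵥ u)) with ha
  have key : ∀ y, u ⬝ᵥ ((designMat x)ᵀ *ᵥ (suppMat s *ᵥ ((suppGram x s)⁻¹ *ᵥ y))) = a ⬝ᵥ y := by
    intro y
    rw [dotProduct_mulVec, dotProduct_mulVec, dotProduct_mulVec, ← mulVec_transpose,
      ← mulVec_transpose, ← mulVec_transpose, transpose_transpose, suppMat_transpose]
  have hform : ∀ z, u ⬝ᵥ patternResid x lam s z = u ⬝ᵥ z - a ⬝ᵥ (suppMat s *ᵥ (designMat x *ᵥ z))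
      + a ⬝ᵥ signedThreshold x lam s z := by
    intro z
    rw [patternResid, dotProduct_sub, key, dotProduct_sub]
    ring
  -- If an active threshold enters, the line follows row `k` of the design: the restricted least
  -- squares residual does not move, and only the term `γ / (β + t)²` varies.
  by_cases hk : ∃ k, s k ≠ 0 ∧ a k ≠ 0
  · obtain ⟨k, hsk, hak⟩ := hk
    set v : Fin n → ℝ := (designMat x)ᵀ *ᵥ Pi.single k 1 with hv
    refine ⟨v, fun z κ => ?_⟩
    have he : ∀ l, s l = 0 → (Pi.single k 1 : Fin q → ℝ) l = 0 := fun l hl => by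
      have : l ≠ k := fun h => hsk (h ▸ hl)
      simp [this]
    have h1 : u ⬝ᵥ v - a ⬝ᵥ (suppMat s *ᵥ (designMat x *ᵥ v)) = 0 := by
      rw [← key, hv, suppGram_inv_mulVec hx he, suppMat_mulVec_eq_self he, sub_self]
    set γ := a k * (lam / 2 * (s k : ℝ)) with hγ
    have hγ0 : γ ≠ 0 := by
      have : (s k : ℝ) ≠ 0 := by
        cases h : s k <;> simp_all
      have := hlam.ne'
      positivity
    set C := u ⬝ᵥ z - a ⬝ᵥ (suppMat s *ᵥ (designMat x *ᵥ z))
      + ∑ l ∈ Finset.univ.erase k, a l * signedThreshold x lam s z l with hC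
    refine (countable_inv_sq_eq (β := olsVec x z k) (κ := κ - C) hγ0).mono fun t ht => ?_
    have h2 : u ⬝ᵥ patternResid x lam s (z + t • v) = κ := ht
    have h3 : a ⬝ᵥ signedThreshold x lam s (z + t • v)
        = γ * ((olsVec x z k + t) ^ 2)⁻¹
          + ∑ l ∈ Finset.univ.erase k, a l * signedThreshold x lam s z l := by
      rw [dotProduct, ← Finset.add_sum_erase _ _ (Finset.mem_univ k)]
      congr 1
      · rw [signedThreshold, hv, olsVec_add_smul_row hx]
        simp [hγ]
        ring
      · refine Finset.sum_congr rfl fun l hl => ?_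
        rw [signedThreshold, hv, olsVec_add_smul_row hx]
        simp [Finset.ne_of_mem_erase hl, signedThreshold]
    rw [hform, h3] at h2
    simp only [dotProduct_add, mulVec_add, mulVec_smul, dotProduct_smul, smul_eq_mul] at h2
    simp only [Set.mem_ofPred_eq, hC]
    linear_combination h2 - t * h1
  -- If no active threshold enters, the functional reduces to `u ⬝ᵥ z`, with slope `u ⬝ᵥ u ≠ 0`
  -- along `u` itself.
  · push Not at hk
    refine ⟨u, fun z κ => Set.Subsingleton.countable fun t₁ h₁ t₂ h₂ => ?_⟩
    have h1 : ∀ y, a ⬝ᵥ (suppMat s *ᵥ y) = 0 := fun y => Finset.sum_eq_zero fun k _ => by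
      rw [suppMat_mulVec_apply]
      by_cases h : s k = 0
      · simp [h]
      · simp [hk k h]
    have h2 : ∀ y, a ⬝ᵥ signedThreshold x lam s y = 0 := fun y => Finset.sum_eq_zero fun k _ => by
      by_cases h : s k = 0
      · simp [h, signedThreshold]
      · simp [hk k h]
    have h3 : ∀ t : ℝ, u ⬝ᵥ patternResid x lam s (z + t • u) = u ⬝ᵥ z + t * (u ⬝ᵥ u) := fun t => by
      rw [hform, h1, h2]
      simp
    have h4 : u ⬝ᵥ u ≠ 0 := fun h => hu (dotProduct_self_eq_zero.1 h)
    have h5 : u ⬝ᵥ z + t₁ * (u ⬝ᵥ u) = u ⬝ᵥ z + t₂ * (u ⬝ᵥ u) := by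
      rw [← h3, ← h3]; exact h₁.trans h₂.symm
    exact mul_right_cancel₀ h4 (by linarith)

theorem measurable_olsVec_apply {α : Type*} [MeasurableSpace α] {x : α → Fin n → Fin q → ℝ}
    {z : α → Fin n → ℝ} (hx : Measurable x) (hz : Measurable z) (k : Fin q) :
    Measurable fun a => olsVec (x a) (z a) k := by
  have h1 : ∀ i j, Measurable fun a => designMat (x a) i j := fun i j => by
    unfold designMat
    fun_prop
  have h2 : ∀ i j, Measurable fun a => (designMat (x a) * (designMat (x a))ᵀ) i j :=
    measurable_mul_apply h1 fun i j => h1 j i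
  exact measurable_mulVec_apply (measurable_mul_apply (measurable_inv_apply h2) h1)
    (fun j => by fun_prop) k

theorem measurable_patternResid_apply {α : Type*} [MeasurableSpace α]
    {x : α → Fin n → Fin q → ℝ} {z : α → Fin n → ℝ} (hx : Measurable x) (hz : Measurable z)
    (lam : ℝ) (s : Fin q → SignType) (i : Fin n) :
    Measurable fun a => patternResid (x a) lam s (z a) i := by
  have h1 : ∀ i j, Measurable fun a => designMat (x a) i j := fun i j => by
    unfold designMat
    fun_prop
  have h2 : ∀ i j, Measurable fun a => (designMat (x a) * (designMat (x a))ᵀ) i j :=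
    measurable_mul_apply h1 fun i j => h1 j i
  have h0 : ∀ i j, Measurable fun _ : α => suppMat s i j := fun i j => measurable_const
  have h3 : ∀ i j, Measurable fun a => suppGram (x a) s i j := fun i j =>
    (measurable_mul_apply (measurable_mul_apply h0 h2) h0 i j).add measurable_const
  have h4 : ∀ j, Measurable fun a => signedThreshold (x a) lam s (z a) j := fun j =>
    ((measurable_olsVec_apply hx hz j).pow_const 2).inv.const_mul _
  have hz' : ∀ j, Measurable fun a => z a j := fun j => by fun_prop
  refine (hz' i).sub (measurable_mulVec_apply (fun i j => h1 j i)
    (measurable_mulVec_apply h0 (measurable_mulVec_apply (measurable_inv_apply h3) ?_)) i)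
  exact fun j => (measurable_mulVec_apply h0 (measurable_mulVec_apply h1 hz') j).sub (h4 j)

end Pattern

theorem pi_absolutelyContinuous_fin {n : ℕ} {α : Type*} [MeasurableSpace α]
    {μ ν : Fin n → Measure α} [∀ i, SigmaFinite (μ i)] [∀ i, SigmaFinite (ν i)]
    (h : ∀ i, μ i ≪ ν i) : Measure.pi μ ≪ Measure.pi ν := by
  induction n with
  | zero =>
    rw [Measure.pi_of_empty μ finZeroElim, Measure.pi_of_empty ν finZeroElim]
  | succ n ih =>
    have hμ := (measurePreserving_piFinSuccAbove μ 0).symm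
    have hν := (measurePreserving_piFinSuccAbove ν 0).symm
    rw [← hμ.map_eq, ← hν.map_eq]
    exact ((h 0).prod (ih fun i => h _)).map hμ.measurable

/-! ### General position for tensors and the almost sure event -/

variable {M n q : ℕ} {p : Fin M → ℕ}

/-- Insert the entry `a` at the position `m` of a multi-index. -/
def insIdx (m : Fin M) (a : Fin (p m)) (c : CoIdx p m) : Idx p :=
  (Equiv.piSplitAt m (fun j => Fin (p j))).symm (a, c)

theorem insIdx_self (m : Fin M) (a : Fin (p m)) (c : CoIdx p m) : insIdx m a c m = a := by
  simp [insIdx, Equiv.piSplitAt]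

theorem insIdx_inj {m : Fin M} {a a' : Fin (p m)} {c c' : CoIdx p m} :
    insIdx m a c = insIdx m a' c' ↔ a = a' ∧ c = c' := by
  rw [insIdx, insIdx, Equiv.apply_eq_iff_eq, Prod.mk.injEq]

/-- Every square matrix formed by distinct columns of the mode-`m` matricizations of `R` is
invertible. -/
def GenPos (R : Fin n → Tensor p) : Prop :=
  ∀ (m : Fin M) (f : Fin (p m) → CoIdx p m × Fin n), Function.Injective f →
    (Matrix.of fun a b => R (f b).2 (insIdx m a (f b).1)).det ≠ 0

/-- The residual tensors of adaptive lasso solutions with given sign patterns. -/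
noncomputable def patternTensor (x : Fin n → Fin q → ℝ) (lam : ℝ) (s : Idx p → Fin q → SignType)
    (y : Fin n → Tensor p) : Fin n → Tensor p :=
  fun i J => patternResid x lam (s J) (fun i => y i J) i

theorem ae_det_patternTensor_ne_zero {x : Fin n → Fin q → ℝ} {lam : ℝ}
    (hx : IsUnit (designMat x * (designMat x)ᵀ).det) (hlam : 0 < lam)
    (s : Idx p → Fin q → SignType) (m : Fin M) (f : Fin (p m) → CoIdx p m × Fin n)
    (hf : Function.Injective f) :
    ∀ᵐ y : Fin n → Tensor p, (Matrix.of fun a b =>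
      patternTensor x lam s y (f b).2 (insIdx m a (f b).1)).det ≠ 0 := by
  -- The projection onto response entries with `m`-th index `a`. The residual of an entry depends on
  -- the responses in that entry alone, so these motions affect row `a` only.
  set L : Fin (p m) → (Fin n → Tensor p) →ₗ[ℝ] (Fin n → Tensor p) := fun a =>
    { toFun := fun w i J => if J m = a then w i J else 0
      map_add' := fun w w' => by ext i J; by_cases h : J m = a <;> simp [h]
      map_smul' := fun r w => by ext i J; by_cases h : J m = a <;> simp [h] } with hL
  have hLa : ∀ a w i J, L a w i J = if J m = a then w i J else 0 := fun _ _ _ _ => rfl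
  refine ae_det_ne_zero (volume : Measure (Fin n → Tensor p))
    (fun a y b => patternTensor x lam s y (f b).2 (insIdx m a (f b).1)) (fun a b => ?_) L
    (fun a a' haa y w => ?_) fun a u hu => ?_
  · unfold patternTensor
    exact measurable_patternResid_apply measurable_const (by fun_prop) _ _ _
  · funext b
    unfold patternTensor
    congr 1
    ext i
    simp [hLa, insIdx_self, haa]
  · obtain ⟨b₀, hb₀⟩ := Function.ne_iff.1 hu
    set c₀ := (f b₀).1 with hc₀
    set J₀ := insIdx m a c₀ with hJ₀
    -- Only the response entry `J₀` is moved, and `u'` collects the coefficients of `u` on the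
    -- columns with co-index `c₀`. Since `f` is injective, nothing is added to `u b₀`, so `u'` does
    -- not vanish.
    set u' : Fin n → ℝ := fun i => ∑ b, if f b = (c₀, i) then u b else 0 with hu'
    have hu'0 : u' ≠ 0 := Function.ne_iff.2 ⟨(f b₀).2, by
      have h : ∀ b, (f b = (c₀, (f b₀).2)) ↔ b = b₀ := fun b => by
        rw [hc₀, Prod.mk.eta, hf.eq_iff]
      simpa [hu', h] using hb₀⟩
    obtain ⟨v₀, hv₀⟩ := exists_line_patternResid (s := s J₀) hx hlam hu'0
    refine ⟨fun i J => if J = J₀ then v₀ i else 0, fun y => ?_⟩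
    set v : Fin n → Tensor p := fun i J => if J = J₀ then v₀ i else 0 with hv
    set C := ∑ b, if (f b).1 = c₀ then 0 else
      u b * patternTensor x lam s y (f b).2 (insIdx m a (f b).1) with hC
    refine (hv₀ (fun i => y i J₀) (-C)).mono fun t ht => ?_
    have h1 : ∀ b, u b * patternTensor x lam s (y + t • L a v) (f b).2 (insIdx m a (f b).1)
        = (if (f b).1 = c₀ then u b * patternResid x lam (s J₀) ((fun i => y i J₀) + t • v₀) (f b).2
            else 0)
          + if (f b).1 = c₀ then 0 else
            u b * patternTensor x lam s y (f b).2 (insIdx m a (f b).1) := fun b => by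
      unfold patternTensor
      by_cases hb : (f b).1 = c₀
      · rw [if_pos hb, if_pos hb, add_zero, hb, ← hJ₀]
        congr 2
        ext i
        simp [hLa, hv, hJ₀, insIdx_self]
      · rw [if_neg hb, if_neg hb, zero_add]
        congr 2
        ext i
        have : insIdx m a (f b).1 ≠ J₀ := fun h => hb (insIdx_inj.1 h).2
        simp [hLa, hv, this]
    have h2 : u' ⬝ᵥ patternResid x lam (s J₀) ((fun i => y i J₀) + t • v₀)
        = ∑ b, if (f b).1 = c₀ then
          u b * patternResid x lam (s J₀) ((fun i => y i J₀) + t • v₀) (f b).2 else 0 := by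
      simp only [dotProduct, hu', Finset.sum_mul]
      rw [Finset.sum_comm]
      refine Finset.sum_congr rfl fun b _ => ?_
      by_cases hb : (f b).1 = c₀
      · rw [if_pos hb, Finset.sum_eq_single (f b).2]
        · rw [if_pos (by rw [← hb])]
        · intro i _ hi
          rw [if_neg, zero_mul]
          intro h
          exact hi (by rw [h])
        · simp
      · rw [if_neg hb]
        refine Finset.sum_eq_zero fun i _ => ?_
        rw [if_neg, zero_mul]
        intro h
        exact hb (by rw [h])
    have h3 : u ⬝ᵥ (fun b => patternTensor x lam s (y + t • L a v) (f b).2 (insIdx m a (f b).1)) = 0 :=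
      ht
    simp only [dotProduct, h1, Finset.sum_add_distrib] at h3
    rw [← h2] at h3
    exact eq_neg_of_add_eq_zero_left h3

theorem ols_eq_olsVec (x : Fin n → Fin q → ℝ) (y : Fin n → Tensor p) (j : Idx p × Fin q) :
    ols x y j = olsVec x (fun i => y i j.1) j.2 := rfl

theorem ae_ols_ne_zero {x : Fin n → Fin q → ℝ}
    (hx : IsUnit (designMat x * (designMat x)ᵀ).det) (j : Idx p × Fin q) :
    ∀ᵐ y : Fin n → Tensor p, ols x y j ≠ 0 := by
  set v : Fin n → Tensor p := fun i J => if J = j.1 then x i j.2 else 0 with hv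
  have hm : Measurable fun y : Fin n → Tensor p => ols x y j := by
    simp only [ols_eq_olsVec]
    exact measurable_olsVec_apply measurable_const (by fun_prop) _
  refine ae_mem_of_ae_add_linearMap_mem (LinearMap.toSpanSingleton ℝ _ v) (volume : Measure ℝ)
    (volume : Measure (Fin n → Tensor p)) (measurableSet_eq_fun hm measurable_const).compl
    fun y => ?_
  have hc : {t : ℝ | ols x (y + t • v) j = 0}.Countable := by
    refine Set.Subsingleton.countable fun t₁ h₁ t₂ h₂ => ?_
    have h : ∀ t : ℝ, ols x (y + t • v) j = ols x y j + t := fun t => by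
      have h1 : (fun i => (y + t • v) i j.1)
          = (fun i => y i j.1) + t • ((designMat x)ᵀ *ᵥ Pi.single j.2 1) := by
        ext i
        simp [hv, designMat, mulVec_single]
      rw [ols_eq_olsVec, h1, olsVec_add_smul_row hx]
      simp [ols_eq_olsVec]
    have h3 : ols x y j + t₁ = 0 := (h t₁).symm.trans h₁
    have h4 : ols x y j + t₂ = 0 := (h t₂).symm.trans h₂
    linarith
  filter_upwards [hc.ae_notMem volume] with t ht
  change ols x (y + LinearMap.toSpanSingleton ℝ _ v t) j ≠ 0
  simpa using ht

/-- The almost sure event on which the algorithm behaves well. -/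
def Regular (lam : ℝ) (x : Fin n → Fin q → ℝ) (y : Fin n → Tensor p) : Prop :=
  (∀ j, ols x y j ≠ 0) ∧ ∀ s : Idx p → Fin q → SignType, GenPos (patternTensor x lam s y)

theorem ae_regular {x : Fin n → Fin q → ℝ} {lam : ℝ}
    (hx : IsUnit (designMat x * (designMat x)ᵀ).det) (hlam : 0 < lam) :
    ∀ᵐ y : Fin n → Tensor p, Regular lam x y := by
  refine (ae_all_iff.2 fun j => ae_ols_ne_zero hx j).and (ae_all_iff.2 fun s =>
    ae_all_iff.2 fun m => ae_all_iff.2 fun f => ?_)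
  by_cases hf : Function.Injective f
  · filter_upwards [ae_det_patternTensor_ne_zero hx hlam s m f hf] with y hy _
    exact hy
  · exact Eventually.of_forall fun y h => absurd h hf

theorem measurableSet_regular {α : Type*} [MeasurableSpace α] {x : α → Fin n → Fin q → ℝ}
    {y : α → Fin n → Tensor p} (hx : Measurable x) (hy : Measurable y) (lam : ℝ) :
    MeasurableSet {a | IsUnit (designMat (x a) * (designMat (x a))ᵀ).det →
      Regular lam (x a) (y a)} := by
  have h1 : ∀ i j, Measurable fun a => designMat (x a) i j := fun i j => by
    unfold designMat
    fun_prop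
  have h2 : Measurable fun a => (designMat (x a) * (designMat (x a))ᵀ).det :=
    measurable_matrix_det (measurable_mul_apply h1 fun i j => h1 j i)
  simp only [isUnit_iff_ne_zero, Regular, GenPos]
  have h0 : ∀ {f : α → ℝ}, Measurable f → Measurable fun a => f a ≠ 0 := fun hf =>
    measurableSet_setOfPred.1 (measurableSet_eq_fun hf measurable_const).compl
  refine measurableSet_setOfPred.2 (Measurable.imp (h0 h2) (Measurable.and ?_ ?_))
  · refine Measurable.forall fun j => h0 ?_
    simp only [ols_eq_olsVec]
    exact measurable_olsVec_apply hx (by fun_prop) _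
  · refine Measurable.forall fun s => Measurable.forall fun m => Measurable.forall
      fun f => Measurable.imp measurable_const (h0 (measurable_matrix_det fun k b => ?_))
    exact measurable_patternResid_apply
      (z := fun a i => y a i (insIdx m k (f b).1)) hx (by fun_prop) _ _ _

/-- The joint law of the errors is absolutely continuous and independent of the predictors. By
Fubini it suffices to fix `x` with invertible Gram matrix; the translation by the regression mean
preserves null sets. -/
theorem ae_regular_model {Ω : Type*} [MeasurableSpace Ω] (μ : Measure Ω) [IsProbabilityMeasure μ]
    {νtrue lam : ℝ} (hlam : 0 < lam) (B₀ : CoefTensor p q) (Ξ₀ : Shape p)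
    {X : Fin n → Ω → Fin q → ℝ} {E Y : Fin n → Ω → Tensor p}
    (hXm : ∀ i, Measurable (X i)) (hEm : ∀ i, Measurable (E i))
    (hElaw : ∀ i, μ.map (E i) = tensorT 0 Ξ₀ νtrue)
    (hEindep : iIndepFun E μ)
    (hXE : IndepFun (fun ω i => X i ω) (fun ω i => E i ω) μ)
    (hY : ∀ i ω, Y i ω = vecProd B₀ (X i ω) + E i ω)
    (hX : ∀ᵐ ω ∂μ, IsUnit (designMat (fun i => X i ω) *
      (designMat (fun i => X i ω)).transpose).det) :
    ∀ᵐ ω ∂μ, Regular lam (fun i => X i ω) (fun i => Y i ω) := by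
  have hXm' : Measurable fun ω i => X i ω := measurable_pi_lambda _ hXm
  have hEm' : Measurable fun ω i => E i ω := measurable_pi_lambda _ hEm
  set S : Set ((Fin n → Fin q → ℝ) × (Fin n → Tensor p)) :=
    {a | IsUnit (designMat a.1 * (designMat a.1)ᵀ).det →
      Regular lam a.1 (fun i => vecProd B₀ (a.1 i) + a.2 i)} with hS
  have hSm : MeasurableSet S := by
    refine measurableSet_regular measurable_fst ?_ lam
    refine measurable_pi_lambda _ fun i => measurable_pi_lambda _ fun J => ?_
    simp only [Pi.add_apply, vecProd]
    fun_prop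
  have hlaw : μ.map (fun ω i => E i ω) ≪ volume := by
    have : ∀ i, IsProbabilityMeasure (μ.map (E i)) := fun i =>
      Measure.isProbabilityMeasure_map (hEm i).aemeasurable
    rw [(iIndepFun_iff_map_fun_eq_pi_map fun i => (hEm i).aemeasurable).1 hEindep, volume_pi]
    refine pi_absolutelyContinuous_fin fun i => ?_
    rw [hElaw i]
    exact withDensity_absolutelyContinuous _ _
  have hprod := (indepFun_iff_map_prod_eq_prod_map_map hXm'.aemeasurable hEm'.aemeasurable).1 hXE
  have : IsProbabilityMeasure (μ.map fun ω i => E i ω) :=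
    Measure.isProbabilityMeasure_map hEm'.aemeasurable
  have hae : ∀ᵐ a ∂(μ.map fun ω => ((fun i => X i ω), (fun i => E i ω))), a ∈ S := by
    rw [hprod, Measure.ae_prod_mem_iff_ae_ae_mem hSm]
    refine Eventually.of_forall fun x => hlaw.ae_le ?_
    by_cases hx : IsUnit (designMat x * (designMat x)ᵀ).det
    · have h := (quasiMeasurePreserving_add_left (volume : Measure (Fin n → Tensor p))
        (fun i => vecProd B₀ (x i))).ae (ae_regular (p := p) hx hlam)
      filter_upwards [h] with e he _
      exact he
    · exact Eventually.of_forall fun e h => absurd h hx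
  filter_upwards [ae_of_ae_map (hXm'.prodMk hEm').aemeasurable hae, hX] with ω h1 h2
  have h3 := h1 h2
  simpa only [← hY] using h3

/-! ### Positive definite matrices -/

open scoped MatrixOrder in
theorem exists_eq_mul_transpose {κ : Type*} [Fintype κ] [DecidableEq κ] {S : Matrix κ κ ℝ}
    (hS : S.PosDef) : ∃ G : Matrix κ κ ℝ, IsUnit G.det ∧ S = G * Gᵀ := by
  obtain ⟨B, hB⟩ := CStarAlgebra.nonneg_iff_eq_star_mul_self.mp hS.posSemidef.nonneg
  rw [star_eq_conjTranspose, conjTranspose_eq_transpose_of_trivial] at hB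
  refine ⟨Bᵀ, ?_, by rw [transpose_transpose, hB]⟩
  have h : S.det = B.det * B.det := by rw [hB, det_mul, det_transpose]
  rw [det_transpose, isUnit_iff_ne_zero]
  intro h0
  have := hS.det_pos
  rw [h, h0] at this
  simp at this

theorem exists_orthogonal_diagonal {κ : Type*} [Fintype κ] [DecidableEq κ] {T : Matrix κ κ ℝ}
    (hT : T.PosDef) : ∃ (U : Matrix κ κ ℝ) (e : κ → ℝ), U * Uᵀ = 1 ∧ (∀ a, 0 < e a) ∧
      T = U * diagonal e * Uᵀ := by
  refine ⟨(hT.isHermitian.eigenvectorUnitary : Matrix κ κ ℝ), hT.isHermitian.eigenvalues, ?_,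
    hT.eigenvalues_pos, ?_⟩
  · have h := Unitary.coe_mul_star_self hT.isHermitian.eigenvectorUnitary
    rwa [Unitary.coe_star, star_eq_conjTranspose, conjTranspose_eq_transpose_of_trivial] at h
  · have h := hT.isHermitian.spectral_theorem
    rwa [Unitary.conjStarAlgAut_apply, star_eq_conjTranspose,
      conjTranspose_eq_transpose_of_trivial] at h

/-- Two positive definite matrices can be diagonalized simultaneously. -/
theorem exists_simultaneous_diagonal {κ : Type*} [Fintype κ] [DecidableEq κ] {S T : Matrix κ κ ℝ}
    (hS : S.PosDef) (hT : T.PosDef) :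
    ∃ (G : Matrix κ κ ℝ) (h : κ → ℝ), IsUnit G.det ∧ S = G * Gᵀ ∧
      T = G * diagonal (fun a => Real.exp (h a)) * Gᵀ := by
  obtain ⟨G₀, hG₀, hS₀⟩ := exists_eq_mul_transpose hS
  -- Whiten by a square root of `S`, then diagonalize orthogonally; the rotation `U` does not
  -- disturb `S = G₀ G₀ᵀ`.
  have hpos : (G₀⁻¹ * T * (G₀⁻¹)ᵀ).PosDef := by
    have h := hT.mul_mul_conjTranspose_same (B := G₀⁻¹)
      (vecMul_injective_of_isUnit ((Matrix.isUnit_iff_isUnit_det _).2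
        (by rwa [isUnit_nonsing_inv_det_iff])))
    rwa [conjTranspose_eq_transpose_of_trivial] at h
  obtain ⟨U, e, hUU, he, hspec⟩ := exists_orthogonal_diagonal hpos
  refine ⟨G₀ * U, fun a => Real.log (e a), ?_, ?_, ?_⟩
  · rw [det_mul]
    refine hG₀.mul ?_
    have := congrArg det hUU
    rw [det_mul, det_one] at this
    exact IsUnit.of_mul_eq_one _ this
  · rw [transpose_mul, Matrix.mul_assoc, ← Matrix.mul_assoc U, hUU, Matrix.one_mul, hS₀]
  · have h1 : diagonal (fun a => Real.exp (Real.log (e a))) = diagonal e :=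
      congrArg diagonal (funext fun a => Real.exp_log (he a))
    rw [h1, transpose_mul]
    calc T = G₀ * (G₀⁻¹ * T * (G₀⁻¹)ᵀ) * G₀ᵀ := by
          rw [Matrix.mul_assoc, Matrix.mul_assoc, ← transpose_mul, mul_nonsing_inv _ hG₀,
            transpose_one, Matrix.mul_one, ← Matrix.mul_assoc, mul_nonsing_inv _ hG₀,
            Matrix.one_mul]
      _ = _ := by rw [hspec]; simp only [Matrix.mul_assoc]

theorem inv_mul_transpose {κ : Type*} [Fintype κ] [DecidableEq κ] (G : Matrix κ κ ℝ) :
    (G * Gᵀ)⁻¹ = (G⁻¹)ᵀ * G⁻¹ := by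
  rw [Matrix.mul_inv_rev, transpose_nonsing_inv]

/-- In a simultaneous diagonalization this is `h + 1 ≤ exp h`, summed over the logarithms `h` of the
relative eigenvalues. -/
theorem log_det_sub_log_det_le {κ : Type*} [Fintype κ] [DecidableEq κ] {S T : Matrix κ κ ℝ}
    (hS : S.PosDef) (hT : T.PosDef) :
    Real.log T.det - Real.log S.det ≤ (S⁻¹ * T).trace - Fintype.card κ := by
  obtain ⟨G, h, hG, rfl, rfl⟩ := exists_simultaneous_diagonal hS hT
  have h1 : (G * diagonal (fun a => Real.exp (h a)) * Gᵀ).det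
      = (G * Gᵀ).det * Real.exp (∑ a, h a) := by
    rw [det_mul, det_mul, det_mul, det_diagonal, Real.exp_sum]
    ring
  have h2 : ((G * Gᵀ)⁻¹ * (G * diagonal (fun a => Real.exp (h a)) * Gᵀ)).trace
      = ∑ a, Real.exp (h a) := by
    rw [inv_mul_transpose, trace_mul_comm, Matrix.mul_assoc, Matrix.mul_assoc, ← Matrix.mul_assoc Gᵀ,
      ← transpose_mul, nonsing_inv_mul _ hG, transpose_one, Matrix.one_mul, trace_mul_comm,
      Matrix.mul_assoc, nonsing_inv_mul _ hG, Matrix.mul_one, trace_diagonal]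
  rw [h1, h2, Real.log_mul hS.det_pos.ne' (Real.exp_pos _).ne', Real.log_exp]
  have h3 : ∑ a, (h a + 1) ≤ ∑ a, Real.exp (h a) :=
    Finset.sum_le_sum fun a _ => Real.add_one_le_exp (h a)
  simp only [Finset.sum_add_distrib, Finset.sum_const, Finset.card_univ, nsmul_eq_mul,
    mul_one] at h3
  linarith

/-- Hadamard's inequality. -/
theorem log_det_le_sum_log_diag {κ : Type*} [Fintype κ] [DecidableEq κ] {T : Matrix κ κ ℝ}
    (hT : T.PosDef) : Real.log T.det ≤ ∑ a, Real.log (T a a) := by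
  have hpos : ∀ a, 0 < T a a := fun a => hT.diag_pos
  -- Comparing `T` with its own diagonal makes the trace term cancel the dimension.
  have h := log_det_sub_log_det_le (PosDef.diagonal hpos) hT
  have h1 : ((diagonal fun a => T a a)⁻¹ * T).trace = Fintype.card κ := by
    have hinv : (diagonal fun a => T a a)⁻¹ = diagonal fun a => (T a a)⁻¹ := by
      refine inv_eq_left_inv ?_
      rw [diagonal_mul_diagonal, ← diagonal_one]
      exact congrArg diagonal (funext fun a => inv_mul_cancel₀ (hpos a).ne')
    rw [hinv, trace]
    simp [diagonal_mul, (hpos _).ne']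
  rw [h1, det_diagonal, Real.log_prod fun a _ => (hpos a).ne'] at h
  linarith

/-! ### Kronecker products of families of matrices -/

section Kron

variable {ι : Type*} [Fintype ι] {κ : ι → Type*}

/-- The Kronecker product of a family of square matrices. -/
def piKron (P : ∀ j, Matrix (κ j) (κ j) ℝ) : Matrix (∀ j, κ j) (∀ j, κ j) ℝ :=
  fun c d => ∏ j, P j (c j) (d j)

theorem piKron_transpose (P : ∀ j, Matrix (κ j) (κ j) ℝ) :
    (piKron P)ᵀ = piKron fun j => (P j)ᵀ := rfl

theorem piKron_diagonal [∀ j, DecidableEq (κ j)] (d : ∀ j, κ j → ℝ) :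
    piKron (fun j => diagonal (d j)) = diagonal fun c => ∏ j, d j (c j) := by
  ext a c
  by_cases h : a = c
  · subst h; simp [piKron]
  · obtain ⟨j, hj⟩ := Function.ne_iff.1 h
    rw [diagonal_apply_ne _ h]
    exact Finset.prod_eq_zero (Finset.mem_univ j) (diagonal_apply_ne _ hj)

theorem piKron_one [∀ j, DecidableEq (κ j)] :
    piKron (fun j => (1 : Matrix (κ j) (κ j) ℝ)) = 1 := by
  have h := piKron_diagonal (fun (j : ι) (_ : κ j) => (1 : ℝ))
  simpa using h

variable [∀ j, Fintype (κ j)] [DecidableEq ι]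

theorem piKron_mul (P Q : ∀ j, Matrix (κ j) (κ j) ℝ) :
    piKron P * piKron Q = piKron fun j => P j * Q j := by
  ext a c
  simp only [piKron, mul_apply, ← Finset.prod_mul_distrib]
  rw [Finset.prod_univ_sum, Fintype.piFinset_univ]

variable [∀ j, DecidableEq (κ j)]

theorem piKron_inv {P : ∀ j, Matrix (κ j) (κ j) ℝ} (hP : ∀ j, IsUnit (P j).det) :
    (piKron P)⁻¹ = piKron fun j => (P j)⁻¹ := by
  refine inv_eq_left_inv ?_
  rw [piKron_mul]
  simp only [nonsing_inv_mul _ (hP _)]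
  exact piKron_one

theorem isUnit_piKron_det {P : ∀ j, Matrix (κ j) (κ j) ℝ} (hP : ∀ j, IsUnit (P j).det) :
    IsUnit (piKron P).det := by
  refine isUnit_det_of_left_inverse (B := piKron fun j => (P j)⁻¹) ?_
  rw [piKron_mul]
  simp only [nonsing_inv_mul _ (hP _)]
  exact piKron_one

theorem piKron_posDef {P : ∀ j, Matrix (κ j) (κ j) ℝ} (hP : ∀ j, (P j).PosDef) :
    (piKron P).PosDef := by
  choose G hG hPG using fun j => exists_eq_mul_transpose (hP j)
  have h : piKron P = piKron G * (piKron G)ᴴ := by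
    rw [conjTranspose_eq_transpose_of_trivial, piKron_transpose, piKron_mul]
    exact congrArg piKron (funext hPG)
  rw [h]
  exact PosDef.mul_conjTranspose_self _ (vecMul_injective_of_isUnit
    ((Matrix.isUnit_iff_isUnit_det _).2 (isUnit_piKron_det hG)))

end Kron

/-! ### The squared Mahalanobis norm and the mode updates -/


/-- The quadratic form of a tensor given by a tuple of matrices. -/
def kronQuad (P : Shape p) (A : Tensor p) : ℝ := A ⬝ᵥ piKron P *ᵥ A

theorem mahaSq_eq_kronQuad (Ξ : Shape p) (A : Tensor p) :
    mahaSq Ξ A = kronQuad (shapeInv Ξ) A := by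
  rw [kronQuad, dotProduct_comm]
  rfl

theorem tucker_eq_mulVec (A : Tensor p) (G : Shape p) : tucker A G = piKron G *ᵥ A := rfl

theorem kronQuad_diagonal (H : Shape p) (d : ∀ m, Fin (p m) → ℝ) (A : Tensor p) :
    kronQuad (fun m => (H m)ᵀ * diagonal (d m) * H m) A
      = ∑ J, (∏ m, d m (J m)) * (tucker A H J) ^ 2 := by
  rw [kronQuad, ← piKron_mul, ← piKron_mul, ← piKron_transpose, piKron_diagonal,
    ← mulVec_mulVec, ← mulVec_mulVec, dotProduct_mulVec, vecMul_transpose, ← tucker_eq_mulVec]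
  simp only [dotProduct, mulVec_diagonal]
  exact Finset.sum_congr rfl fun J _ => by ring

theorem sum_idx (m : Fin M) (g : Idx p → ℝ) :
    ∑ J, g J = ∑ a, ∑ c, g (insIdx m a c) := by
  rw [← (Equiv.piSplitAt m fun j => Fin (p j)).symm.sum_comp, Fintype.sum_prod_type]
  rfl

theorem insIdx_ne (m : Fin M) (a : Fin (p m)) (c : CoIdx p m) (j : {j : Fin M // j ≠ m}) :
    insIdx m a c j = c j := by
  simp [insIdx, Equiv.piSplitAt, j.2]

theorem matricize_apply (A : Tensor p) (m : Fin M) (a : Fin (p m)) (c : CoIdx p m) :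
    matricize A m a c = A (insIdx m a c) := rfl

theorem kronQuad_eq_trace (P : Shape p) (A : Tensor p) (m : Fin M) :
    kronQuad P A = ((P m)ᵀ * (matricize A m * piKron (fun j : {j : Fin M // j ≠ m} => P j)
      * (matricize A m)ᵀ)).trace := by
  have h : ∀ a a' c c', piKron P (insIdx m a c) (insIdx m a' c')
      = P m a a' * piKron (fun j : {j : Fin M // j ≠ m} => P j) c c' := fun a a' c c' => by
    simp only [piKron]
    rw [Fintype.prod_eq_mul_prod_subtype_ne _ m]
    simp only [insIdx_self, insIdx_ne]
  have h1 : kronQuad P A = ∑ a, ∑ a', ∑ c, ∑ c', A (insIdx m a c) * (P m a a' *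
      piKron (fun j : {j : Fin M // j ≠ m} => P j) c c' * A (insIdx m a' c')) := by
    simp only [kronQuad, dotProduct, mulVec, Finset.mul_sum]
    rw [sum_idx m]
    refine Finset.sum_congr rfl fun a _ => ?_
    simp only [sum_idx m (fun J => A _ * _), h]
    rw [Finset.sum_comm]
  rw [h1, trace, Finset.sum_comm]
  refine Finset.sum_congr rfl fun a' _ => ?_
  simp only [diag_apply, mul_apply, transpose_apply, matricize_apply, Finset.mul_sum,
    Finset.sum_mul]
  refine Finset.sum_congr rfl fun a _ => ?_
  rw [Finset.sum_comm]
  refine Finset.sum_congr rfl fun c' _ => Finset.sum_congr rfl fun c _ => by ring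

theorem kronInv_eq (Ξ : Shape p) (m : Fin M) :
    kronInv Ξ m = piKron fun j : {j : Fin M // j ≠ m} => (Ξ j)⁻¹ := rfl

theorem kronInv_posDef {Ξ : Shape p} (hΞ : IsPD Ξ) (m : Fin M) : (kronInv Ξ m).PosDef :=
  piKron_posDef fun j => (hΞ j).inv

theorem card_coIdx (m : Fin M) : Fintype.card (CoIdx p m) = coDim p m := by
  rw [Fintype.card_pi, coDim]
  simp only [Fintype.card_fin]
  rw [← Finset.prod_subtype (p := fun j => j ≠ m) (Finset.univ.erase m) (by simp) p]

theorem totalDim_eq (p : Fin M → ℕ) (m : Fin M) : totalDim p = p m * coDim p m := by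
  rw [totalDim, coDim, Finset.mul_prod_erase _ _ (Finset.mem_univ m)]

/-- Stated for an arbitrary `Q` in mode `m`: an inverse matrix gives the surrogate, while an
indefinite direction gives the stationarity equation in `shapeObj_le_of_fixed`. -/
theorem sum_weight_kronQuad (R : Fin n → Tensor p) (w : Fin n → ℝ) (Ξ : Shape p) (m : Fin M)
    (hnp : (n : ℝ) * coDim p m ≠ 0) (Q : Matrix (Fin (p m)) (Fin (p m)) ℝ) :
    ∑ i, w i * kronQuad (Function.update (shapeInv Ξ) m Q) (R i)
      = n * coDim p m * (Qᵀ * modeUpdate R w Ξ m).trace := by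
  have h : ∀ i, kronQuad (Function.update (shapeInv Ξ) m Q) (R i)
      = (Qᵀ * (matricize (R i) m * kronInv Ξ m * (matricize (R i) m)ᵀ)).trace := fun i => by
    rw [kronQuad_eq_trace _ _ m, Function.update_self]
    congr 5
    funext j
    rw [Function.update_of_ne j.2]
    rfl
  simp only [h, modeUpdate, Matrix.mul_smul, trace_smul, Matrix.mul_sum, trace_sum, smul_eq_mul]
  rw [mul_inv_cancel_left₀ hnp]

theorem shapeInv_update (Ξ : Shape p) (m : Fin M) (S : Matrix (Fin (p m)) (Fin (p m)) ℝ) :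
    shapeInv (Function.update Ξ m S) = Function.update (shapeInv Ξ) m S⁻¹ := by
  funext j
  by_cases h : j = m
  · subst h; simp [shapeInv]
  · simp [shapeInv, h]

theorem sum_weight_mahaSq_update (R : Fin n → Tensor p) (w : Fin n → ℝ) (Ξ : Shape p) (m : Fin M)
    (hnp : (n : ℝ) * coDim p m ≠ 0) {S : Matrix (Fin (p m)) (Fin (p m)) ℝ} (hS : S.PosDef) :
    ∑ i, w i * mahaSq (Function.update Ξ m S) (R i)
      = n * coDim p m * (S⁻¹ * modeUpdate R w Ξ m).trace := by
  simp only [mahaSq_eq_kronQuad, shapeInv_update]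
  rw [sum_weight_kronQuad _ _ _ _ hnp]
  have h : (S⁻¹)ᵀ = S⁻¹ := by
    simpa [conjTranspose_eq_transpose_of_trivial] using hS.inv.isHermitian.eq
  rw [h]

theorem mahaSq_nonneg {Ξ : Shape p} (hΞ : IsPD Ξ) (A : Tensor p) : 0 ≤ mahaSq Ξ A := by
  rw [mahaSq_eq_kronQuad]
  exact posSemidef_quad_nonneg (piKron_posDef fun m => (hΞ m).inv).posSemidef A

theorem mahaSq_pos {Ξ : Shape p} (hΞ : IsPD Ξ) {A : Tensor p} (hA : A ≠ 0) : 0 < mahaSq Ξ A := by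
  rw [mahaSq_eq_kronQuad]
  exact posDef_quad_pos (piKron_posDef fun m => (hΞ m).inv) hA

/-! ### Positive definiteness of the mode updates and majorization of the objective -/

theorem modeUpdate_transpose (R : Fin n → Tensor p) (w : Fin n → ℝ) {Ξ : Shape p} (hΞ : IsPD Ξ)
    (m : Fin M) : (modeUpdate R w Ξ m)ᵀ = modeUpdate R w Ξ m := by
  have h : (kronInv Ξ m)ᵀ = kronInv Ξ m := by
    simpa [conjTranspose_eq_transpose_of_trivial] using (kronInv_posDef hΞ m).isHermitian.eq
  simp only [modeUpdate, transpose_smul, transpose_sum, transpose_mul, transpose_transpose, h,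
    Matrix.mul_assoc]

theorem modeUpdate_quad (R : Fin n → Tensor p) (w : Fin n → ℝ) (Ξ : Shape p) (m : Fin M)
    (v : Fin (p m) → ℝ) :
    v ⬝ᵥ modeUpdate R w Ξ m *ᵥ v = ((n : ℝ) * coDim p m)⁻¹ *
      ∑ i, w i * (((matricize (R i) m)ᵀ *ᵥ v) ⬝ᵥ kronInv Ξ m *ᵥ ((matricize (R i) m)ᵀ *ᵥ v)) := by
  have h : ∀ i, v ⬝ᵥ (matricize (R i) m * kronInv Ξ m * (matricize (R i) m)ᵀ) *ᵥ v
      = ((matricize (R i) m)ᵀ *ᵥ v) ⬝ᵥ kronInv Ξ m *ᵥ ((matricize (R i) m)ᵀ *ᵥ v) := fun i => by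
    rw [← mulVec_mulVec, ← mulVec_mulVec, dotProduct_mulVec v, ← mulVec_transpose]
  simp only [modeUpdate, smul_mulVec, dotProduct_smul, sum_mulVec, dotProduct_sum, smul_eq_mul, h]

/-- There are at least `p m` columns in all the matricizations together; a vector orthogonal to all
of them would make an invertible square selection singular. -/
theorem exists_matricize_mulVec_ne_zero {R : Fin n → Tensor p} (hR : GenPos R) {m : Fin M}
    (hn : p m ≤ n * coDim p m) {v : Fin (p m) → ℝ} (hv : v ≠ 0) :
    ∃ i, (matricize (R i) m)ᵀ *ᵥ v ≠ 0 := by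
  obtain ⟨f⟩ := Function.Embedding.nonempty_of_card_le
    (α := Fin (p m)) (β := CoIdx p m × Fin n) (by
      rw [Fintype.card_prod, card_coIdx, Fintype.card_fin, Fintype.card_fin, mul_comm]; exact hn)
  by_contra hcon
  push Not at hcon
  refine hR m f f.injective (exists_vecMul_eq_zero_iff.1 ⟨v, hv, ?_⟩)
  ext b
  have h := congrFun (hcon (f b).2) (f b).1
  rw [mulVec_transpose] at h
  exact h

theorem modeUpdate_posDef {R : Fin n → Tensor p} (hR : GenPos R) {m : Fin M}
    (hp : 0 < p m) (hn : p m ≤ n * coDim p m) {w : Fin n → ℝ} (hw : ∀ i, 0 < w i) {Ξ : Shape p}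
    (hΞ : IsPD Ξ) : (modeUpdate R w Ξ m).PosDef := by
  refine posDef_of_quad_pos (modeUpdate_transpose R w hΞ m) fun v hv => ?_
  rw [modeUpdate_quad]
  have hnp : (0 : ℝ) < n * coDim p m := by exact_mod_cast hp.trans_le hn
  obtain ⟨i, hi⟩ := exists_matricize_mulVec_ne_zero hR hn hv
  refine mul_pos (inv_pos.2 hnp) (Finset.sum_pos' (fun i _ => ?_) ⟨i, Finset.mem_univ i, ?_⟩)
  · exact mul_nonneg (hw i).le (posSemidef_quad_nonneg (kronInv_posDef hΞ m).posSemidef _)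
  · exact mul_pos (hw i) (posDef_quad_pos (kronInv_posDef hΞ m) hi)

/-- The Gaussian surrogate of `shapeObj` for fixed weights. -/
noncomputable def shapeSurrogate (R : Fin n → Tensor p) (w : Fin n → ℝ) (Ξ : Shape p) : ℝ :=
  (n : ℝ) / 2 * (∑ m, (coDim p m : ℝ) * Real.log (Ξ m).det) + 1 / 2 * ∑ i, w i * mahaSq Ξ (R i)

/-- As a function of `Σ_m` alone the surrogate is a multiple of `log det Σ_m + tr (Σ_m⁻¹ S)` plus a
constant, with `S` the mode update, and `S` minimizes it by `log_det_sub_log_det_le`. -/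
theorem shapeSurrogate_modeUpdate_le {R : Fin n → Tensor p} {w : Fin n → ℝ} {Ξ : Shape p}
    (hΞ : IsPD Ξ) {m : Fin M} (hnp : (0 : ℝ) < n * coDim p m)
    (hS : (modeUpdate R w Ξ m).PosDef) :
    shapeSurrogate R w (Function.update Ξ m (modeUpdate R w Ξ m)) ≤ shapeSurrogate R w Ξ := by
  have h1 := sum_weight_mahaSq_update R w Ξ m hnp.ne' hS
  have h2 := sum_weight_mahaSq_update R w Ξ m hnp.ne' (hΞ m)
  have h3 := log_det_sub_log_det_le (hΞ m) hS
  rw [Function.update_eq_self] at h2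
  rw [nonsing_inv_mul _ ((Matrix.isUnit_iff_isUnit_det _).1 hS.isUnit), trace_one] at h1
  have h4 : ∀ Ξ' : Shape p, ∑ j, (coDim p j : ℝ) * Real.log (Ξ' j).det
      = coDim p m * Real.log (Ξ' m).det
        + ∑ j ∈ Finset.univ.erase m, (coDim p j : ℝ) * Real.log (Ξ' j).det := fun Ξ' =>
    (Finset.add_sum_erase _ _ (Finset.mem_univ m)).symm
  have h5 : ∑ j ∈ Finset.univ.erase m,
      (coDim p j : ℝ) * Real.log (Function.update Ξ m (modeUpdate R w Ξ m) j).det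
      = ∑ j ∈ Finset.univ.erase m, (coDim p j : ℝ) * Real.log (Ξ j).det :=
    Finset.sum_congr rfl fun j hj => by rw [Function.update_of_ne (Finset.ne_of_mem_erase hj)]
  unfold shapeSurrogate
  rw [h1, h2, h4, h4 Ξ, h5, Function.update_self]
  nlinarith

/-- Concavity of the logarithm: the weights are the slopes of its tangents at the current norms, so
the surrogate majorizes increments of the objective. -/
theorem shapeObj_le_of_shapeSurrogate {ν : ℝ} (hν : 0 < ν) (R : Fin n → Tensor p)
    {Ξ Ξ' : Shape p} (hΞ : IsPD Ξ) (hΞ' : IsPD Ξ') :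
    shapeObj ν R Ξ' - shapeObj ν R Ξ
      ≤ shapeSurrogate R (tWeight ν R Ξ) Ξ' - shapeSurrogate R (tWeight ν R Ξ) Ξ := by
  have h : ∀ i, (ν + totalDim p) / 2 * (Real.log (1 + mahaSq Ξ' (R i) / ν)
      - Real.log (1 + mahaSq Ξ (R i) / ν))
      ≤ 1 / 2 * (tWeight ν R Ξ i * mahaSq Ξ' (R i) - tWeight ν R Ξ i * mahaSq Ξ (R i)) := by
    intro i
    have ha := mahaSq_nonneg hΞ (R i)
    have hb := mahaSq_nonneg hΞ' (R i)
    set a := mahaSq Ξ (R i)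
    set b := mahaSq Ξ' (R i)
    have h1 : Real.log (1 + b / ν) - Real.log (1 + a / ν) ≤ (b - a) / (ν + a) := by
      rw [← Real.log_div (by positivity) (by positivity)]
      refine (Real.log_le_sub_one_of_pos (by positivity)).trans (le_of_eq ?_)
      have : ν + a ≠ 0 := by positivity
      field_simp
      ring
    calc _ ≤ (ν + totalDim p) / 2 * ((b - a) / (ν + a)) := by gcongr
      _ = _ := by simp only [tWeight]; ring
  have h2 := Finset.sum_le_sum fun i (_ : i ∈ Finset.univ) => h i
  simp only [← Finset.mul_sum, Finset.sum_sub_distrib] at h2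
  unfold shapeObj shapeSurrogate
  linarith

/-! ### Limits of shapes -/

theorem tendsto_matrix_inv {α κ : Type*} [Fintype κ] [DecidableEq κ] {l : Filter α}
    {A : α → Matrix κ κ ℝ} {B : Matrix κ κ ℝ} (hB : IsUnit B.det) (h : Tendsto A l (𝓝 B)) :
    Tendsto (fun a => (A a)⁻¹) l (𝓝 B⁻¹) := by
  simp only [inv_def, Ring.inverse_eq_inv']
  have h1 : Tendsto (fun a => (A a).det) l (𝓝 B.det) :=
    ((continuous_id.matrix_det (A := fun A : Matrix κ κ ℝ => A)).tendsto B).comp h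
  have h2 : Tendsto (fun a => (A a).adjugate) l (𝓝 B.adjugate) :=
    ((continuous_id.matrix_adjugate (A := fun A : Matrix κ κ ℝ => A)).tendsto B).comp h
  exact (h1.inv₀ (isUnit_iff_ne_zero.1 hB)).smul h2

theorem tendsto_matrix_apply {α κ₁ κ₂ : Type*} {l : Filter α} {A : α → Matrix κ₁ κ₂ ℝ}
    {B : Matrix κ₁ κ₂ ℝ} (h : Tendsto A l (𝓝 B)) (i : κ₁) (j : κ₂) :
    Tendsto (fun a => A a i j) l (𝓝 (B i j)) :=
  ((continuous_id.matrix_elem (A := fun A : Matrix κ₁ κ₂ ℝ => A) i j).tendsto B).comp h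

theorem tendsto_quad {α κ : Type*} [Fintype κ] {l : Filter α} {A : α → Matrix κ κ ℝ}
    {B : Matrix κ κ ℝ} (h : Tendsto A l (𝓝 B)) (v : κ → ℝ) :
    Tendsto (fun a => v ⬝ᵥ A a *ᵥ v) l (𝓝 (v ⬝ᵥ B *ᵥ v)) := by
  simp only [dotProduct, mulVec]
  exact tendsto_finsetSum _ fun i _ => (tendsto_finsetSum _ fun j _ =>
    (tendsto_matrix_apply h i j).mul_const _).const_mul _

theorem isUnit_det_of_posDef {κ : Type*} [Fintype κ] [DecidableEq κ] {A : Matrix κ κ ℝ}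
    (hA : A.PosDef) : IsUnit A.det := (Matrix.isUnit_iff_isUnit_det _).1 hA.isUnit

theorem tendsto_mahaSq {α : Type*} {l : Filter α} {Ξ : α → Shape p} {Ξhat : Shape p}
    (h : Tendsto Ξ l (𝓝 Ξhat)) (hpd : IsPD Ξhat) (A : Tensor p) :
    Tendsto (fun a => mahaSq (Ξ a) A) l (𝓝 (mahaSq Ξhat A)) := by
  unfold mahaSq tucker shapeInv
  refine tendsto_finsetSum _ fun J _ => (tendsto_finsetSum _ fun K _ =>
    (tendsto_finsetProd _ fun m _ => ?_).mul_const _).mul_const _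
  exact tendsto_matrix_apply
    (tendsto_matrix_inv (isUnit_det_of_posDef (hpd m)) (tendsto_pi_nhds.1 h m)) _ _

theorem tendsto_log_det {α : Type*} {l : Filter α} {Ξ : α → Shape p} {Ξhat : Shape p}
    (h : Tendsto Ξ l (𝓝 Ξhat)) {m : Fin M} (hpd : (Ξhat m).PosDef) :
    Tendsto (fun a => Real.log (Ξ a m).det) l (𝓝 (Real.log (Ξhat m).det)) :=
  (((continuous_id.matrix_det (A := fun A : Matrix _ _ ℝ => A)).tendsto (Ξhat m)).comp
    (tendsto_pi_nhds.1 h m)).log hpd.det_pos.ne'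

theorem tendsto_shapeSurrogate {α : Type*} {l : Filter α} {Ξ : α → Shape p} {Ξhat : Shape p}
    (h : Tendsto Ξ l (𝓝 Ξhat)) (hpd : IsPD Ξhat) (R : Fin n → Tensor p) (w : Fin n → ℝ) :
    Tendsto (fun a => shapeSurrogate R w (Ξ a)) l (𝓝 (shapeSurrogate R w Ξhat)) := by
  unfold shapeSurrogate
  exact ((tendsto_finsetSum _ fun m _ => (tendsto_log_det h (hpd m)).const_mul _).const_mul _).add
    ((tendsto_finsetSum _ fun i _ => (tendsto_mahaSq h hpd (R i)).const_mul _).const_mul _)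

theorem tendsto_tWeight {α : Type*} {l : Filter α} {Ξ : α → Shape p} {Ξhat : Shape p}
    {ν : ℝ} (hν : 0 < ν) (h : Tendsto Ξ l (𝓝 Ξhat)) (hpd : IsPD Ξhat) (R : Fin n → Tensor p) :
    Tendsto (fun a => tWeight ν R (Ξ a)) l (𝓝 (tWeight ν R Ξhat)) := by
  unfold tWeight
  refine tendsto_pi_nhds.2 fun i => tendsto_const_nhds.div
    ((tendsto_mahaSq h hpd (R i)).const_add _) ?_
  have := mahaSq_nonneg hpd (R i)
  positivity

theorem tendsto_modeUpdate {α : Type*} {l : Filter α} {Ξ : α → Shape p} {Ξhat : Shape p}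
    {w : α → Fin n → ℝ} {what : Fin n → ℝ} (hw : Tendsto w l (𝓝 what))
    (h : Tendsto Ξ l (𝓝 Ξhat)) (hpd : IsPD Ξhat) (R : Fin n → Tensor p) (m : Fin M) :
    Tendsto (fun a => modeUpdate R (w a) (Ξ a) m) l (𝓝 (modeUpdate R what Ξhat m)) := by
  have hK : Tendsto (fun a => kronInv (Ξ a) m) l (𝓝 (kronInv Ξhat m)) := by
    refine tendsto_pi_nhds.2 fun c => tendsto_pi_nhds.2 fun d =>
      tendsto_finsetProd _ fun j _ => ?_
    exact tendsto_matrix_apply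
      (tendsto_matrix_inv (isUnit_det_of_posDef (hpd j)) (tendsto_pi_nhds.1 h j)) _ _
  unfold modeUpdate
  refine (tendsto_finsetSum _ fun i _ => (tendsto_pi_nhds.1 hw i).smul ?_).const_smul _
  have hc : Continuous fun K : Matrix (CoIdx p m) (CoIdx p m) ℝ =>
      matricize (R i) m * K * (matricize (R i) m)ᵀ :=
    (continuous_const.matrix_mul continuous_id).matrix_mul continuous_const
  exact (hc.tendsto _).comp hK

theorem exists_entry_bound {Ξ : ℕ → Shape p} {Ξhat : Shape p} (h : Tendsto Ξ atTop (𝓝 Ξhat)) :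
    ∃ C : ℝ, 1 ≤ C ∧ ∀ k m a b, |Ξ k m a b| ≤ C := by
  have h1 : ∀ m a b, ∃ C, ∀ k, |Ξ k m a b| ≤ C := fun m a b => by
    obtain ⟨C, hC⟩ := ((tendsto_matrix_apply (tendsto_pi_nhds.1 h m) a b).abs).bddAbove_range
    exact ⟨C, fun k => hC ⟨k, rfl⟩⟩
  choose C hC using h1
  have hC0 : ∀ m a b, 0 ≤ C m a b := fun m a b => (abs_nonneg _).trans (hC m a b 0)
  refine ⟨1 + ∑ m, ∑ a, ∑ b, C m a b, ?_, fun k m a b => ?_⟩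
  · have : 0 ≤ ∑ m, ∑ a, ∑ b, C m a b := Finset.sum_nonneg fun m _ => Finset.sum_nonneg
      fun a _ => Finset.sum_nonneg fun b _ => hC0 m a b
    linarith
  · have h2 : C m a b ≤ ∑ b, C m a b :=
      Finset.single_le_sum (f := fun b => C m a b) (fun b _ => hC0 m a b) (Finset.mem_univ b)
    have h3 : ∑ b, C m a b ≤ ∑ a, ∑ b, C m a b :=
      Finset.single_le_sum (f := fun a => ∑ b, C m a b)
        (fun a _ => Finset.sum_nonneg fun b _ => hC0 m a b) (Finset.mem_univ a)
    have h4 : ∑ a, ∑ b, C m a b ≤ ∑ m, ∑ a, ∑ b, C m a b :=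
      Finset.single_le_sum (f := fun m => ∑ a, ∑ b, C m a b)
        (fun m _ => Finset.sum_nonneg fun a _ => Finset.sum_nonneg fun b _ => hC0 m a b)
        (Finset.mem_univ m)
    have := hC m a b k
    linarith

/-- An upper bound on the entries of the shape suffices: the inverse of `kronInv` is the Kronecker
product of the matrices themselves, so the bound is uniform even for nearly singular shapes. -/
theorem exists_kronInv_quad_ge (p : Fin M → ℕ) {C : ℝ} (hC : 1 ≤ C) (m : Fin M) :
    ∃ c > 0, ∀ Ξ : Shape p, IsPD Ξ → (∀ j a b, |Ξ j a b| ≤ C) → ∀ v : CoIdx p m → ℝ,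
      c * (v ⬝ᵥ v) ≤ v ⬝ᵥ kronInv Ξ m *ᵥ v := by
  have hC0 : 0 < C := by linarith
  set D : ℝ := C ^ Fintype.card {j : Fin M // j ≠ m} with hD
  have hD0 : 0 < D := by positivity
  refine ⟨(D * (Fintype.card (CoIdx p m) + 1))⁻¹, by positivity, fun Ξ hΞ hb => ?_⟩
  refine quad_ge_of_inv_entry_le (kronInv_posDef hΞ m) hD0 fun c d => ?_
  have hinv : (kronInv Ξ m)⁻¹ = piKron fun j : {j : Fin M // j ≠ m} => Ξ j := by
    rw [kronInv_eq, piKron_inv (P := fun j : {j : Fin M // j ≠ m} => (Ξ j)⁻¹)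
      fun j => isUnit_det_of_posDef (hΞ j).inv]
    refine congrArg piKron (funext fun j => ?_)
    exact nonsing_inv_nonsing_inv _ (isUnit_det_of_posDef (hΞ j))
  rw [hinv, piKron, Finset.abs_prod]
  calc ∏ j : {j : Fin M // j ≠ m}, |Ξ j (c j) (d j)|
      ≤ ∏ _j : {j : Fin M // j ≠ m}, C :=
        Finset.prod_le_prod (fun j _ => abs_nonneg _) fun j _ => hb j _ _
    _ = D := by rw [Finset.prod_const, hD, Finset.card_univ]

theorem modeUpdate_quad_ge {m : Fin M} {c : ℝ} {Ξ : Shape p}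
    (hc : ∀ v : CoIdx p m → ℝ, c * (v ⬝ᵥ v) ≤ v ⬝ᵥ kronInv Ξ m *ᵥ v) (R : Fin n → Tensor p)
    {w : Fin n → ℝ} (hw : ∀ i, 0 ≤ w i) (v : Fin (p m) → ℝ) :
    ((n : ℝ) * coDim p m)⁻¹ * ∑ i, w i * (c * (((matricize (R i) m)ᵀ *ᵥ v) ⬝ᵥ
      ((matricize (R i) m)ᵀ *ᵥ v))) ≤ v ⬝ᵥ modeUpdate R w Ξ m *ᵥ v := by
  rw [modeUpdate_quad]
  gcongr with i
  · exact hw i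
  · exact hc _

/-! ### One round of the shape estimation -/

/-- The properties of one round with weights `w`, leading from `Ξ` to `Ξ'`. -/
structure RoundSpec (R : Fin n → Tensor p) (w : Fin n → ℝ) (Ξ Ξ' : Shape p) : Prop where
  pd : IsPD Ξ'
  total : ∑ i, w i * mahaSq Ξ' (R i) = n * totalDim p
  descent : shapeSurrogate R w Ξ' ≤ shapeSurrogate R w Ξ
  mode : ∀ m, ∃ Ξ'', IsPD Ξ'' ∧ (∀ j, Ξ'' j = Ξ j ∨ Ξ'' j = Ξ' j) ∧ Ξ' m = modeUpdate R w Ξ'' m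

/-- The updates of the modes in a list, with fixed weights. -/
noncomputable def modeSweep (R : Fin n → Tensor p) (w : Fin n → ℝ) (l : List (Fin M))
    (Ξ : Shape p) : Shape p :=
  l.foldl (fun Ξ m => Function.update Ξ m (modeUpdate R w Ξ m)) Ξ

theorem isPD_update {Ξ : Shape p} (hΞ : IsPD Ξ) {m : Fin M}
    {S : Matrix (Fin (p m)) (Fin (p m)) ℝ} (hS : S.PosDef) : IsPD (Function.update Ξ m S) := by
  intro j
  by_cases h : j = m
  · subst h; simpa using hS
  · simpa [h] using hΞ j

section Round

variable {R : Fin n → Tensor p} {w : Fin n → ℝ}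

theorem modeSweep_isPD (hR : GenPos R) (hp : ∀ m, 0 < p m) (hn : ∀ m, p m ≤ n * coDim p m)
    (hw : ∀ i, 0 < w i) (l : List (Fin M)) {Ξ : Shape p} (hΞ : IsPD Ξ) :
    IsPD (modeSweep R w l Ξ) := by
  induction l generalizing Ξ with
  | nil => exact hΞ
  | cons m l ih => exact ih (isPD_update hΞ (modeUpdate_posDef hR (hp m) (hn m) hw hΞ))

theorem modeSweep_surrogate_le (hR : GenPos R) (hp : ∀ m, 0 < p m)
    (hn : ∀ m, p m ≤ n * coDim p m) (hw : ∀ i, 0 < w i) (l : List (Fin M)) {Ξ : Shape p}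
    (hΞ : IsPD Ξ) : shapeSurrogate R w (modeSweep R w l Ξ) ≤ shapeSurrogate R w Ξ := by
  induction l generalizing Ξ with
  | nil => exact le_rfl
  | cons m l ih =>
    have hS := modeUpdate_posDef hR (hp m) (hn m) hw hΞ
    have hnp : (0 : ℝ) < n * coDim p m := by exact_mod_cast (hp m).trans_le (hn m)
    exact (ih (isPD_update hΞ hS)).trans (shapeSurrogate_modeUpdate_le hΞ hnp hS)

theorem modeSweep_of_notMem (l : List (Fin M)) {m : Fin M} (hm : m ∉ l) (Ξ : Shape p) :
    modeSweep R w l Ξ m = Ξ m := by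
  induction l generalizing Ξ with
  | nil => rfl
  | cons m' l ih =>
    rw [List.mem_cons, not_or] at hm
    exact (ih hm.2 _).trans (Function.update_of_ne hm.1 _ _)

/-- When mode `m` is updated, the modes visited before already have their final values, since the
list has no repetitions, and the others still have their old ones. -/
theorem modeSweep_mode (hR : GenPos R) (hp : ∀ m, 0 < p m) (hn : ∀ m, p m ≤ n * coDim p m)
    (hw : ∀ i, 0 < w i) (l : List (Fin M)) (hl : l.Nodup) {Ξ : Shape p} (hΞ : IsPD Ξ) :
    ∀ m ∈ l, ∃ Ξ'', IsPD Ξ'' ∧ (∀ j, Ξ'' j = Ξ j ∨ Ξ'' j = modeSweep R w l Ξ j) ∧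
      modeSweep R w l Ξ m = modeUpdate R w Ξ'' m := by
  induction l generalizing Ξ with
  | nil => simp
  | cons m' l ih =>
    rw [List.nodup_cons] at hl
    have hS := modeUpdate_posDef hR (hp m') (hn m') hw hΞ
    have hcons : modeSweep R w (m' :: l) Ξ
      = modeSweep R w l (Function.update Ξ m' (modeUpdate R w Ξ m')) := rfl
    have hm' : modeSweep R w (m' :: l) Ξ m' = modeUpdate R w Ξ m' := by
      rw [hcons, modeSweep_of_notMem l hl.1, Function.update_self]
    intro m hm
    rcases List.mem_cons.1 hm with rfl | hm
    · exact ⟨Ξ, hΞ, fun j => Or.inl rfl, hm'⟩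
    · obtain ⟨Ξ'', h1, h2, h3⟩ := ih hl.2 (isPD_update hΞ hS) m hm
      refine ⟨Ξ'', h1, fun j => ?_, h3⟩
      rcases h2 j with h | h
      · by_cases hj : j = m'
        · subst hj
          right
          rw [h, hm', Function.update_self]
        · left
          rw [h, Function.update_of_ne hj]
      · exact Or.inr h

/-- The last update of the sweep replaces the trace by that of the identity of size `p m`, whichever
mode comes last. -/
theorem modeSweep_total (hR : GenPos R) (hp : ∀ m, 0 < p m) (hn : ∀ m, p m ≤ n * coDim p m)
    (hw : ∀ i, 0 < w i) {l : List (Fin M)} (hl : l ≠ []) {Ξ : Shape p} (hΞ : IsPD Ξ) :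
    ∑ i, w i * mahaSq (modeSweep R w l Ξ) (R i) = n * totalDim p := by
  obtain ⟨l', m, rfl⟩ := (List.eq_nil_or_concat' l).resolve_left hl
  have h1 := modeSweep_isPD hR hp hn hw l' hΞ
  have hS := modeUpdate_posDef hR (hp m) (hn m) hw h1
  have hnp : (0 : ℝ) < n * coDim p m := by exact_mod_cast (hp m).trans_le (hn m)
  have h2 : modeSweep R w (l' ++ [m]) Ξ = Function.update (modeSweep R w l' Ξ) m
      (modeUpdate R w (modeSweep R w l' Ξ) m) := by
    simp [modeSweep]
  rw [h2, sum_weight_mahaSq_update R w _ m hnp.ne' hS, nonsing_inv_mul _ (isUnit_det_of_posDef hS),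
    trace_one, totalDim_eq p m, Fintype.card_fin]
  push_cast
  ring

theorem roundSpec_shapeSweep (hM : 0 < M) (hR : GenPos R) (hp : ∀ m, 0 < p m)
    (hn : ∀ m, p m ≤ n * coDim p m) (hw : ∀ i, 0 < w i) {Ξ : Shape p} (hΞ : IsPD Ξ) :
    RoundSpec R w Ξ (shapeSweep R w Ξ) where
  pd := modeSweep_isPD hR hp hn hw _ hΞ
  total := modeSweep_total hR hp hn hw (l := List.finRange M)
    (fun h => by simpa [h] using List.mem_finRange (⟨0, hM⟩ : Fin M)) hΞ
  descent := modeSweep_surrogate_le hR hp hn hw _ hΞ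
  mode m := modeSweep_mode hR hp hn hw _ (List.nodup_finRange M) hΞ m (List.mem_finRange m)

/-- Each mode of the intermediate shapes agrees with the old or the new iterate, so they share the
limit, and continuity of the update turns the recursion into a fixed-point equation. -/
theorem modeUpdate_eq_of_tendsto {Ξ : ℕ → Shape p} {Ξhat : Shape p} {w : ℕ → Fin n → ℝ}
    {what : Fin n → ℝ} (hΞ : Tendsto Ξ atTop (𝓝 Ξhat)) (hw : Tendsto w atTop (𝓝 what))
    (hpd : IsPD Ξhat) (hstep : ∀ k, RoundSpec R (w k) (Ξ k) (Ξ (k + 1))) (m : Fin M) :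
    modeUpdate R what Ξhat m = Ξhat m := by
  choose Ξ'' _ h2 h3 using fun k => (hstep k).mode m
  have hsucc : Tendsto (fun k => Ξ (k + 1)) atTop (𝓝 Ξhat) := hΞ.comp (tendsto_add_atTop_nat 1)
  have hlim : Tendsto Ξ'' atTop (𝓝 Ξhat) := by
    refine tendsto_pi_nhds.2 fun j => fun U hU => ?_
    have hU₁ : ∀ᶠ k in atTop, Ξ k j ∈ U := tendsto_pi_nhds.1 hΞ j hU
    have hU₂ : ∀ᶠ k in atTop, Ξ (k + 1) j ∈ U := tendsto_pi_nhds.1 hsucc j hU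
    change ∀ᶠ k in atTop, Ξ'' k j ∈ U
    filter_upwards [hU₁, hU₂] with k hk hk'
    rcases h2 k j with h | h <;> rw [h]
    · exact hk
    · exact hk'
  refine tendsto_nhds_unique (tendsto_modeUpdate hw hlim hpd R m)
    ((tendsto_pi_nhds.1 hsucc m).congr fun k => h3 k)

theorem isSymm_of_tendsto {κ : Type*} {A : ℕ → Matrix κ κ ℝ} {B : Matrix κ κ ℝ}
    (h : Tendsto A atTop (𝓝 B)) (hA : ∀ k, (A k)ᵀ = A k) : Bᵀ = B := by
  ext i j
  refine tendsto_nhds_unique (tendsto_matrix_apply h j i) ((tendsto_matrix_apply h i j).congr ?_)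
  intro k
  exact (congrFun (congrFun (hA k) i) j).symm

theorem posDef_transpose_eq {κ : Type*} {A : Matrix κ κ ℝ} (hA : A.PosDef) : Aᵀ = A := by
  simpa [conjTranspose_eq_transpose_of_trivial] using hA.isHermitian.eq

/-- With frozen weights the limit cannot be singular: convergent iterates have bounded entries, so
the Kronecker factors, and with them all updated forms, have a common positive lower bound. -/
theorem roundSpec_of_tendsto (hM : 0 < M) (hR : GenPos R) (hp : ∀ m, 0 < p m)
    (hn : ∀ m, p m ≤ n * coDim p m) (hw : ∀ i, 0 < w i) {Ξ Ξ' : Shape p} (hΞ : IsPD Ξ)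
    (hlim : Tendsto (fun t : ℕ => (shapeSweep R w)^[t] Ξ) atTop (𝓝 Ξ')) :
    RoundSpec R w Ξ Ξ' := by
  set S : ℕ → Shape p := fun t => (shapeSweep R w)^[t] Ξ with hS
  have hSs : ∀ t, S (t + 1) = shapeSweep R w (S t) := fun t =>
    Function.iterate_succ_apply' _ _ _
  have hSpd : ∀ t, IsPD (S t) := fun t => by
    induction t with
    | zero => exact hΞ
    | succ t ih => rw [hSs]; exact (roundSpec_shapeSweep hM hR hp hn hw ih).pd
  have hspec : ∀ t, RoundSpec R w (S t) (S (t + 1)) := fun t => by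
    rw [hSs]; exact roundSpec_shapeSweep hM hR hp hn hw (hSpd t)
  have hsucc : Tendsto (fun t => S (t + 1)) atTop (𝓝 Ξ') :=
    hlim.comp (tendsto_add_atTop_nat 1)
  have hpd : IsPD Ξ' := by
    intro m
    obtain ⟨C, hC1, hC⟩ := exists_entry_bound hlim
    obtain ⟨c, hc, hcK⟩ := exists_kronInv_quad_ge p hC1 m
    refine posDef_of_quad_pos (isSymm_of_tendsto (tendsto_pi_nhds.1 hlim m)
      fun t => posDef_transpose_eq (hSpd t m)) fun v hv => ?_
    obtain ⟨i, hi⟩ := exists_matricize_mulVec_ne_zero hR (hn m) hv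
    have hnp : (0 : ℝ) < n * coDim p m := by exact_mod_cast (hp m).trans_le (hn m)
    have hnn : ∀ i, 0 ≤ ((matricize (R i) m)ᵀ *ᵥ v) ⬝ᵥ ((matricize (R i) m)ᵀ *ᵥ v) := fun i => by
      simpa using dotProduct_star_self_nonneg ((matricize (R i) m)ᵀ *ᵥ v)
    have hpos : 0 < ((n : ℝ) * coDim p m)⁻¹ * ∑ i, w i * (c * (((matricize (R i) m)ᵀ *ᵥ v) ⬝ᵥ
        ((matricize (R i) m)ᵀ *ᵥ v))) := by
      refine mul_pos (inv_pos.2 hnp) (Finset.sum_pos' (fun i _ => ?_) ⟨i, Finset.mem_univ i, ?_⟩)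
      · exact mul_nonneg (hw i).le (mul_nonneg hc.le (hnn i))
      · exact mul_pos (hw i) (mul_pos hc ((hnn i).lt_of_ne
          fun h => hi (dotProduct_self_eq_zero.1 h.symm)))
    refine hpos.trans_le (ge_of_tendsto' (tendsto_quad (tendsto_pi_nhds.1 hsucc m) v) fun t => ?_)
    obtain ⟨Ξ'', h1, h2, h3⟩ := (hspec t).mode m
    rw [h3]
    refine modeUpdate_quad_ge (hcK Ξ'' h1 fun j a b => ?_) R (fun i => (hw i).le) v
    rcases h2 j with h | h <;> rw [h]
    · exact hC t j a b
    · exact hC (t + 1) j a b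
  refine ⟨hpd, ?_, ?_, fun m => ⟨Ξ', hpd, fun j => Or.inr rfl, ?_⟩⟩
  · exact tendsto_nhds_unique (tendsto_finsetSum _ fun i _ =>
      (tendsto_mahaSq hsucc hpd (R i)).const_mul (w i))
      (tendsto_const_nhds.congr fun t => ((hspec t).total).symm)
  · refine le_of_tendsto' (tendsto_shapeSurrogate hlim hpd R w) fun t => ?_
    induction t with
    | zero => exact le_rfl
    | succ t ih => exact (hspec t).descent.trans ih
  · exact (modeUpdate_eq_of_tendsto hlim tendsto_const_nhds hpd hspec m).symm

end Round

/-! ### Outputs of the shape estimation -/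

theorem dotProduct_self_nonneg' {κ : Type*} [Fintype κ] (v : κ → ℝ) : 0 ≤ v ⬝ᵥ v := by
  simpa using dotProduct_star_self_nonneg v

/-- With `(Ξ m)⁻¹ = G Gᵀ` the norm is the sum of the `kronInv` forms of the rows of `Gᵀ A_(m)`; the
lower bound is applied to each row and only the coordinate `d` is kept. -/
theorem mahaSq_ge_col {m : Fin M} {c : ℝ} {Ξ : Shape p} (hΞ : IsPD Ξ) (hc0 : 0 ≤ c)
    (hc : ∀ v : CoIdx p m → ℝ, c * (v ⬝ᵥ v) ≤ v ⬝ᵥ kronInv Ξ m *ᵥ v) (A : Tensor p)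
    (d : CoIdx p m) :
    c * ((fun a => A (insIdx m a d)) ⬝ᵥ (Ξ m)⁻¹ *ᵥ fun a => A (insIdx m a d)) ≤ mahaSq Ξ A := by
  obtain ⟨G, -, hG⟩ := exists_eq_mul_transpose (hΞ m).inv
  set H : Matrix (Fin (p m)) (CoIdx p m) ℝ := Gᵀ * matricize A m with hH
  have h1 : mahaSq Ξ A = ∑ a, H a ⬝ᵥ kronInv Ξ m *ᵥ H a := by
    rw [mahaSq_eq_kronQuad, kronQuad_eq_trace _ _ m]
    change ((((Ξ m)⁻¹)ᵀ * (matricize A m * kronInv Ξ m * (matricize A m)ᵀ))).trace = _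
    rw [posDef_transpose_eq (hΞ m).inv, hG, Matrix.mul_assoc, trace_mul_comm]
    have h2 : Gᵀ * (matricize A m * kronInv Ξ m * (matricize A m)ᵀ) * G
        = H * kronInv Ξ m * Hᵀ := by
      rw [hH, transpose_mul, transpose_transpose]
      simp only [Matrix.mul_assoc]
    rw [h2, trace]
    refine Finset.sum_congr rfl fun a _ => ?_
    rw [diag_apply, Matrix.mul_assoc, mul_apply]
    rfl
  have h3 : (fun a => A (insIdx m a d)) ⬝ᵥ (Ξ m)⁻¹ *ᵥ (fun a => A (insIdx m a d))
      = ∑ a, H a d ^ 2 := by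
    rw [hG, ← mulVec_mulVec, dotProduct_mulVec, ← mulVec_transpose, dotProduct]
    exact Finset.sum_congr rfl fun a _ => (pow_two _).symm
  rw [h1, h3, Finset.mul_sum]
  refine Finset.sum_le_sum fun a _ => le_trans (mul_le_mul_of_nonneg_left ?_ hc0) (hc (H a))
  rw [pow_two]
  exact Finset.single_le_sum (f := fun d => H a d * H a d) (fun i _ => mul_self_nonneg _)
    (Finset.mem_univ d)

/-- For residuals in general position, a degenerate matrix `Ξ m` makes the norms large. -/
theorem exists_sum_log_ge {R : Fin n → Tensor p} (hR : GenPos R) {ν : ℝ} (hν : 0 < ν) {C : ℝ}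
    (hC : 1 ≤ C) {m : Fin M} (hp : 0 < p m) (hn : p m ≤ n * coDim p m) :
    ∃ D : ℝ, ∀ Ξ : Shape p, IsPD Ξ → (∀ j a b, |Ξ j a b| ≤ C) →
      (n : ℝ) / p m * (-Real.log (Ξ m).det) - D ≤ ∑ i, Real.log (1 + mahaSq Ξ (R i) / ν) := by
  obtain ⟨c, hc, hcK⟩ := exists_kronInv_quad_ge p hC m
  set N := n * coDim p m with hN
  have hN0 : 0 < N := hp.trans_le hn
  have : NeZero N := ⟨hN0.ne'⟩
  have hcard : Fintype.card (CoIdx p m × Fin n) = N := by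
    rw [Fintype.card_prod, card_coIdx, Fintype.card_fin, mul_comm]
  set e : Fin N ≃ CoIdx p m × Fin n := (Fintype.equivFinOfCardEq hcard).symm with he
  -- Cyclic windows of `p m` consecutive columns: addition in `Fin N` wraps around, so over all
  -- shifts every column is used exactly `p m` times.
  set f : Fin N → Fin (p m) → CoIdx p m × Fin n := fun s b => e (Fin.castLE hn b + s) with hf
  have hinj : ∀ s, Function.Injective (f s) := fun s b b' h =>
    Fin.castLE_injective hn (add_right_cancel (e.injective h))
  set V : Fin N → Matrix (Fin (p m)) (Fin (p m)) ℝ := fun s =>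
    Matrix.of fun a b => R (f s b).2 (insIdx m a (f s b).1) with hV
  have hVdet : ∀ s, (V s).det ≠ 0 := fun s => hR m (f s) (hinj s)
  have hpm : (0 : ℝ) < p m := by exact_mod_cast hp
  have hcod : (0 : ℝ) < coDim p m := by
    have : 0 < coDim p m := Nat.pos_of_mul_pos_left hN0
    exact_mod_cast this
  refine ⟨-((∑ s, Real.log ((V s).det ^ 2) + N * (p m * Real.log (c / ν))) / (p m * coDim p m)),
    fun Ξ hΞ hb => ?_⟩
  set ℓ : Fin n → ℝ := fun i => Real.log (1 + mahaSq Ξ (R i) / ν) with hℓ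
  have key : ∀ s, Real.log ((V s).det ^ 2) - Real.log (Ξ m).det + p m * Real.log (c / ν)
      ≤ ∑ b, ℓ (f s b).2 := by
    intro s
    have hT : ((V s)ᵀ * (Ξ m)⁻¹ * V s).PosDef := by
      have h := (hΞ m).inv.conjTranspose_mul_mul_same (B := V s)
        (mulVec_injective_of_isUnit ((Matrix.isUnit_iff_isUnit_det _).2
          (isUnit_iff_ne_zero.2 (hVdet s))))
      rwa [conjTranspose_eq_transpose_of_trivial] at h
    -- Hadamard bounds the determinant by the Mahalanobis norms of the columns in the window, each
    -- of which is dominated by the norm of its tensor.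
    have h1 := log_det_le_sum_log_diag hT
    have h2 : Real.log ((V s)ᵀ * (Ξ m)⁻¹ * V s).det
        = Real.log ((V s).det ^ 2) - Real.log (Ξ m).det := by
      rw [← Real.log_div (pow_ne_zero 2 (hVdet s)) (hΞ m).det_pos.ne', det_mul, det_mul,
        det_transpose, det_nonsing_inv, Ring.inverse_eq_inv']
      congr 1
      ring
    have h3 : ∀ b, Real.log (((V s)ᵀ * (Ξ m)⁻¹ * V s) b b) + Real.log (c / ν) ≤ ℓ (f s b).2 := by
      intro b
      have hpos : 0 < ((V s)ᵀ * (Ξ m)⁻¹ * V s) b b := hT.diag_pos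
      have h4 := mahaSq_ge_col hΞ hc.le (hcK Ξ hΞ hb) (R (f s b).2) (f s b).1
      have h5 : ((V s)ᵀ * (Ξ m)⁻¹ * V s) b b = (fun a => R (f s b).2 (insIdx m a (f s b).1)) ⬝ᵥ
          (Ξ m)⁻¹ *ᵥ fun a => R (f s b).2 (insIdx m a (f s b).1) := by
        rw [Matrix.mul_assoc, mul_apply]
        rfl
      rw [← h5] at h4
      rw [← Real.log_mul hpos.ne' (by positivity)]
      refine Real.log_le_log (by positivity) ?_
      have h6 : ((V s)ᵀ * (Ξ m)⁻¹ * V s) b b * (c / ν) ≤ mahaSq Ξ (R (f s b).2) / ν := by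
        rw [mul_div_assoc', mul_comm _ c]
        gcongr
      linarith
    have h7 := Finset.sum_le_sum fun b (_ : b ∈ Finset.univ) => h3 b
    rw [Finset.sum_add_distrib, Finset.sum_const, Finset.card_univ, Fintype.card_fin,
      nsmul_eq_mul] at h7
    linarith
  have hsum : ∑ s, ∑ b, ℓ (f s b).2 = p m * (coDim p m * ∑ i, ℓ i) := by
    rw [Finset.sum_comm]
    have h : ∀ b : Fin (p m), ∑ s, ℓ (f s b).2 = coDim p m * ∑ i, ℓ i := fun b => by
      have h1 : ∑ s, ℓ (f s b).2 = ∑ s, ℓ (e s).2 :=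
        Equiv.sum_comp (Equiv.addLeft (Fin.castLE hn b)) fun s => ℓ (e s).2
      rw [h1, e.sum_comp fun d => ℓ d.2, Fintype.sum_prod_type]
      simp only
      rw [Finset.sum_const, Finset.card_univ, card_coIdx, nsmul_eq_mul]
    simp only [h, Finset.sum_const, Finset.card_univ, Fintype.card_fin, nsmul_eq_mul]
  have h8 := Finset.sum_le_sum fun s (_ : s ∈ Finset.univ) => key s
  rw [hsum, Finset.sum_add_distrib, Finset.sum_sub_distrib, Finset.sum_const, Finset.sum_const,
    Finset.card_univ, Fintype.card_fin, nsmul_eq_mul, nsmul_eq_mul] at h8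
  have h9 : (n : ℝ) / p m * (-Real.log (Ξ m).det)
      = -(N * Real.log (Ξ m).det) / (p m * coDim p m) := by
    rw [hN]
    push_cast
    field_simp
  rw [h9, sub_neg_eq_add, ← add_div, div_le_iff₀ (by positivity)]
  linarith

/-- If eventually all `a k i` exceeded `P + 1`, the potential `∑ log (ν + a k i)` would drop by a
fixed amount in every step, by `log t ≤ t - 1` and the normalization `htot`; yet it is at least `n
log ν`. The threshold only has to exceed `P` strictly. -/
theorem frequently_exists_le {a : ℕ → Fin n → ℝ} {ν P : ℝ} (hν : 0 < ν) (hP : 0 ≤ P) (hn : 0 < n)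
    (ha : ∀ k i, 0 ≤ a k i)
    (htot : ∀ k, ∑ i, (ν + P) / (ν + a k i) * a (k + 1) i = n * P) :
    ∃ᶠ k in atTop, ∃ i, a k i ≤ P + 1 := by
  intro hcon
  rw [eventually_atTop] at hcon
  obtain ⟨K, hK⟩ := hcon
  push Not at hK
  have hn' : (0 : ℝ) < n := by exact_mod_cast hn
  set Φ : ℕ → ℝ := fun k => ∑ i, Real.log (ν + a k i) with hΦ
  set ε : ℝ := n * (ν / (ν + P) - ν / (ν + (P + 1))) with hε
  have hεpos : 0 < ε := by
    refine mul_pos hn' (sub_pos.2 ?_)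
    gcongr
    linarith
  have hstep : ∀ k, K ≤ k → Φ (k + 1) ≤ Φ k - ε := by
    intro k hk
    have h1 : ∀ i, Real.log (ν + a (k + 1) i) - Real.log (ν + a k i)
        ≤ (ν + P)⁻¹ * ((ν + P) / (ν + a k i) * a (k + 1) i) + ν / (ν + (P + 1)) - 1 := by
      intro i
      have h2 := ha k i
      have h3 := ha (k + 1) i
      rw [← Real.log_div (by positivity) (by positivity)]
      refine (Real.log_le_sub_one_of_pos (by positivity)).trans ?_
      have h4 : (ν + P)⁻¹ * ((ν + P) / (ν + a k i) * a (k + 1) i) = a (k + 1) i / (ν + a k i) := by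
        field_simp
      have h5 : ν / (ν + a k i) ≤ ν / (ν + (P + 1)) := by
        gcongr
        exact (hK k hk i).le
      rw [h4, add_div]
      linarith
    have h6 := Finset.sum_le_sum fun i (_ : i ∈ Finset.univ) => h1 i
    simp only [Finset.sum_sub_distrib, Finset.sum_add_distrib, ← Finset.mul_sum, Finset.sum_const,
      Finset.card_univ, Fintype.card_fin, nsmul_eq_mul] at h6
    rw [htot] at h6
    have h7 : (ν + P)⁻¹ * (n * P) + n * (ν / (ν + (P + 1))) - n * 1 = -ε := by
      rw [hε]
      have : ν + P ≠ 0 := by positivity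
      field_simp
      ring
    simp only [hΦ]
    linarith
  have hiter : ∀ t : ℕ, Φ (K + t) ≤ Φ K - t * ε := fun t => by
    induction t with
    | zero => simp
    | succ t ih =>
      have := hstep (K + t) (Nat.le_add_right _ _)
      rw [← add_assoc]
      push_cast
      linarith
  have hlow : ∀ k, n * Real.log ν ≤ Φ k := fun k => by
    have h : ∑ _i : Fin n, Real.log ν ≤ Φ k := Finset.sum_le_sum fun i _ =>
      Real.log_le_log hν (by linarith [ha k i])
    simpa using h
  obtain ⟨t, ht⟩ := exists_nat_gt ((Φ K - n * Real.log ν) / ε)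
  rw [div_lt_iff₀ hεpos] at ht
  linarith [hiter t, hlow (K + t)]

theorem tWeight_pos {ν : ℝ} (hν : 0 < ν) (R : Fin n → Tensor p) {Ξ : Shape p} (hΞ : IsPD Ξ)
    (i : Fin n) : 0 < tWeight ν R Ξ i := by
  have := mahaSq_nonneg hΞ (R i)
  unfold tWeight
  positivity

/-- When `p m ≤ coDim p m`, one residual alone already has a matricization of full row rank. -/
theorem matricize_mulVec_ne_zero {R : Fin n → Tensor p} (hR : GenPos R) {m : Fin M}
    (hm : p m ≤ coDim p m) (i : Fin n) {v : Fin (p m) → ℝ} (hv : v ≠ 0) :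
    (matricize (R i) m)ᵀ *ᵥ v ≠ 0 := by
  obtain ⟨g⟩ := Function.Embedding.nonempty_of_card_le (α := Fin (p m)) (β := CoIdx p m)
    (by rw [card_coIdx, Fintype.card_fin]; exact hm)
  intro h0
  refine hR m (fun b => (g b, i)) (fun b b' h => g.injective (Prod.mk.inj h).1)
    (exists_vecMul_eq_zero_iff.1 ⟨v, hv, ?_⟩)
  ext b
  have h := congrFun h0 (g b)
  rw [mulVec_transpose] at h
  exact h

theorem le_coDim (hp : ∀ m, 0 < p m) {m j : Fin M} (h : j ≠ m) : p j ≤ coDim p m :=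
  Nat.le_of_dvd (Finset.prod_pos fun j _ => hp j)
    (Finset.dvd_prod_of_mem p (Finset.mem_erase.2 ⟨h, Finset.mem_univ j⟩))

section Run

variable {R : Fin n → Tensor p} {ν : ℝ} {Ξ : ℕ → Shape p} {Ξhat : Shape p}

theorem IsShapeRun.isPD_and_roundSpec (hrun : IsShapeRun ν R Ξ Ξhat) (hν : 0 < ν) (hM : 0 < M)
    (hR : GenPos R) (hp : ∀ m, 0 < p m) (hn : ∀ m, p m ≤ n * coDim p m) (k : ℕ) :
    IsPD (Ξ k) ∧ RoundSpec R (tWeight ν R (Ξ k)) (Ξ k) (Ξ (k + 1)) := by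
  have hstep : ∀ k, IsPD (Ξ k) → RoundSpec R (tWeight ν R (Ξ k)) (Ξ k) (Ξ (k + 1)) := by
    intro k hk
    rcases hrun.step k with h | h
    · rw [h]
      exact roundSpec_shapeSweep hM hR hp hn (tWeight_pos hν R hk) hk
    · exact roundSpec_of_tendsto hM hR hp hn (tWeight_pos hν R hk) hk h
  have hpd : ∀ k, IsPD (Ξ k) := fun k => by
    induction k with
    | zero => exact hrun.init
    | succ k ih => exact (hstep k ih).pd
  exact ⟨hpd k, hstep k (hpd k)⟩

/-- Modes with `p m ≤ coDim p m` do not degenerate in the limit. -/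
theorem limit_posDef_of_le_coDim (hν : 0 < ν) (hR : GenPos R) (hn0 : 0 < n)
    (hp : ∀ m, 0 < p m) (hpd : ∀ k, IsPD (Ξ k))
    (hspec : ∀ k, RoundSpec R (tWeight ν R (Ξ k)) (Ξ k) (Ξ (k + 1)))
    (hlim : Tendsto Ξ atTop (𝓝 Ξhat)) {m : Fin M} (hm : p m ≤ coDim p m) :
    (Ξhat m).PosDef := by
  set P : ℝ := (totalDim p : ℝ) with hP
  have hP0 : 0 ≤ P := Nat.cast_nonneg _
  have hfreq := frequently_exists_le (a := fun k i => mahaSq (Ξ k) (R i)) hν hP0 hn0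
    (fun k i => mahaSq_nonneg (hpd k) _) fun k => (hspec k).total
  -- Pigeonhole over the finitely many observations fixes one index. Its weight is then at least `(ν
  -- + P) / (ν + (P + 1))` infinitely often, which is enough because the iterates converge.
  obtain ⟨i, hi⟩ : ∃ i, ∃ᶠ k in atTop, mahaSq (Ξ k) (R i) ≤ P + 1 := by
    by_contra hcon
    simp only [not_exists, not_frequently] at hcon
    exact hfreq ((eventually_all.2 hcon).mono fun k hk ⟨i, hi⟩ => hk i hi)
  obtain ⟨C, hC1, hC⟩ := exists_entry_bound hlim
  obtain ⟨c, hc, hcK⟩ := exists_kronInv_quad_ge p hC1 m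
  have hsucc : Tendsto (fun k => Ξ (k + 1)) atTop (𝓝 Ξhat) := hlim.comp (tendsto_add_atTop_nat 1)
  refine posDef_of_quad_pos (isSymm_of_tendsto (tendsto_pi_nhds.1 hlim m)
    fun k => posDef_transpose_eq (hpd k m)) fun v hv => ?_
  have hnp : (0 : ℝ) < n * coDim p m := by exact_mod_cast mul_pos hn0 ((hp m).trans_le hm)
  set u := (matricize (R i) m)ᵀ *ᵥ v with hu
  have hupos : 0 < u ⬝ᵥ u := (dotProduct_self_nonneg' u).lt_of_ne fun h =>
    matricize_mulVec_ne_zero hR hm i hv (dotProduct_self_eq_zero.1 h.symm)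
  have hpos : 0 < ((n : ℝ) * coDim p m)⁻¹ * ((ν + P) / (ν + (P + 1)) * (c * (u ⬝ᵥ u))) := by
    positivity
  refine hpos.trans_le (ge_of_tendsto_of_frequently (tendsto_quad (tendsto_pi_nhds.1 hsucc m) v)
    (hi.mono fun k hk => ?_))
  obtain ⟨Ξ'', h1, h2, h3⟩ := (hspec k).mode m
  rw [h3]
  refine le_trans ?_ (modeUpdate_quad_ge (hcK Ξ'' h1 fun j a b => ?_) R
    (fun i => (tWeight_pos hν R (hpd k) i).le) v)
  · refine mul_le_mul_of_nonneg_left ?_ (inv_pos.2 hnp).le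
    refine le_trans ?_ (Finset.single_le_sum (f := fun i => tWeight ν R (Ξ k) i *
      (c * (((matricize (R i) m)ᵀ *ᵥ v) ⬝ᵥ ((matricize (R i) m)ᵀ *ᵥ v))))
      (fun i _ => mul_nonneg (tWeight_pos hν R (hpd k) i).le
        (mul_nonneg hc.le (dotProduct_self_nonneg' _))) (Finset.mem_univ i))
    have hδ := mahaSq_nonneg (hpd k) (R i)
    simp only [tWeight]
    gcongr
  · rcases h2 j with h | h <;> rw [h]
    · exact hC k j a b
    · exact hC (k + 1) j a b

theorem shapeObj_run_le (hν : 0 < ν) (hpd : ∀ k, IsPD (Ξ k))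
    (hspec : ∀ k, RoundSpec R (tWeight ν R (Ξ k)) (Ξ k) (Ξ (k + 1))) (k : ℕ) :
    shapeObj ν R (Ξ k) ≤ shapeObj ν R (Ξ 0) := by
  induction k with
  | zero => exact le_rfl
  | succ k ih =>
    have h1 := shapeObj_le_of_shapeSurrogate hν R (hpd k) (hpd (k + 1))
    have h2 := (hspec k).descent
    linarith

/-- If all other modes do not degenerate in the limit, then neither does the mode `m`. -/
theorem limit_posDef_of_forall_ne (hν : 0 < ν) (hR : GenPos R) (hp : ∀ m, 0 < p m)
    (hn : ∀ m, p m ≤ n * coDim p m) (hpd : ∀ k, IsPD (Ξ k))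
    (hspec : ∀ k, RoundSpec R (tWeight ν R (Ξ k)) (Ξ k) (Ξ (k + 1)))
    (hlim : Tendsto Ξ atTop (𝓝 Ξhat)) {m : Fin M} (hne : ∀ j, j ≠ m → (Ξhat j).PosDef) :
    (Ξhat m).PosDef := by
  obtain ⟨C, hC1, hC⟩ := exists_entry_bound hlim
  obtain ⟨D, hD⟩ := exists_sum_log_ge hR hν hC1 (hp m) (hn m)
  have hlog : ∃ L : ℝ, ∀ k,
      L ≤ ∑ j ∈ Finset.univ.erase m, (coDim p j : ℝ) * Real.log (Ξ k j).det := by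
    have h : Tendsto (fun k => ∑ j ∈ Finset.univ.erase m, (coDim p j : ℝ) * Real.log (Ξ k j).det)
        atTop (𝓝 (∑ j ∈ Finset.univ.erase m, (coDim p j : ℝ) * Real.log (Ξhat j).det)) :=
      tendsto_finsetSum _ fun j hj =>
        (tendsto_log_det hlim (hne j (Finset.ne_of_mem_erase hj))).const_mul _
    obtain ⟨L, hL⟩ := h.bddBelow_range
    exact ⟨L, fun k => hL ⟨k, rfl⟩⟩
  obtain ⟨L, hL⟩ := hlog
  have hpm : (0 : ℝ) < p m := by exact_mod_cast hp m
  have hnp : (0 : ℝ) < n * coDim p m := by exact_mod_cast (hp m).trans_le (hn m)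
  have hn0 : (0 : ℝ) < n := by
    have := Nat.pos_of_mul_pos_right ((hp m).trans_le (hn m))
    exact_mod_cast this
  set P : ℝ := (totalDim p : ℝ) with hP
  have hP0 : 0 ≤ P := Nat.cast_nonneg _
  have hPm : P = p m * coDim p m := by rw [hP, totalDim_eq p m]; push_cast; rfl
  set B : ℝ := shapeObj ν R (Ξ 0) - n / 2 * L + (ν + P) / 2 * D with hB
  -- Since `P = p m * coDim p m`, the logarithmic sum contributes `(ν + P) n / (2 p m)` times `-log
  -- det`, and the determinant term removes only `P n / (2 p m)`. The surplus `ν` bounds the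
  -- determinant away from zero.
  have hmain : ∀ k, n * ν / (2 * p m) * (-Real.log (Ξ k m).det) ≤ B := by
    intro k
    have h1 := shapeObj_run_le hν hpd hspec k
    have h2 := hD (Ξ k) (hpd k) (hC k)
    have h3 : ∑ j, (coDim p j : ℝ) * Real.log (Ξ k j).det = coDim p m * Real.log (Ξ k m).det
        + ∑ j ∈ Finset.univ.erase m, (coDim p j : ℝ) * Real.log (Ξ k j).det :=
      (Finset.add_sum_erase _ _ (Finset.mem_univ m)).symm
    have h4 : (n : ℝ) / 2 * L
        ≤ n / 2 * ∑ j ∈ Finset.univ.erase m, (coDim p j : ℝ) * Real.log (Ξ k j).det :=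
      mul_le_mul_of_nonneg_left (hL k) (by positivity)
    have h5 := mul_le_mul_of_nonneg_left h2 (show 0 ≤ (ν + P) / 2 by positivity)
    have h6 : n * ν / (2 * p m) * (-Real.log (Ξ k m).det)
        = (ν + P) / 2 * (n / p m * (-Real.log (Ξ k m).det))
          + n / 2 * (coDim p m * Real.log (Ξ k m).det) := by
      rw [hPm]
      field_simp
      ring
    have h7 : shapeObj ν R (Ξ k) = n / 2 * (coDim p m * Real.log (Ξ k m).det
        + ∑ j ∈ Finset.univ.erase m, (coDim p j : ℝ) * Real.log (Ξ k j).det)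
        + (ν + P) / 2 * ∑ i, Real.log (1 + mahaSq (Ξ k) (R i) / ν) := by
      rw [shapeObj, h3]
    rw [h6, hB]
    linarith
  have hdet : ∀ k, Real.exp (-(B / (n * ν / (2 * p m)))) ≤ (Ξ k m).det := fun k => by
    rw [← Real.le_log_iff_exp_le (hpd k m).det_pos]
    have h1 := hmain k
    rw [mul_comm, ← le_div_iff₀ (by positivity)] at h1
    linarith
  have hlimm := tendsto_pi_nhds.1 hlim m
  have hdetlim : Real.exp (-(B / (n * ν / (2 * p m)))) ≤ (Ξhat m).det :=
    ge_of_tendsto' (((continuous_id.matrix_det (A := fun A : Matrix _ _ ℝ => A)).tendsto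
      (Ξhat m)).comp hlimm) hdet
  have hpsd : (Ξhat m).PosSemidef := by
    refine .of_dotProduct_mulVec_nonneg ?_ fun v => ?_
    · have := isSymm_of_tendsto hlimm fun k => posDef_transpose_eq (hpd k m)
      simpa [IsHermitian, conjTranspose_eq_transpose_of_trivial] using this
    · have := ge_of_tendsto' (tendsto_quad hlimm v) fun k =>
        posSemidef_quad_nonneg (hpd k m).posSemidef v
      simpa using this
  exact hpsd.posDef_iff_det_ne_zero.2 ((Real.exp_pos _).trans_le hdetlim).ne'

/-- Outputs of the shape estimation are positive definite fixed points. -/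
theorem IsShapeRun.output (hrun : IsShapeRun ν R Ξ Ξhat) (hν : 0 < ν) (hM : 0 < M)
    (hR : GenPos R) (hp : ∀ m, 0 < p m) (hn : ∀ m, p m ≤ n * coDim p m) :
    IsPD Ξhat ∧ ∀ m, modeUpdate R (tWeight ν R Ξhat) Ξhat m = Ξhat m := by
  have hpd := fun k => (hrun.isPD_and_roundSpec hν hM hR hp hn k).1
  have hspec := fun k => (hrun.isPD_and_roundSpec hν hM hR hp hn k).2
  have : Nonempty (Fin M) := ⟨⟨0, hM⟩⟩
  -- Every other mode `j` satisfies `p j ≤ p m₁ ≤ coDim p j`, because `p m₁` is a factor of `coDim p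
  -- j`. Only `m₁` needs the determinant bound.
  obtain ⟨m₁, hm₁⟩ := Finite.exists_max p
  have hn0 : 0 < n := Nat.pos_of_mul_pos_right ((hp m₁).trans_le (hn m₁))
  have hne : ∀ j, j ≠ m₁ → (Ξhat j).PosDef := fun j hj =>
    limit_posDef_of_le_coDim hν hR hn0 hp hpd hspec hrun.converges
      ((hm₁ j).trans (le_coDim hp hj.symm))
  have hhat : IsPD Ξhat := fun j => by
    by_cases hj : j = m₁
    · rw [hj]
      exact limit_posDef_of_forall_ne hν hR hp hn hpd hspec hrun.converges hne
    · exact hne j hj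
  exact ⟨hhat, modeUpdate_eq_of_tendsto hrun.converges
    (tendsto_tWeight hν hrun.converges hhat R) hhat hspec⟩

end Run

/-! ### Global optimality of the fixed points -/

/-- The tangent inequality at `h = 0` for the convex function `h ↦ log (ν + ∑ exp (-h j) z j)`. -/
theorem neg_div_le_log_sub_log {κ : Type*} [Fintype κ] {ν : ℝ} (hν : 0 < ν) {z h : κ → ℝ}
    (hz : ∀ j, 0 ≤ z j) :
    -((∑ j, z j * h j) / (ν + ∑ j, z j)) ≤
      Real.log (1 + (∑ j, Real.exp (-h j) * z j) / ν) - Real.log (1 + (∑ j, z j) / ν) := by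
  set a := ∑ j, z j with ha
  set s := ∑ j, z j * h j with hs
  set b := ∑ j, Real.exp (-h j) * z j with hb
  -- The mean of `h` under the weights `z`, with the extra mass `ν` placed at the value zero;
  -- expanding the exponentials around `c` gives Jensen's inequality.
  set c := s / (ν + a) with hc
  have ha0 : 0 ≤ a := Finset.sum_nonneg fun j _ => hz j
  have hb0 : 0 ≤ b := Finset.sum_nonneg fun j _ => mul_nonneg (Real.exp_pos _).le (hz j)
  have hνa : 0 < ν + a := by positivity
  have h1 : ∀ j, Real.exp (-c) * (z j * (1 + c) - z j * h j) ≤ Real.exp (-h j) * z j := fun j => by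
    have h2 : Real.exp (-h j) = Real.exp (-c) * Real.exp (c - h j) := by
      rw [← Real.exp_add]; ring_nf
    have h3 := Real.add_one_le_exp (c - h j)
    rw [h2, mul_assoc]
    refine mul_le_mul_of_nonneg_left ?_ (Real.exp_pos _).le
    nlinarith [hz j]
  have h4 := Finset.sum_le_sum fun j (_ : j ∈ Finset.univ) => h1 j
  rw [← Finset.mul_sum, Finset.sum_sub_distrib, ← Finset.sum_mul] at h4
  change Real.exp (-c) * (a * (1 + c) - s) ≤ b at h4
  have h5 : Real.exp (-c) * (1 + c) ≤ 1 := by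
    have := Real.add_one_le_exp c
    calc Real.exp (-c) * (1 + c) ≤ Real.exp (-c) * Real.exp c := by gcongr; linarith
      _ = 1 := by rw [← Real.exp_add]; simp
  have h6 : Real.exp (-c) * (ν + a) ≤ ν + b := by
    have h7 : c * (ν + a) = s := by rw [hc]; field_simp
    have h8 : Real.exp (-c) * (ν + a)
        = ν * (Real.exp (-c) * (1 + c)) + Real.exp (-c) * (a * (1 + c) - s) := by
      rw [← h7]; ring
    rw [h8]
    nlinarith
  rw [← Real.log_div (by positivity) (by positivity), Real.le_log_iff_exp_le (by positivity)]
  have h9 : (1 + b / ν) / (1 + a / ν) = (ν + b) / (ν + a) := by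
    field_simp
  rw [h9, le_div_iff₀ hνa]
  exact h6

/-- A positive definite fixed point of the updates is a global minimizer of `shapeObj`. -/
theorem shapeObj_le_of_fixed {ν : ℝ} (hν : 0 < ν) {R : Fin n → Tensor p} {Ξ Ξ' : Shape p}
    (hΞ : IsPD Ξ) (hΞ' : IsPD Ξ') (hnp : ∀ m, (n : ℝ) * coDim p m ≠ 0)
    (hfix : ∀ m, modeUpdate R (tWeight ν R Ξ) Ξ m = Ξ m) :
    shapeObj ν R Ξ ≤ shapeObj ν R Ξ' := by
  -- In these coordinates the competitor multiplies each squared entry of the transformed residual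
  -- by `exp (-∑ h m (J m))` and changes the log determinants linearly in `h`.
  choose G h hG hS hT using fun m => exists_simultaneous_diagonal (hΞ m) (hΞ' m)
  set H : Shape p := fun m => (G m)⁻¹ with hH
  set Z : Fin n → Tensor p := fun i => tucker (R i) H with hZ
  have hinv : ∀ m, (Ξ m)⁻¹ = (H m)ᵀ * diagonal (fun _ => 1) * H m := fun m => by
    rw [hS m, inv_mul_transpose, diagonal_one, Matrix.mul_one]
  have hinv' : ∀ m, (Ξ' m)⁻¹ = (H m)ᵀ * diagonal (fun a => Real.exp (-h m a)) * H m := fun m => by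
    have hD : (diagonal fun a => Real.exp (h m a))⁻¹ = diagonal fun a => Real.exp (-h m a) := by
      refine inv_eq_left_inv ?_
      rw [diagonal_mul_diagonal, ← diagonal_one]
      refine congrArg diagonal (funext fun a => ?_)
      rw [← Real.exp_add]
      simp
    rw [hT m, Matrix.mul_inv_rev, Matrix.mul_inv_rev, hD, ← transpose_nonsing_inv,
      Matrix.mul_assoc]
  have hmaha : ∀ i, mahaSq Ξ (R i) = ∑ J, Z i J ^ 2 := fun i => by
    have : shapeInv Ξ = fun m => (H m)ᵀ * diagonal (fun _ => 1) * H m := funext hinv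
    rw [mahaSq_eq_kronQuad, this, kronQuad_diagonal]
    simp [hZ]
  have hmaha' : ∀ i, mahaSq Ξ' (R i)
      = ∑ J : Idx p, Real.exp (-∑ m, h m (J m)) * Z i J ^ 2 := fun i => by
    have : shapeInv Ξ' = fun m => (H m)ᵀ * diagonal (fun a => Real.exp (-h m a)) * H m :=
      funext hinv'
    rw [mahaSq_eq_kronQuad, this, kronQuad_diagonal]
    refine Finset.sum_congr rfl fun J _ => ?_
    rw [← Real.exp_sum, Finset.sum_neg_distrib]
  -- The fixed-point equation tested against the direction `Hᵀ diag(h) H` in mode `m`, with the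
  -- other modes kept at `Ξ`: the first-order condition along the path to `Ξ'`.
  have hstat : ∀ m, ∑ i, tWeight ν R Ξ i * ∑ J : Idx p, h m (J m) * Z i J ^ 2
      = n * coDim p m * ∑ a, h m a := fun m => by
    have h1 := sum_weight_kronQuad R (tWeight ν R Ξ) Ξ m (hnp m)
      ((H m)ᵀ * diagonal (h m) * H m)
    set d : ∀ j, Fin (p j) → ℝ := Function.update (fun j (_ : Fin (p j)) => (1 : ℝ)) m (h m) with hd
    have hdm : d m = h m := Function.update_self _ _ _
    have hdj : ∀ j, j ≠ m → d j = fun _ => 1 := fun j hj => Function.update_of_ne hj _ _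
    have h2 : Function.update (shapeInv Ξ) m ((H m)ᵀ * diagonal (h m) * H m)
        = fun j => (H j)ᵀ * diagonal (d j) * H j := by
      funext j
      by_cases hj : j = m
      · subst hj
        rw [Function.update_self, hdm]
      · rw [Function.update_of_ne hj, hdj j hj]
        exact hinv j
    have h3 : ∀ J : Idx p, ∏ j, d j (J j) = h m (J m) := fun J => by
      rw [← Finset.mul_prod_erase _ _ (Finset.mem_univ m), hdm, Finset.prod_eq_one, mul_one]
      intro j hj
      rw [hdj j (Finset.ne_of_mem_erase hj)]
    rw [h2, hfix m] at h1
    simp only [kronQuad_diagonal, h3] at h1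
    rw [h1]
    congr 1
    rw [transpose_mul, transpose_mul, transpose_transpose, diagonal_transpose, hS m,
      trace_mul_comm]
    have h4 : G m * (G m)ᵀ * ((H m)ᵀ * (diagonal (h m) * H m)) = G m * diagonal (h m) * H m := by
      rw [Matrix.mul_assoc, ← Matrix.mul_assoc (G m)ᵀ, ← transpose_mul, hH,
        nonsing_inv_mul _ (hG m), transpose_one, Matrix.one_mul, Matrix.mul_assoc]
    rw [h4, trace_mul_comm, ← Matrix.mul_assoc, hH, nonsing_inv_mul _ (hG m), Matrix.one_mul,
      trace_diagonal]
  have hdet : ∀ m, Real.log (Ξ' m).det = Real.log (Ξ m).det + ∑ a, h m a := fun m => by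
    have h1 : (Ξ' m).det = (Ξ m).det * Real.exp (∑ a, h m a) := by
      rw [hT m, hS m, det_mul, det_mul, det_mul, det_diagonal, Real.exp_sum]
      ring
    rw [h1, Real.log_mul (hΞ m).det_pos.ne' (Real.exp_pos _).ne', Real.log_exp]
  have hlog : ∀ i, -(1 / 2 * (tWeight ν R Ξ i * ∑ J : Idx p, Z i J ^ 2 * ∑ m, h m (J m))) ≤
      (ν + totalDim p) / 2 * (Real.log (1 + mahaSq Ξ' (R i) / ν)
        - Real.log (1 + mahaSq Ξ (R i) / ν)) := fun i => by
    have h1 := neg_div_le_log_sub_log hν (z := fun J => Z i J ^ 2)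
      (h := fun J : Idx p => ∑ m, h m (J m)) fun J => sq_nonneg _
    rw [← hmaha, ← hmaha'] at h1
    have h2 := mul_le_mul_of_nonneg_left h1 (show 0 ≤ (ν + totalDim p) / 2 by positivity)
    refine le_trans (le_of_eq ?_) h2
    simp only [tWeight]
    ring
  have hsum := Finset.sum_le_sum fun i (_ : i ∈ Finset.univ) => hlog i
  have hcross : ∑ i, tWeight ν R Ξ i * ∑ J : Idx p, Z i J ^ 2 * ∑ m, h m (J m)
      = n * ∑ m, coDim p m * ∑ a, h m a := by
    have h1 : ∀ i, ∑ J : Idx p, Z i J ^ 2 * ∑ m, h m (J m)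
        = ∑ m, ∑ J : Idx p, h m (J m) * Z i J ^ 2 := fun i => by
      rw [Finset.sum_comm]
      refine Finset.sum_congr rfl fun J _ => ?_
      rw [Finset.mul_sum]
      exact Finset.sum_congr rfl fun m _ => mul_comm _ _
    have h2 : ∀ i, tWeight ν R Ξ i * ∑ m, ∑ J : Idx p, h m (J m) * Z i J ^ 2
        = ∑ m, tWeight ν R Ξ i * ∑ J : Idx p, h m (J m) * Z i J ^ 2 := fun i => Finset.mul_sum ..
    simp only [h1, h2]
    rw [Finset.sum_comm]
    simp only [hstat]
    rw [Finset.mul_sum]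
    exact Finset.sum_congr rfl fun m _ => by ring
  -- Summed over observations, the tangent bounds equal minus half of `n ∑ coDim p m ∑ h m a`, which
  -- is exactly compensated by the change of the log determinants.
  rw [Finset.sum_neg_distrib, ← Finset.mul_sum, hcross, ← Finset.mul_sum,
    Finset.sum_sub_distrib] at hsum
  unfold shapeObj
  simp only [hdet, mul_add, Finset.sum_add_distrib]
  linarith

/-! ### The adaptive penalized least squares estimator -/

theorem design_gram_posDef {x : Fin n → Fin q → ℝ}
    (hx : IsUnit (designMat x * (designMat x)ᵀ).det) : (designMat x * (designMat x)ᵀ).PosDef := by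
  have h : (designMat x * (designMat x)ᵀ).PosSemidef := by
    simpa [conjTranspose_eq_transpose_of_trivial] using
      posSemidef_self_mul_conjTranspose (designMat x)
  exact h.posDef_iff_det_ne_zero.2 (isUnit_iff_ne_zero.1 hx)

theorem aplUpdate_eq (x : Fin n → Fin q → ℝ) (z : Fin n → ℝ) (lam : ℝ) (r : Fin q → ℝ) :
    aplUpdate x z lam r = lassoUpdate (designMat x * (designMat x)ᵀ) (designMat x *ᵥ z)
      (fun k => lam * r k / 2) := by
  funext b k
  unfold aplUpdate lassoUpdate
  have h1 : ∑ i, (z i - ∑ l, Function.update b k 0 l * x i l) * x i k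
      = (designMat x *ᵥ z) k
        - ((designMat x * (designMat x)ᵀ) *ᵥ Function.update b k 0) k := by
    rw [← mulVec_mulVec, ← Pi.sub_apply, ← mulVec_sub]
    simp only [mulVec, dotProduct, designMat, transpose_apply, Pi.sub_apply]
    refine Finset.sum_congr rfl fun i _ => ?_
    rw [mul_comm]
    congr 2
    exact Finset.sum_congr rfl fun l _ => mul_comm _ _
  have h2 : ∑ i, x i k ^ 2 = (designMat x * (designMat x)ᵀ) k k := by
    simp [mul_apply, designMat, pow_two]
  rw [h1, h2]

theorem aplObj_eq (x : Fin n → Fin q → ℝ) (y : Fin n → Tensor p) (lam : ℝ) (r B : CoefTensor p q) :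
    aplObj x y lam r B = ∑ J, (∑ i, y i J ^ 2 + lassoObj (designMat x * (designMat x)ᵀ)
      (designMat x *ᵥ fun i => y i J) (fun k => lam * r (J, k) / 2) fun k => B (J, k)) := by
  have h1 : ∀ J, ∑ i, resid x y B i J ^ 2 = ∑ i, y i J ^ 2
      + ((fun k => B (J, k)) ⬝ᵥ (designMat x * (designMat x)ᵀ) *ᵥ (fun k => B (J, k))
      - 2 * ((designMat x *ᵥ fun i => y i J) ⬝ᵥ fun k => B (J, k))) := fun J => by
    set b : Fin q → ℝ := fun k => B (J, k) with hb
    have h2 : b ⬝ᵥ (designMat x * (designMat x)ᵀ) *ᵥ b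
        = ∑ i, ((designMat x)ᵀ *ᵥ b) i ^ 2 := by
      rw [← mulVec_mulVec, dotProduct_mulVec, ← mulVec_transpose]
      exact Finset.sum_congr rfl fun i _ => (pow_two _).symm
    have h3 : (designMat x *ᵥ fun i => y i J) ⬝ᵥ b = ∑ i, ((designMat x)ᵀ *ᵥ b) i * y i J := by
      rw [dotProduct_comm, dotProduct_mulVec, ← mulVec_transpose]
      rfl
    rw [h2, h3, Finset.mul_sum, ← Finset.sum_sub_distrib, ← Finset.sum_add_distrib]
    refine Finset.sum_congr rfl fun i _ => ?_
    have h4 : resid x y B i J = y i J - ((designMat x)ᵀ *ᵥ b) i := by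
      simp only [resid, Pi.sub_apply, vecProd, mulVec, dotProduct, designMat, transpose_apply, hb]
      congr 1
      exact Finset.sum_congr rfl fun k _ => mul_comm _ _
    rw [h4]
    ring
  unfold aplObj adaPenalty lassoObj
  rw [Finset.sum_comm, Fintype.sum_prod_type, Finset.mul_sum, ← Finset.sum_add_distrib]
  refine Finset.sum_congr rfl fun J _ => ?_
  rw [h1 J, add_assoc]
  congr 2
  rw [Finset.mul_sum, Finset.mul_sum]
  exact Finset.sum_congr rfl fun k _ => by ring

/-- Testing the subgradient inequality with `d = b j` and `d = -b j` gives both inequalities. -/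
theorem eq_of_lassoStationary {ι : Type*} [Fintype ι] {H : Matrix ι ι ℝ} {c τ b : ι → ℝ} {j : ι}
    (h : LassoStationary H c τ b j) (hb : b j ≠ 0) :
    c j - (H *ᵥ b) j = τ j * (SignType.sign (b j) : ℝ) := by
  have h1 := h (b j)
  have h2 := h (-b j)
  rw [add_neg_cancel, abs_zero, zero_sub] at h2
  have h3 : |b j + b j| = 2 * |b j| := by rw [← two_mul, abs_mul, abs_two]
  rw [h3] at h1
  have h4 : (c j - (H *ᵥ b) j) * b j = τ j * |b j| := by linarith
  rcases lt_or_gt_of_ne hb with hneg | hpos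
  · rw [abs_of_neg hneg] at h4
    rw [sign_neg hneg]
    refine mul_right_cancel₀ hb ?_
    rw [h4]
    simp
  · rw [abs_of_pos hpos] at h4
    rw [sign_pos hpos]
    refine mul_right_cancel₀ hb ?_
    rw [h4]
    simp

/-- Links the estimator to general position. The pattern is read off the solution and so depends on
the data, which is why `Regular` quantifies over all patterns. -/
theorem resid_eq_patternTensor {x : Fin n → Fin q → ℝ} {y : Fin n → Tensor p} {lam : ℝ}
    (hx : IsUnit (designMat x * (designMat x)ᵀ).det) {B : CoefTensor p q}
    (hB : ∀ J k, LassoStationary (designMat x * (designMat x)ᵀ) (designMat x *ᵥ fun i => y i J)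
      (fun k => lam * adaWeight x y (J, k) / 2) (fun k => B (J, k)) k) :
    resid x y B = patternTensor x lam (fun J k => SignType.sign (B (J, k))) y := by
  funext i J
  have h := eq_patternResid (lam := lam) (s := fun k => SignType.sign (B (J, k))) hx
    (b := fun k => B (J, k)) (z := fun i => y i J) (fun k hk => sign_eq_zero_iff.1 hk) (fun k hk => by
      have h1 := eq_of_lassoStationary (hB J k) (fun h0 => hk (sign_eq_zero_iff.2 h0))
      rw [← mulVec_mulVec, ← Pi.sub_apply, ← mulVec_sub] at h1
      rw [h1, signedThreshold, adaWeight, ols_eq_olsVec]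
      ring)
  have h2 := congrFun h i
  rw [patternTensor, ← h2]
  simp only [resid, vecProd, Pi.sub_apply, mulVec, dotProduct, designMat, transpose_apply]
  congr 1
  exact Finset.sum_congr rfl fun k _ => mul_comm _ _

/-! ### The one-step estimator -/

/-- The matrix of the quadratic part of `ostObj`. -/
noncomputable def ostMat (x : Fin n → Fin q → ℝ) (w : Fin n → ℝ) (Ξ : Shape p) :
    Matrix (Idx p × Fin q) (Idx p × Fin q) ℝ :=
  fun j l => ∑ i, w i * (piKron (shapeInv Ξ) j.1 l.1 * x i l.2 * x i j.2)

/-- The vector of the linear part of `ostObj`. -/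
noncomputable def ostVec (x : Fin n → Fin q → ℝ) (y : Fin n → Tensor p) (w : Fin n → ℝ)
    (Ξ : Shape p) : CoefTensor p q :=
  fun j => ∑ i, w i * (tucker (y i) (shapeInv Ξ) j.1 * x i j.2)

theorem ostMat_mulVec (x : Fin n → Fin q → ℝ) (w : Fin n → ℝ) (Ξ : Shape p) (B : CoefTensor p q)
    (j : Idx p × Fin q) :
    (ostMat x w Ξ *ᵥ B) j = ∑ i, w i * (tucker (vecProd B (x i)) (shapeInv Ξ) j.1 * x i j.2) := by
  simp only [ostMat, mulVec, dotProduct, Finset.sum_mul]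
  rw [Finset.sum_comm]
  refine Finset.sum_congr rfl fun i _ => ?_
  rw [tucker_eq_mulVec, Fintype.sum_prod_type]
  simp only [mulVec, dotProduct, vecProd, Finset.mul_sum, Finset.sum_mul]
  exact Finset.sum_congr rfl fun L _ => Finset.sum_congr rfl fun l _ => by ring

theorem dotProduct_weighted (x : Fin n → Fin q → ℝ) (w : Fin n → ℝ) (T : Fin n → Tensor p)
    (B : CoefTensor p q) :
    B ⬝ᵥ (fun j => ∑ i, w i * (T i j.1 * x i j.2)) = ∑ i, w i * (T i ⬝ᵥ vecProd B (x i)) := by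
  simp only [dotProduct, vecProd, Finset.mul_sum]
  rw [Finset.sum_comm]
  refine Finset.sum_congr rfl fun i _ => ?_
  rw [Fintype.sum_prod_type]
  exact Finset.sum_congr rfl fun J _ => Finset.sum_congr rfl fun k _ => by ring

theorem ostMat_quad (x : Fin n → Fin q → ℝ) (w : Fin n → ℝ) (Ξ : Shape p) (B : CoefTensor p q) :
    B ⬝ᵥ ostMat x w Ξ *ᵥ B = ∑ i, w i * mahaSq Ξ (vecProd B (x i)) := by
  rw [funext (ostMat_mulVec x w Ξ B),
    dotProduct_weighted x w fun i => tucker (vecProd B (x i)) (shapeInv Ξ)]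
  rfl

/-- A nonzero `B` has a nonzero slice in some response entry, and the invertible Gram matrix gives
it a nonzero fitted value at some observation; all weights and the shape are positive. -/
theorem ostMat_posDef {x : Fin n → Fin q → ℝ} (hx : IsUnit (designMat x * (designMat x)ᵀ).det)
    {w : Fin n → ℝ} (hw : ∀ i, 0 < w i) {Ξ : Shape p} (hΞ : IsPD Ξ) : (ostMat x w Ξ).PosDef := by
  have hK := posDef_transpose_eq (piKron_posDef fun m => (hΞ m).inv)
  refine posDef_of_quad_pos ?_ fun B hB => ?_
  · ext j l
    simp only [transpose_apply, ostMat]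
    refine Finset.sum_congr rfl fun i _ => ?_
    have h : piKron (shapeInv Ξ) l.1 j.1 = piKron (shapeInv Ξ) j.1 l.1 :=
      congrFun (congrFun hK j.1) l.1
    rw [h]
    ring
  · rw [ostMat_quad]
    obtain ⟨i, hi⟩ : ∃ i, vecProd B (x i) ≠ 0 := by
      by_contra hcon
      push Not at hcon
      obtain ⟨⟨J, k⟩, hJ⟩ := Function.ne_iff.1 hB
      refine design_transpose_mulVec_ne_zero hx (b := fun k => B (J, k))
        (Function.ne_iff.2 ⟨k, hJ⟩) ?_
      ext i
      have h := congrFun (hcon i) J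
      simp only [vecProd] at h
      simp only [mulVec, dotProduct, designMat, transpose_apply]
      refine Eq.trans (Finset.sum_congr rfl fun k _ => mul_comm _ _) h
    exact Finset.sum_pos' (fun i _ => mul_nonneg (hw i).le (mahaSq_nonneg hΞ _))
      ⟨i, Finset.mem_univ i, mul_pos (hw i) (mahaSq_pos hΞ hi)⟩

theorem tucker_sub (A A' : Tensor p) (G : Shape p) :
    tucker (A - A') G = tucker A G - tucker A' G := by
  rw [tucker_eq_mulVec, mulVec_sub]
  rfl

theorem ostUpdate_eq (x : Fin n → Fin q → ℝ) (y : Fin n → Tensor p) (lam : ℝ)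
    (r : CoefTensor p q) (w : Fin n → ℝ) (Ξ : Shape p) :
    ostUpdate x y lam r w Ξ = lassoUpdate (ostMat x w Ξ) (ostVec x y w Ξ)
      (fun j => lam * r j / 2) := by
  funext B j
  unfold ostUpdate lassoUpdate
  congr 1
  · rw [ostMat_mulVec, ostVec, ← Finset.sum_sub_distrib]
    refine Finset.sum_congr rfl fun i _ => ?_
    rw [resid, tucker_sub, Pi.sub_apply]
    ring
  · refine Finset.sum_congr rfl fun i _ => ?_
    simp only [piKron, shapeInv]
    ring

theorem ostObj_eq (x : Fin n → Fin q → ℝ) (y : Fin n → Tensor p) (lam : ℝ) (r : CoefTensor p q)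
    (w : Fin n → ℝ) {Ξ : Shape p} (hΞ : IsPD Ξ) (B : CoefTensor p q) :
    ostObj x y lam r w Ξ B = ∑ i, w i * mahaSq Ξ (y i)
      + lassoObj (ostMat x w Ξ) (ostVec x y w Ξ) (fun j => lam * r j / 2) B := by
  have h1 : ostVec x y w Ξ ⬝ᵥ B
      = ∑ i, w i * (tucker (y i) (shapeInv Ξ) ⬝ᵥ vecProd B (x i)) := by
    rw [dotProduct_comm]
    exact dotProduct_weighted x w (fun i => tucker (y i) (shapeInv Ξ)) B
  have h2 : ∀ A A' : Tensor p, mahaSq Ξ (A - A')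
      = mahaSq Ξ A - 2 * (tucker A (shapeInv Ξ) ⬝ᵥ A') + mahaSq Ξ A' := fun A A' => by
    have hK := (piKron_posDef fun m => (hΞ m).inv).isHermitian
    have h3 : A ⬝ᵥ piKron (shapeInv Ξ) *ᵥ A' = A' ⬝ᵥ piKron (shapeInv Ξ) *ᵥ A :=
      dotProduct_mulVec_comm hK A A'
    rw [mahaSq_eq_kronQuad, mahaSq_eq_kronQuad, mahaSq_eq_kronQuad, kronQuad, kronQuad, kronQuad,
      tucker_eq_mulVec, dotProduct_comm _ A', mulVec_sub, dotProduct_sub, sub_dotProduct,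
      sub_dotProduct, h3]
    ring
  have h4 : lam * ∑ j, r j * |B j| = 2 * ∑ j, lam * r j / 2 * |B j| := by
    rw [Finset.mul_sum, Finset.mul_sum]
    exact Finset.sum_congr rfl fun j _ => by ring
  unfold ostObj adaPenalty lassoObj
  rw [ostMat_quad, h1, h4, ← add_assoc]
  congr 1
  rw [Finset.mul_sum, ← Finset.sum_sub_distrib, ← Finset.sum_add_distrib]
  refine Finset.sum_congr rfl fun i _ => ?_
  rw [resid, h2]
  ring

/-- Coordinate descent for `ostObj` converges to the unique global minimizer. -/
theorem exists_ost_minimizer {x : Fin n → Fin q → ℝ}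
    (hx : IsUnit (designMat x * (designMat x)ᵀ).det) (y : Fin n → Tensor p) {lam : ℝ}
    {r : CoefTensor p q} (hτ : ∀ j, 0 ≤ lam * r j / 2) {w : Fin n → ℝ} (hw : ∀ i, 0 < w i)
    {Ξ : Shape p} (hΞ : IsPD Ξ) :
    ∃ Bost : CoefTensor p q,
      (∀ order : List (Idx p × Fin q), IsOrder order → ∀ B : CoefTensor p q,
        Tendsto (fun t : ℕ => (coordSweep (ostUpdate x y lam r w Ξ) order)^[t] B)
          atTop (𝓝 Bost)) ∧
      (∀ B, B ≠ Bost → ostObj x y lam r w Ξ Bost < ostObj x y lam r w Ξ B) := by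
  have hH := ostMat_posDef hx hw hΞ
  obtain ⟨b, hb⟩ := exists_lassoStationary (c := ostVec x y w Ξ) hH hτ
  refine ⟨b, fun order ho B => ?_, fun B hB => ?_⟩
  · rw [ostUpdate_eq]
    exact tendsto_coordSweep_lassoUpdate hH hτ hb ho.2 B
  · rw [ostObj_eq x y lam r w hΞ, ostObj_eq x y lam r w hΞ]
    have := lassoObj_lt_of_stationary hH hb hB
    linarith

end TensorReg

/-! ### The main theorem -/

open TensorReg
theorem mainTheorem5 {Ω : Type*} [MeasurableSpace Ω] (μ : Measure Ω) [IsProbabilityMeasure μ]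
    {M n q : ℕ} (p : Fin M → ℕ) (hM : 0 < M) (hp : ∀ m, 0 < p m)
    (hn : ∀ m, p m < n * coDim p m)
    -- degrees of freedom used by the algorithm, true degrees of freedom, tuning parameter
    (ν νtrue lam : ℝ) (hν : 0 < ν) (hνtrue : 0 < νtrue) (hlam : 0 < lam)
    -- the tensor response regression model
    (B₀ : CoefTensor p q) (Ξ₀ : Shape p) (hΞ₀ : IsPD Ξ₀)
    (X : Fin n → Ω → Fin q → ℝ) (E Y : Fin n → Ω → Tensor p)
    (hXm : ∀ i, Measurable (X i)) (hEm : ∀ i, Measurable (E i))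
    (hElaw : ∀ i, μ.map (E i) = tensorT 0 Ξ₀ νtrue)
    (hEindep : iIndepFun E μ)
    (hXE : IndepFun (fun ω i => X i ω) (fun ω i => E i ω) μ)
    (hY : ∀ i ω, Y i ω = vecProd B₀ (X i ω) + E i ω)
    -- the ordinary least squares estimator is well defined
    (hX : ∀ᵐ ω ∂μ, IsUnit (designMat (fun i => X i ω) *
      (designMat (fun i => X i ω)).transpose).det) :
    ∀ᵐ ω ∂μ,
      ∀ (x : Fin n → Fin q → ℝ) (y : Fin n → Tensor p) (r : CoefTensor p q),
      x = (fun i => X i ω) → y = (fun i => Y i ω) → r = adaWeight x y →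
      -- the penalty weights are well defined
      (∀ j, ols x y j ≠ 0) ∧
      -- coordinate descent on the sub-problems converges to the global solution
      ∃ Bapl : CoefTensor p q,
        (∀ (J : Idx p) (order : List (Fin q)), IsOrder order → ∀ b : Fin q → ℝ,
          Tendsto
            (fun t : ℕ => (coordSweep
              (aplUpdate x (fun i => y i J) lam (fun k => r (J, k))) order)^[t] b)
            atTop (𝓝 (fun k => Bapl (J, k)))) ∧
        (∀ B, B ≠ Bapl → aplObj x y lam r Bapl < aplObj x y lam r B) ∧
        -- the shape updates are well defined
        (∀ (w : Fin n → ℝ) (Ξ : Shape p), (∀ i, 0 < w i) → IsPD Ξ →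
          ∀ m, (modeUpdate (resid x y Bapl) w Ξ m).PosDef) ∧
        -- every output of the shape estimation is a global solution
        ∀ (Ξ : ℕ → Shape p) (Ξhat : Shape p), IsShapeRun ν (resid x y Bapl) Ξ Ξhat →
          (∀ k, IsPD (Ξ k)) ∧ IsPD Ξhat ∧
          (∀ Ξ' : Shape p, IsPD Ξ' →
            shapeObj ν (resid x y Bapl) Ξhat ≤ shapeObj ν (resid x y Bapl) Ξ') ∧
          -- the final coordinate descent converges to the global solution
          ∃ Bost : CoefTensor p q,
            (∀ order : List (Idx p × Fin q), IsOrder order → ∀ B : CoefTensor p q,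
              Tendsto
                (fun t : ℕ => (coordSweep
                  (ostUpdate x y lam r (tWeight ν (resid x y Bapl) Ξhat) Ξhat) order)^[t] B)
                atTop (𝓝 Bost)) ∧
            (∀ B, B ≠ Bost →
              ostObj x y lam r (tWeight ν (resid x y Bapl) Ξhat) Ξhat Bost <
                ostObj x y lam r (tWeight ν (resid x y Bapl) Ξhat) Ξhat B) := by
  have hreg := ae_regular_model μ hlam B₀ Ξ₀ hXm hEm hElaw hEindep hXE hY hX
  filter_upwards [hreg, hX] with ω hω hxω
  intro x y r hx hy hr
  rw [← hx, ← hy] at hω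
  rw [← hx] at hxω
  have hn' : ∀ m, p m ≤ n * coDim p m := fun m => (hn m).le
  have hτ : ∀ j, 0 ≤ lam * r j / 2 := fun j => by
    rw [hr, adaWeight]
    positivity
  have hH := design_gram_posDef hxω
  -- (APL) splits into one lasso problem per response entry, all with the same Gram matrix; their
  -- solutions are assembled into `Bapl`.
  choose b hb using fun J : Idx p => exists_lassoStationary
    (c := (designMat x).mulVec fun i => y i J) hH fun k => hτ (J, k)
  set Bapl : CoefTensor p q := fun j => b j.1 j.2 with hBapl
  -- The only use of the random event beyond nonzero OLS coefficients; the rest of the argument is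
  -- deterministic.
  have hR : GenPos (resid x y Bapl) := by
    rw [resid_eq_patternTensor (lam := lam) hxω (B := Bapl) fun J k => by rw [← hr]; exact hb J k]
    exact hω.2 _
  refine ⟨hω.1, Bapl, fun J order ho b₀ => ?_, fun B hB => ?_,
    fun w Ξ hw hΞ m => modeUpdate_posDef hR (hp m) (hn' m) hw hΞ, fun Ξ Ξhat hrun => ?_⟩
  · rw [aplUpdate_eq]
    exact tendsto_coordSweep_lassoUpdate hH (fun k => hτ (J, k)) (hb J) ho.2 b₀
  · rw [aplObj_eq, aplObj_eq]
    obtain ⟨⟨J, k⟩, hJ⟩ := Function.ne_iff.1 hB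
    have hne : (fun k => B (J, k)) ≠ b J := Function.ne_iff.2 ⟨k, hJ⟩
    refine Finset.sum_lt_sum (fun J _ => ?_) ⟨J, Finset.mem_univ J, ?_⟩
    · by_cases h : (fun k => B (J, k)) = b J
      · rw [h]
      · exact add_le_add_right (lassoObj_lt_of_stationary hH (hb J) h).le _
    · exact add_lt_add_right (lassoObj_lt_of_stationary hH (hb J) hne) _
  · obtain ⟨hhat, hfix⟩ := hrun.output hν hM hR hp hn'
    have hnp : ∀ m, (n : ℝ) * coDim p m ≠ 0 := fun m => by
      exact_mod_cast ((hp m).trans_le (hn' m)).ne'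
    exact ⟨fun k => (hrun.isPD_and_roundSpec hν hM hR hp hn' k).1, hhat,
      fun Ξ' hΞ' => shapeObj_le_of_fixed hν hhat hΞ' hnp hfix,
      exists_ost_minimizer hxω y hτ (tWeight_pos hν _ hhat) hhat⟩
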